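/- Let $d\ge 1$, let $0<s<d$, and let $v_1,\dots,v_d$ be a basis of $\mathbb R^d$. Put $\Lambda=\mathbb Z v_1+\dots+\mathbb Z v_d$, with co-volume $|\Lambda|$, fundamental domain $\Omega=\{\sum_i t_iv_i: t_i\in[0,1)\}$ (representing the flat torus $\mathbb R^d/\Lambda$), normalized Lebesgue measure $\mu$ on $\Omega$, and dual lattice $\Lambda^*=\{x:\langle x,\lambda\rangle\in\mathbb Z\ \forall \lambda\in\Lambda\}$. Let $\nu$ be the multiple of Lebesgue measure that gives measure $1$ to a fundamental domain of $\Lambda^*$. For $\mathcal D\subset\mathbb R^d$ and $0<t<d$ put $$I_\nu^{\mathcal D}(t)=\int_{\mathcal D\times\mathcal D}\frac{d\nu(x)\,d\nu(y)}{|x-y|^t}.$$ For $x\notin\Lambda$ let $$F_{s,\Lambda}(x)=\sum_{v\in\Lambda}\int_1^\infty e^{-|x+v|^2t}\frac{t^{s/2-1}}{\Gamma(s/2)}\,dt+\frac1{|\Lambda|}\sum_{w\in\Lambda^*\setminus\{0\}}e^{2\pi i\langle x,w\rangle}\int_0^1\frac{\pi^{d/2}}{t^{d/2}}e^{-\pi^2|w|^2/t}\frac{t^{s/2-1}}{\Gamma(s/2)}\,dt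 ,$$ and let $E_{s,\Lambda}(x_1,\dots,x_n)=\sum_{k\ne j}F_{s,\Lambda}(x_k-x_j)$ be the periodic Riesz $s$-energy. For a bounded set $\mathcal D$ and $N\ge 0$ let $\kappa_N$ be the indicator function of $\Lambda^*\cap N^{1/d}\mathcal D$ on $\Lambda^*$ (the family $\kappa^{\mathcal D,\Lambda}=(\kappa_N)_{N\ge0}$), let $t_N=\sum_{w\in\Lambda^*}\kappa_N(w)$ and $K_N(u,u')=\sum_{w\in\Lambda^*}\kappa_N(w)e^{2\pi i\langle u-u',w\rangle}$. A determinantal process with kernel $K_N$ is a random vector $(x_1,\dots,x_{t_N})$ of almost surely distinct points of $\Omega$ whose joint intensities with respect to $\mu$ are $\det(K_N(y_i,y_j))_{i,j\le k}$, that is, for all $k$ and all pairwise disjoint Borel sets $B_1,\dots,B_k\subset\Omega$ the numbers $\mathcal X(B_j)$ of points in $B_j$ satisfy $\mathbb E[\mathcal X(B_1)\cdots\mathcal X(B_k)]=\int_{B_1\times\dots\times B_k}\det(K_N(y_i,y_j))\,d\mu^k(y)$. Let $\mathcal D\subset\mathbb R^d$ be open and bounded, and let $\mathcal D^*$ be the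 open ball centered at the origin with radius $(d|\mathcal D|/\omega_{d-1})^{1/d}$, where $\omega_{d-1}=d\,\pi^{d/2}/\Gamma(\frac d2+1)$. (1) $|\mathcal D^*|=|\mathcal D|$, the integral $I_\nu^{\mathcal D}(d-s)$ is finite, and $I_\nu^{\mathcal D}(d-s)\le I_\nu^{\mathcal D^*}(d-s)$. (2) Suppose moreover that $\mathcal D$ is non-empty and that its boundary has Lebesgue measure zero. For $\mathcal G\in\{\mathcal D,\mathcal D^*\}$ put $$C_{\mathcal G}=-\frac{\pi^{s-\frac d2}\,\Gamma(\frac{d-s}2)}{\Gamma(\frac s2)\,|\Lambda|}\cdot\frac{I_\nu^{\mathcal G}(d-s)}{(|\Lambda||\mathcal G|)^{1+s/d}}$$ (the last denominator is $1$ under the normalization $|\Lambda||\mathcal G|=1$). Then for the family $\kappa^{\mathcal G,\Lambda}$, determinantal processes with kernels $K_N$ exist for all $N$, $t_N\to\infty$ as $N\to\infty$, and for every choice of such processes the energy $E_{s,\Lambda}$ is integrable for every $N$ and, as $N\to\infty$, $$\mathbb E\big(E_{s,\Lambda}(x_1,\dots,x_{t_N})\big)=\frac{2\pi^{d/2}}{|\Lambda|\,\Gamma(\frac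 s2)(d-s)}\,t_N^2+C_{\mathcal G}\,t_N^{1+s/d}+o\big(t_N^{1+s/d}\big).$$ Moreover $C_{\mathcal D^*}\le C_{\mathcal D}$; that is, among the domains of a given volume the ball gives the lowest asymptotic expected Riesz energy. -/

import Mathlib

open MeasureTheory Module

namespace FlatTorus

/-- The Euclidean space `ℝ^d`. -/
abbrev E (d : ℕ) : Type := EuclideanSpace ℝ (Fin d)

/-- The lattice `Λ = A ℤ^d`, where the columns of the nonsingular matrix `A` are the vectors of
the basis `v` of `ℝ^d`. -/
noncomputable def lattice {d : ℕ} (v : Basis (Fin d) ℝ (E d)) : Submodule ℤ (E d) :=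
  Submodule.span ℤ (Set.range v)

/-- The co-volume `|Λ|`. -/
noncomputable def covol {d : ℕ} (v : Basis (Fin d) ℝ (E d)) : ℝ :=
  ZLattice.covolume (lattice v) volume

/-- The fundamental domain `Ω = {t₁ v₁ + ⋯ + t_d v_d : tᵢ ∈ [0,1)}`, which represents the flat
torus `ℝ^d / Λ`. -/
noncomputable def torus {d : ℕ} (v : Basis (Fin d) ℝ (E d)) : Set (E d) :=
  ZSpan.fundamentalDomain v

/-- The normalized Lebesgue measure on `Ω`. -/
noncomputable def torusMeasure {d : ℕ} (v : Basis (Fin d) ℝ (E d)) : Measure (E d) :=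
  ProbabilityTheory.cond volume (torus v)

/-- The dual lattice `Λ* = {x : ⟨x, l⟩ ∈ ℤ for all l ∈ Λ}`. -/
noncomputable def dualLattice {d : ℕ} (v : Basis (Fin d) ℝ (E d)) : Submodule ℤ (E d) :=
  LinearMap.BilinForm.dualSubmodule (innerₗ (E d)) (lattice v)

theorem mem_dualLattice {d : ℕ} (v : Basis (Fin d) ℝ (E d)) (x : E d) :
    x ∈ dualLattice v ↔ ∀ l ∈ lattice v, ∃ n : ℤ, (n : ℝ) = inner ℝ x l := by
  simp [dualLattice, LinearMap.BilinForm.mem_dualSubmodule, Submodule.mem_one]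

/-- The multiple `ν` of the Lebesgue measure for which a fundamental domain of the dual lattice
has measure one. -/
noncomputable def nu {d : ℕ} (v : Basis (Fin d) ℝ (E d)) : Measure (E d) :=
  ENNReal.ofReal (ZLattice.covolume (dualLattice v) volume)⁻¹ • (volume : Measure (E d))

/-- The potential `I_ν^D(t) = ∫_{D × D} |x - y|^{-t} dν(x) dν(y)`. -/
noncomputable def potential {d : ℕ} (v : Basis (Fin d) ℝ (E d)) (D : Set (E d)) (t : ℝ) : ℝ :=
  ∫ p in D ×ˢ D, 1 / ‖p.1 - p.2‖ ^ t ∂((nu v).prod (nu v))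

/-- The surface measure `ω_{d-1} = d π^{d/2} / Γ(d/2 + 1)` of the unit sphere of `ℝ^d`. -/
noncomputable def sphereArea (d : ℕ) : ℝ :=
  d * (Real.pi ^ ((d : ℝ) / 2) / Real.Gamma ((d : ℝ) / 2 + 1))

/-- The open ball `D*` centered at the origin with the same volume as `D`. -/
noncomputable def ballOf {d : ℕ} (D : Set (E d)) : Set (E d) :=
  Metric.ball 0 ((d * volume.real D / sphereArea d) ^ (1 / (d : ℝ)))

/-- The function `F_{s,Λ}(x)` for `x ∉ Λ` (by the symmetry `w ↦ -w` the second sum is real).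
The values at `x ∈ Λ` are irrelevant. -/
noncomputable def rieszKernel {d : ℕ} (v : Basis (Fin d) ℝ (E d)) (s : ℝ) (x : E d) : ℝ :=
  (∑' l : lattice v, ∫ t in Set.Ioi (1 : ℝ),
      Real.exp (-‖x + (l : E d)‖ ^ 2 * t) * (t ^ (s / 2 - 1) / Real.Gamma (s / 2)))
  + (1 / covol v) *
    (∑' w : {w : dualLattice v // w ≠ 0},
      Complex.exp (2 * Real.pi * Complex.I * (inner ℝ x (w : E d) : ℝ)) *
        ((∫ t in Set.Ioc (0 : ℝ) 1,
          Real.pi ^ ((d : ℝ) / 2) / t ^ ((d : ℝ) / 2) *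
            Real.exp (-(Real.pi ^ 2 * ‖(w : E d)‖ ^ 2) / t) *
            (t ^ (s / 2 - 1) / Real.Gamma (s / 2)) : ℝ) : ℂ)).re

/-- The periodic Riesz `s`-energy `∑_{k ≠ j} F_{s,Λ}(x_k - x_j)`. -/
noncomputable def rieszEnergy {d : ℕ} (v : Basis (Fin d) ℝ (E d)) (s : ℝ) {n : ℕ}
    (x : Fin n → E d) : ℝ :=
  ∑ p ∈ (Finset.univ : Finset (Fin n)).offDiag, rieszKernel v s (x p.1 - x p.2)

/-- The kernel `K(u, u') = ∑_{w ∈ Λ*} κ(w) e^{2 π i ⟨u - u', w⟩}` of a finitely supported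
function `κ` on the dual lattice. -/
noncomputable def kernel {d : ℕ} (v : Basis (Fin d) ℝ (E d)) (κ : dualLattice v → ℕ)
    (u u' : E d) : ℂ :=
  ∑ᶠ w : dualLattice v,
    (κ w : ℂ) * Complex.exp (2 * Real.pi * Complex.I * (inner ℝ (u - u') (w : E d) : ℝ))

open scoped Pointwise Classical in
/-- The functions `κ_N` of the family `κ^{D,Λ}`: the indicator function of `N^{1/d} D` on the
dual lattice. -/
noncomputable def kappa {d : ℕ} (v : Basis (Fin d) ℝ (E d)) (D : Set (E d)) (N : ℕ)
    (w : dualLattice v) : ℕ :=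
  if (w : E d) ∈ ((N : ℝ) ^ (1 / (d : ℝ))) • D then 1 else 0

/-- The trace `t_N = ∑_{w ∈ Λ*} κ_N(w)`. -/
noncomputable def trace {d : ℕ} (v : Basis (Fin d) ℝ (E d)) (D : Set (E d)) (N : ℕ) : ℕ :=
  ∑ᶠ w : dualLattice v, kappa v D N w

/-- `P` is the law of a random vector `(x_1, …, x_n)` of points of `Ω` which form a
determinantal point process with kernel `K` and background measure `μ`: the process is simple
and its joint intensities with respect to `μ` are `ρ_k = det (K(y_i, y_j))`, i.e. for pairwise
disjoint Borel sets `B_1, …, B_k` in `Ω` the numbers `X(B_j)` of points in `B_j` satisfy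
`𝔼[X(B_1) ⋯ X(B_k)] = ∫_{B_1 × ⋯ × B_k} ρ_k dμ^k`. -/
structure IsDeterminantal {d : ℕ} (Ω : Set (E d)) (μ : Measure (E d)) (K : E d → E d → ℂ)
    {n : ℕ} (P : Measure (Fin n → E d)) : Prop where
  isProbabilityMeasure : IsProbabilityMeasure P
  mem_domain : ∀ᵐ x ∂P, ∀ i, x i ∈ Ω
  simple : ∀ᵐ x ∂P, Function.Injective x
  intensity : ∀ (k : ℕ) (B : Fin k → Set (E d)), (∀ j, MeasurableSet (B j)) → (∀ j, B j ⊆ Ω) →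
    Pairwise (fun i j => Disjoint (B i) (B j)) →
    ((∫ x, ∏ j, ∑ i, (B j).indicator (fun _ => (1 : ℝ)) (x i) ∂P : ℝ) : ℂ) =
      ∫ y in Set.univ.pi B, (Matrix.of fun i j => K (y i) (y j)).det
        ∂(Measure.pi fun _ : Fin k => μ)

/-- `P` is the law of the `t_N` points of the determinantal process on the flat torus given by
the `N`-th function of the family `κ^{D,Λ}`. -/
def IsProcess {d : ℕ} (v : Basis (Fin d) ℝ (E d)) (D : Set (E d)) (N : ℕ)
    (P : Measure (Fin (trace v D N) → E d)) : Prop :=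
  IsDeterminantal (torus v) (torusMeasure v) (kernel v (kappa v D N)) P

/-- The constant `2 π^{d/2} / (|Λ| Γ(s/2) (d - s))` in front of the leading term of the
energy. -/
noncomputable def leadingConst {d : ℕ} (v : Basis (Fin d) ℝ (E d)) (s : ℝ) : ℝ :=
  2 * Real.pi ^ ((d : ℝ) / 2) / (covol v * Real.Gamma (s / 2) * (d - s))

/-- `C` is the asymptotic expected Riesz `s`-energy of the determinantal processes given by
`κ^{D,Λ}`, i.e. the coefficient in
`𝔼 E_{s,Λ} = 2 π^{d/2} / (|Λ| Γ(s/2) (d - s)) t_N² + C t_N^{1+s/d} + o(t_N^{1+s/d})`.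
The first two parts say that the processes exist for every `N` and that `t_N → ∞`, so that the
last part is not void and determines `C`. -/
def HasAsymptoticEnergy {d : ℕ} (v : Basis (Fin d) ℝ (E d)) (D : Set (E d)) (s C : ℝ) : Prop :=
  (∀ N, ∃ P, IsProcess v D N P) ∧
  Filter.Tendsto (trace v D) Filter.atTop Filter.atTop ∧
  ∀ P : (N : ℕ) → Measure (Fin (trace v D N) → E d), (∀ N, IsProcess v D N (P N)) →
    (∀ N, Integrable (rieszEnergy v s) (P N)) ∧
    Asymptotics.IsLittleO Filter.atTop
      (fun N => ∫ x, rieszEnergy v s x ∂(P N)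
        - (leadingConst v s * (trace v D N : ℝ) ^ 2
          + C * (trace v D N : ℝ) ^ (1 + s / d)))
      (fun N => (trace v D N : ℝ) ^ (1 + s / d))

/-- The constant `- π^{s-d/2} Γ((d-s)/2) / (Γ(s/2) |Λ|) · I_ν^D(d-s) / (|Λ||D|)^{1+s/d}`; the last
denominator is `1` under the normalization `|Λ||D| = 1`. -/
noncomputable def energyCoeff {d : ℕ} (v : Basis (Fin d) ℝ (E d)) (D : Set (E d)) (s : ℝ) : ℝ :=
  -(Real.pi ^ (s - (d : ℝ) / 2) * Real.Gamma ((d - s) / 2) / (Real.Gamma (s / 2) * covol v))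
    * (potential v D (d - s) / (covol v * volume.real D) ^ (1 + s / d))

end FlatTorus

/-! The expected energy has an exact formula. The two-point intensity of the process is `t_N² -
|K_N(u,u')|²`, a function of `u - u'`, so the expectation is a single integral over the torus of
this intensity against the kernel `F` (`IsProcess.energy`). Expanding `|K_N|²` into the characters
of `w - w'` leaves only Fourier coefficients of `F`. In the definition of `F` the Gaussian integral
is split at `t = 1`; by unfolding the lattice sum, the part over `(1,∞)` and the part over `(0,1]`
join again to one Gamma integral, so the coefficient at `w ≠ 0` is a constant times `|w|^{s-d}`. At
`w = 0` only the part over `(1,∞)` is present and gives the leading constant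
(`setIntegral_rieszKernel_mul_char`). The energy is therefore the leading constant times `t_N² -
t_N`, minus a constant times the sum of `|w-w'|^{s-d}` over the pairs of distinct frequencies.

That double sum is a Riemann sum. With every lattice point replaced by its cell, of `ν`-measure one,
and everything rescaled by `N^{-1/d}`, dominated convergence gives `N^{1+s/d} I_ν(d-s)`
asymptotically (`tendsto_pair_sum_div`). The singularity is harmless because distinct lattice points
are separated. In the same way `t_N / N` tends to `ν(G) = |Λ||G|`, and the linear term `t_N` is of
lower order.

The processes exist because distinct characters are orthonormal: the normalized squared modulus of
their determinant is a density with the required intensities (`isDeterminantal_slater`). Conversely,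
the intensities on disjoint sets determine the law of the pairs of distinct points
(`pairMeasure_eq`), so the formula holds for every such process.

The comparison with the ball is Riesz's rearrangement inequality for a set and a decreasing kernel,
proved by polarization. Reflecting the part of a set beyond a hyperplane to the side of the origin,
wherever there is room, preserves volume and does not decrease the interaction
(`interaction_le_polarization`). Averaging over all hyperplanes shows that some polarization reduces
the excess of the set over the ball by a definite amount (`exists_reflection_gain`), so the infimum
of the excess is zero, and the interaction is continuous with respect to it. -/

namespace FlatTorus

/-! ### Lattices, covolumes and integrals of periodic functions -/

open scoped Pointwise

theorem innerₗ_nondegenerate (d : ℕ) : (innerₗ (E d) : LinearMap.BilinForm ℝ (E d)).Nondegenerate := by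
  refine ⟨fun x h => ?_, fun x h => ?_⟩
  · simpa using h x
  · simpa using h x

/-- The basis of `ℝ^d` which is dual to `v`. -/
noncomputable def dualBasis {d : ℕ} (v : Basis (Fin d) ℝ (E d)) : Basis (Fin d) ℝ (E d) :=
  LinearMap.BilinForm.dualBasis (innerₗ (E d)) (innerₗ_nondegenerate d) v

theorem inner_dualBasis {d : ℕ} (v : Basis (Fin d) ℝ (E d)) (i j : Fin d) :
    inner ℝ (dualBasis v i) (v j) = if j = i then (1 : ℝ) else 0 :=
  LinearMap.BilinForm.apply_dualBasis_left (hB := innerₗ_nondegenerate d) v i j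

theorem dualLattice_eq {d : ℕ} (v : Basis (Fin d) ℝ (E d)) :
    dualLattice v = lattice (dualBasis v) :=
  LinearMap.BilinForm.dualSubmodule_span_of_basis _ (innerₗ_nondegenerate d) v

instance {d : ℕ} (v : Basis (Fin d) ℝ (E d)) : DiscreteTopology (lattice v) := by
  unfold lattice; infer_instance

instance {d : ℕ} (v : Basis (Fin d) ℝ (E d)) : IsZLattice ℝ (lattice v) := by
  unfold lattice; infer_instance

instance {d : ℕ} (v : Basis (Fin d) ℝ (E d)) : Countable (lattice v) := by
  unfold lattice; infer_instance

instance {d : ℕ} (v : Basis (Fin d) ℝ (E d)) : DiscreteTopology (dualLattice v) := by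
  rw [dualLattice_eq]; infer_instance

instance {d : ℕ} (v : Basis (Fin d) ℝ (E d)) : IsZLattice ℝ (dualLattice v) := by
  simp only [dualLattice_eq]; infer_instance

instance {d : ℕ} (v : Basis (Fin d) ℝ (E d)) : Countable (dualLattice v) := by
  rw [dualLattice_eq]; infer_instance

instance {d : ℕ} (v : Basis (Fin d) ℝ (E d)) : MeasurableConstVAdd (lattice v) (E d) :=
  inferInstanceAs <| MeasurableConstVAdd (lattice v).toAddSubgroup (E d)

instance {d : ℕ} (v : Basis (Fin d) ℝ (E d)) : VAddInvariantMeasure (lattice v) (E d) volume :=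
  inferInstanceAs <| VAddInvariantMeasure (lattice v).toAddSubgroup (E d) volume

theorem isAddFundamentalDomain_torus {d : ℕ} (v : Basis (Fin d) ℝ (E d)) :
    IsAddFundamentalDomain (lattice v) (torus v) (volume : Measure (E d)) :=
  ZSpan.isAddFundamentalDomain v volume

theorem measurableSet_torus {d : ℕ} (v : Basis (Fin d) ℝ (E d)) : MeasurableSet (torus v) :=
  ZSpan.fundamentalDomain_measurableSet v

theorem isBounded_torus {d : ℕ} (v : Basis (Fin d) ℝ (E d)) : Bornology.IsBounded (torus v) :=
  ZSpan.fundamentalDomain_isBounded v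

theorem covol_pos {d : ℕ} (v : Basis (Fin d) ℝ (E d)) : 0 < covol v :=
  ZLattice.covolume_pos _ _

theorem volume_real_torus {d : ℕ} (v : Basis (Fin d) ℝ (E d)) : volume.real (torus v) = covol v :=
  (ZLattice.covolume_eq_measure_fundamentalDomain _ _ (isAddFundamentalDomain_torus v)).symm

theorem volume_torus_lt_top {d : ℕ} (v : Basis (Fin d) ℝ (E d)) : volume (torus v) < ⊤ :=
  (isBounded_torus v).measure_lt_top

theorem volume_torus {d : ℕ} (v : Basis (Fin d) ℝ (E d)) :
    volume (torus v) = ENNReal.ofReal (covol v) := by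
  rw [← volume_real_torus, ofReal_measureReal (volume_torus_lt_top v).ne]

theorem torusMeasure_eq {d : ℕ} (v : Basis (Fin d) ℝ (E d)) :
    torusMeasure v = ENNReal.ofReal (covol v)⁻¹ • (volume.restrict (torus v)) := by
  rw [torusMeasure, ProbabilityTheory.cond, volume_torus, ENNReal.ofReal_inv_of_pos (covol_pos v)]

instance {d : ℕ} (v : Basis (Fin d) ℝ (E d)) : IsProbabilityMeasure (torusMeasure v) := by
  apply ProbabilityTheory.cond_isProbabilityMeasure_of_finite
  · rw [volume_torus]
    simpa using covol_pos v
  · exact (volume_torus_lt_top v).ne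

instance {d : ℕ} [NeZero d] (v : Basis (Fin d) ℝ (E d)) : NullSingletonClass (torusMeasure v) := by
  rw [torusMeasure_eq]
  exact ⟨fun x => by simp⟩

theorem ae_mem_torus {d : ℕ} (v : Basis (Fin d) ℝ (E d)) :
    ∀ᵐ x ∂(torusMeasure v), x ∈ torus v := by
  rw [torusMeasure_eq]
  exact Measure.ae_smul_measure (ae_restrict_mem (measurableSet_torus v)) _

theorem integral_torusMeasure {d : ℕ} (v : Basis (Fin d) ℝ (E d)) {F : Type*}
    [NormedAddCommGroup F] [NormedSpace ℝ F] (f : E d → F) :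
    ∫ x, f x ∂(torusMeasure v) = (covol v)⁻¹ • ∫ x in torus v, f x := by
  rw [torusMeasure_eq, integral_smul_measure, ENNReal.toReal_ofReal (inv_nonneg.2 (covol_pos v).le)]

theorem integrable_torusMeasure {d : ℕ} (v : Basis (Fin d) ℝ (E d)) {F : Type*}
    [NormedAddCommGroup F] {f : E d → F} :
    Integrable f (torusMeasure v) ↔ IntegrableOn f (torus v) := by
  rw [torusMeasure_eq, integrable_smul_measure _ ENNReal.ofReal_ne_top, IntegrableOn]
  simpa using covol_pos v

/-- Biorthogonality says that the transposed coordinate matrix of one basis is inverse to the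
coordinate matrix of the other. This makes the covolumes of the two lattices reciprocal, so that `ν`
has density `covol v`. -/
theorem det_mul_det_dualBasis {d : ℕ} (v : Basis (Fin d) ℝ (E d)) :
    (EuclideanSpace.basisFun (Fin d) ℝ).toBasis.det v *
      (EuclideanSpace.basisFun (Fin d) ℝ).toBasis.det (dualBasis v) = 1 := by
  rw [Basis.det_apply, Basis.det_apply, ← Matrix.det_transpose, ← Matrix.det_mul]
  convert Matrix.det_one (n := Fin d) (R := ℝ)
  ext i j
  have := inner_dualBasis v j i
  rw [PiLp.inner_apply] at this
  simp only [Matrix.mul_apply, Matrix.transpose_apply, Basis.toMatrix_apply, Matrix.one_apply]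
  simpa [mul_comm] using this

theorem covol_eq_abs_det {d : ℕ} (v : Basis (Fin d) ℝ (E d)) :
    covol v = |(EuclideanSpace.basisFun (Fin d) ℝ).toBasis.det v| := by
  rw [← volume_real_torus, torus,
    ZSpan.measureReal_fundamentalDomain v volume (EuclideanSpace.basisFun (Fin d) ℝ).toBasis,
    measureReal_congr (ZSpan.fundamentalDomain_ae_parallelepiped _ volume), measureReal_def,
    OrthonormalBasis.coe_toBasis, OrthonormalBasis.volume_parallelepiped]
  simp

theorem covol_mul_covol_dual {d : ℕ} (v : Basis (Fin d) ℝ (E d)) :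
    covol v * covol (dualBasis v) = 1 := by
  rw [covol_eq_abs_det, covol_eq_abs_det, ← abs_mul, det_mul_det_dualBasis, abs_one]

theorem nu_eq {d : ℕ} (v : Basis (Fin d) ℝ (E d)) :
    nu v = ENNReal.ofReal (covol v) • (volume : Measure (E d)) := by
  have h : ZLattice.covolume (dualLattice v) volume = covol (dualBasis v) := by
    simp only [dualLattice_eq]; rfl
  rw [nu, h, inv_eq_of_mul_eq_one_left (covol_mul_covol_dual v)]

instance {d : ℕ} (v : Basis (Fin d) ℝ (E d)) : (nu v).IsAddHaarMeasure := by
  rw [nu_eq]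
  exact Measure.IsAddHaarMeasure.smul _ (by simpa using covol_pos v) ENNReal.ofReal_ne_top

theorem isAddFundamentalDomain_vadd_torus {d : ℕ} (v : Basis (Fin d) ℝ (E d)) (y : E d) :
    IsAddFundamentalDomain (lattice v) (y +ᵥ torus v) (volume : Measure (E d)) := by
  have : VAddCommClass (E d) (lattice v) (E d) :=
    ⟨fun a b c => by simp only [vadd_eq_add, Submodule.vadd_def]; abel⟩
  exact (isAddFundamentalDomain_torus v).vadd_of_comm y

/-- Translating the function amounts to translating the domain, and a translate of `Ω` is again a
fundamental domain. -/
theorem setIntegral_torus_sub {d : ℕ} (v : Basis (Fin d) ℝ (E d)) {F : Type*}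
    [NormedAddCommGroup F] [NormedSpace ℝ F] {f : E d → F}
    (hf : ∀ l ∈ lattice v, ∀ x, f (x + l) = f x) (y : E d) :
    ∫ x in torus v, f (x - y) = ∫ x in torus v, f x := by
  rw [(isAddFundamentalDomain_torus v).setIntegral_eq (isAddFundamentalDomain_vadd_torus v (-y))
    (f := f) (fun g x => by rw [Submodule.vadd_def, vadd_eq_add, add_comm, hf _ g.2])]
  have h := (measurePreserving_sub_right (volume : Measure (E d)) y).setIntegral_preimage_emb
    (MeasurableEquiv.subRight y).measurableEmbedding f (-y +ᵥ torus v)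
  rw [← h]
  congr 2
  ext x
  simp [Set.mem_vadd_set_iff_neg_vadd_mem]

theorem integrableOn_torus_sub {d : ℕ} (v : Basis (Fin d) ℝ (E d)) {F : Type*}
    [NormedAddCommGroup F] {f : E d → F}
    (hf : ∀ l ∈ lattice v, ∀ x, f (x + l) = f x) (h : IntegrableOn f (torus v)) (y : E d) :
    IntegrableOn (fun x => f (x - y)) (torus v) := by
  rw [(isAddFundamentalDomain_torus v).integrableOn_iff (isAddFundamentalDomain_vadd_torus v (-y))
    (f := f) (fun g x => by rw [Submodule.vadd_def, vadd_eq_add, add_comm, hf _ g.2])] at h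
  have hs : (fun x => x - y) ⁻¹' (-y +ᵥ torus v) = torus v := by
    ext x
    rw [Set.mem_preimage, Set.mem_vadd_set_iff_neg_vadd_mem, neg_neg, vadd_eq_add,
      add_sub_cancel]
  have h2 := (measurePreserving_sub_right (volume : Measure (E d)) y).integrableOn_comp_preimage
    (MeasurableEquiv.subRight y).measurableEmbedding (f := f) (s := -y +ᵥ torus v)
  rw [hs] at h2
  exact h2.2 h

theorem integrable_prod_torus_sub {d : ℕ} (v : Basis (Fin d) ℝ (E d)) {F : Type*}
    [NormedAddCommGroup F] {f : E d → F} (hm : StronglyMeasurable f)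
    (hf : ∀ l ∈ lattice v, ∀ x, f (x + l) = f x) (h : IntegrableOn f (torus v)) :
    Integrable (fun p : E d × E d => f (p.1 - p.2)) ((torusMeasure v).prod (torusMeasure v)) := by
  rw [integrable_prod_iff' (f := fun p : E d × E d => f (p.1 - p.2)) (hm.comp_measurable (by fun_prop)).aestronglyMeasurable]
  refine ⟨.of_forall fun y => (integrable_torusMeasure v).2 (integrableOn_torus_sub v hf h y), ?_⟩
  have : ∀ y, ∫ x, ‖f (x - y)‖ ∂(torusMeasure v) = ∫ x, ‖f x‖ ∂(torusMeasure v) := fun y => by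
    rw [integral_torusMeasure, integral_torusMeasure,
      setIntegral_torus_sub v (f := fun x => ‖f x‖) (fun l hl x => by simp only [hf l hl x])]
  simp only [this]
  exact integrable_const _

/-- By translation invariance the inner integral does not depend on the second variable. -/
theorem integral_prod_torus_sub {d : ℕ} (v : Basis (Fin d) ℝ (E d)) {F : Type*}
    [NormedAddCommGroup F] [NormedSpace ℝ F] [CompleteSpace F] {f : E d → F} (hm : StronglyMeasurable f)
    (hf : ∀ l ∈ lattice v, ∀ x, f (x + l) = f x) (h : IntegrableOn f (torus v)) :
    ∫ p : E d × E d, f (p.1 - p.2) ∂((torusMeasure v).prod (torusMeasure v)) =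
      (covol v)⁻¹ • ∫ x in torus v, f x := by
  rw [integral_prod_symm _ (integrable_prod_torus_sub v hm hf h)]
  have : ∀ y, ∫ x, f (x - y) ∂(torusMeasure v) = (covol v)⁻¹ • ∫ x in torus v, f x := fun y => by
    rw [integral_torusMeasure, setIntegral_torus_sub v hf]
  simp only [this, integral_const, probReal_univ, one_smul]

end FlatTorus

/-! ### Projection determinantal processes from orthonormal functions -/

namespace FlatTorus

open scoped ComplexConjugate

/-- The joint density of the points of the projection determinantal process with orthonormal
functions `φ`. -/
noncomputable def slater {Y : Type*} {n : ℕ} (φ : Fin n → Y → ℂ) (x : Fin n → Y) : ℝ :=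
  (n.factorial : ℝ)⁻¹ * ‖(Matrix.of fun i j => φ j (x i)).det‖ ^ 2

theorem slater_nonneg {Y : Type*} {n : ℕ} (φ : Fin n → Y → ℂ) (x : Fin n → Y) : 0 ≤ slater φ x := by
  unfold slater; positivity

theorem exists_slater_le {Y : Type*} {n : ℕ} (φ : Fin n → Y → ℂ) {C : ℝ} (hC : ∀ i x, ‖φ i x‖ ≤ C) :
    ∃ C', ∀ x, slater φ x ≤ C' := by
  refine ⟨(n.factorial : ℝ)⁻¹ * (n.factorial • |C| ^ n) ^ 2, fun x => ?_⟩
  unfold slater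
  gcongr
  have := Matrix.det_le (A := Matrix.of fun i j => φ j (x i))
    (abv := IsAbsoluteValue.toAbsoluteValue (norm : ℂ → ℝ)) (x := |C|)
    (fun i j => (hC j (x i)).trans (le_abs_self C))
  simpa using this

section Slater

variable {X : Type*} [MeasurableSpace X]

/-- Row `i` involves only the variable `x i`, so every term of the Leibniz formula is a product of
functions of separate variables. -/
theorem integral_det_eq_det_integral {n : ℕ} {μ : Measure X} [SigmaFinite μ]
    {g : Fin n → Fin n → X → ℂ} (hg : ∀ i j, Integrable (g i j) μ) :
    ∫ x, (Matrix.of fun i j => g i j (x i)).det ∂(Measure.pi fun _ : Fin n => μ) =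
      (Matrix.of fun i j => ∫ x, g i j x ∂μ).det := by
  simp only [← Matrix.det_transpose (Matrix.of _), Matrix.det_apply', Matrix.transpose_apply,
    Matrix.of_apply]
  rw [integral_finsetSum]
  · refine Finset.sum_congr rfl fun σ _ => ?_
    rw [integral_const_mul, integral_fintype_prod_eq_prod (fun i => g i (σ i))]
  · intro σ _
    exact (Integrable.fintype_prod (f := fun i => g i (σ i)) fun i => hg i (σ i)).const_mul _

/-- Only one of the determinant and its conjugate is expanded by the Leibniz formula; the sign is
absorbed by permuting the columns of the other. The result has row `i` depending on the point `i`
alone, as `integral_det_eq_det_integral` requires. -/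
theorem normSq_det_eq_sum {n : ℕ} (a : Fin n → Fin n → ℂ) :
    (((‖(Matrix.of fun i j => a j i).det‖ ^ 2 : ℝ)) : ℂ) =
      ∑ σ : Equiv.Perm (Fin n), (Matrix.of fun i j => a (σ i) i * conj (a (σ j) i)).det := by
  have h1 : (((‖(Matrix.of fun i j => a j i).det‖ ^ 2 : ℝ)) : ℂ) =
      (Matrix.of fun i j => a j i).det * (Matrix.of fun i j => conj (a j i)).det := by
    rw [← Complex.normSq_eq_norm_sq, ← Complex.mul_conj, RingHom.map_det]
    rfl
  rw [h1]
  nth_rw 1 [← Matrix.det_transpose, Matrix.det_apply', Finset.sum_mul]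
  refine Finset.sum_congr rfl fun σ _ => ?_
  have h2 : (Matrix.of fun i j => a (σ i) i * conj (a (σ j) i)).det =
      (∏ i, a (σ i) i) * ((Matrix.of fun i j => conj (a j i)).submatrix id σ).det := by
    rw [← Matrix.det_mul_column]
    rfl
  rw [h2, Matrix.det_permute']
  simp only [Matrix.transpose_apply, Matrix.of_apply]
  ring

variable {n : ℕ} {μ : Measure X} [IsProbabilityMeasure μ] {φ : Fin n → X → ℂ}

theorem measurable_slater (hφ : ∀ i, Measurable (φ i)) : Measurable (slater φ) := by
  unfold slater
  refine measurable_const.mul (Measurable.pow_const (Measurable.norm ?_) _)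
  simp only [Matrix.det_apply']
  refine Finset.measurable_sum _ fun σ _ => measurable_const.mul ?_
  refine Finset.measurable_prod _ fun i _ => ?_
  exact (hφ _).comp (measurable_pi_apply _)

theorem integrable_mul_conj (hφ : ∀ i, Measurable (φ i)) {C : ℝ} (hC : ∀ i x, ‖φ i x‖ ≤ C)
    {h : X → ℂ} (hh : Measurable h) (hb : ∀ x, ‖h x‖ ≤ 1) (a b : Fin n) :
    Integrable (fun x => h x * (φ a x * conj (φ b x))) μ := by
  refine Integrable.of_bound (C := C * C) ?_ (.of_forall fun x => ?_)
  · exact (hh.mul ((hφ a).mul (Complex.continuous_conj.measurable.comp (hφ b)))).aestronglyMeasurable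
  · have h0 : 0 ≤ C := (norm_nonneg _).trans (hC a x)
    rw [norm_mul, norm_mul, RCLike.norm_conj]
    calc _ ≤ 1 * (C * C) := by
          gcongr
          exacts [hb x, hC a x, hC b x]
      _ = _ := one_mul _

theorem integral_prod_mul_slater (hφ : ∀ i, Measurable (φ i)) {C : ℝ} (hC : ∀ i x, ‖φ i x‖ ≤ C)
    {h : Fin n → X → ℂ} (hh : ∀ i, Measurable (h i)) (hb : ∀ i x, ‖h i x‖ ≤ 1) :
    ∫ x, (∏ i, h i (x i)) * (slater φ x : ℂ) ∂(Measure.pi fun _ : Fin n => μ) =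
      (n.factorial : ℂ)⁻¹ * ∑ σ : Equiv.Perm (Fin n),
        (Matrix.of fun i j => ∫ x, h i x * (φ (σ i) x * conj (φ (σ j) x)) ∂μ).det := by
  have h1 : ∀ x : Fin n → X, (∏ i, h i (x i)) * (slater φ x : ℂ) =
      (n.factorial : ℂ)⁻¹ * ∑ σ : Equiv.Perm (Fin n),
        (Matrix.of fun i j => h i (x i) * (φ (σ i) (x i) * conj (φ (σ j) (x i)))).det := by
    intro x
    have : ∀ σ : Equiv.Perm (Fin n),
        (Matrix.of fun i j => h i (x i) * (φ (σ i) (x i) * conj (φ (σ j) (x i)))).det =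
        (∏ i, h i (x i)) * (Matrix.of fun i j => φ (σ i) (x i) * conj (φ (σ j) (x i))).det := by
      intro σ
      rw [← Matrix.det_mul_column]
      rfl
    simp only [this]
    rw [← Finset.mul_sum, ← normSq_det_eq_sum (fun a i => φ a (x i)), slater]
    push_cast
    ring
  simp only [h1]
  rw [integral_const_mul, integral_finsetSum]
  · congr 1
    refine Finset.sum_congr rfl fun σ _ => ?_
    exact integral_det_eq_det_integral
      (g := fun i j x => h i x * (φ (σ i) x * conj (φ (σ j) x)))
      (fun i j => integrable_mul_conj hφ hC (hh i) (hb i) _ _)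
  · intro σ _
    simp only [← Matrix.det_transpose (Matrix.of _), Matrix.det_apply', Matrix.transpose_apply,
      Matrix.of_apply]
    refine integrable_finsetSum _ fun τ _ => Integrable.const_mul ?_ _
    exact Integrable.fintype_prod
      (f := fun i x => h i x * (φ (σ i) x * conj (φ (σ (τ i)) x)))
      fun i => integrable_mul_conj hφ hC (hh i) (hb i) _ _

/-- The rows outside the range of `f` are rows of the identity, so the matrix is block triangular
with an identity block. This is how points that are not tested are integrated out: orthonormality
turns their rows into identity rows. -/
theorem det_of_rows_one {k : ℕ} (f : Fin k → Fin n) (hf : Function.Injective f)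
    (b : Matrix (Fin n) (Fin n) ℂ)
    (hb : ∀ i, i ∉ Set.range f → ∀ j, b i j = if i = j then 1 else 0) :
    b.det = (Matrix.of fun i j => b (f i) (f j)).det := by
  classical
  rw [Matrix.twoBlockTriangular_det b (fun i => i ∈ Set.range f)]
  · have h1 : (b.toSquareBlockProp fun i => i ∉ Set.range f) = 1 := by
      ext i j
      simp only [Matrix.toSquareBlockProp_def, Matrix.of_apply, hb i i.2, Matrix.one_apply,
        Subtype.ext_iff]
    rw [h1, Matrix.det_one, mul_one]
    have h2 := Matrix.det_submatrix_equiv_self (Equiv.ofInjective f hf)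
      (b.toSquareBlockProp fun i => i ∈ Set.range f)
    rw [← show (b.toSquareBlockProp fun i => i ∈ Set.range f).submatrix (Equiv.ofInjective f hf)
      (Equiv.ofInjective f hf) = Matrix.of fun i j => b (f i) (f j) from by
        ext i j; simp [Matrix.toSquareBlockProp_def]]
    convert h2.symm
  · intro i hi j hj
    rw [hb i hi, if_neg]
    rintro rfl
    exact hi hj

theorem integral_prod_indicator_mul_slater (hφ : ∀ i, Measurable (φ i)) {C : ℝ}
    (hC : ∀ i x, ‖φ i x‖ ≤ C)
    (ho : ∀ a b, ∫ x, φ a x * conj (φ b x) ∂μ = if a = b then 1 else 0)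
    {k : ℕ} {B : Fin k → Set X} (hB : ∀ j, MeasurableSet (B j))
    (hd : Pairwise (fun i j => Disjoint (B i) (B j))) (f : Fin k → Fin n) :
    ∫ x, (∏ j, (B j).indicator (fun _ => (1 : ℂ)) (x (f j))) * (slater φ x : ℂ)
        ∂(Measure.pi fun _ : Fin n => μ) =
      (n.factorial : ℂ)⁻¹ * ∑ σ : Equiv.Perm (Fin n),
        (Matrix.of fun i j => ∫ x, (B i).indicator (fun _ => (1 : ℂ)) x *
          (φ (σ (f i)) x * conj (φ (σ (f j)) x)) ∂μ).det := by
  classical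
  by_cases hf : Function.Injective f
  -- Grouping the factors by the point they test gives each point its own test function; an untested
  -- point gets the empty product `1`.
  · have h1 : ∀ x : Fin n → X, ∏ j, (B j).indicator (fun _ => (1 : ℂ)) (x (f j)) =
        ∏ i, ∏ j with f j = i, (B j).indicator (fun _ => (1 : ℂ)) (x i) := by
      intro x
      rw [← Finset.prod_fiberwise (s := Finset.univ) (g := f)]
      refine Finset.prod_congr rfl fun i _ => Finset.prod_congr rfl fun j hj => ?_
      rw [(Finset.mem_filter.1 hj).2]
    simp only [h1]
    rw [integral_prod_mul_slater hφ hC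
      (h := fun i x => ∏ j with f j = i, (B j).indicator (fun _ => (1 : ℂ)) x)]
    · congr 1
      refine Finset.sum_congr rfl fun σ _ => ?_
      rw [det_of_rows_one f hf]
      · congr 1
        ext i j
        simp only [Matrix.of_apply]
        have : (Finset.univ.filter fun j => f j = f i) = {i} := by
          ext j; simp [hf.eq_iff]
        simp [this]
      · intro i hi j
        have : (Finset.univ.filter fun j => f j = i) = ∅ := by
          ext j
          simp only [Finset.mem_filter, Finset.mem_univ, true_and, Finset.notMem_empty, iff_false]
          exact fun h => hi ⟨j, h⟩
        simp only [Matrix.of_apply, this, Finset.prod_empty, one_mul, ho, σ.injective.eq_iff]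
    · intro i
      exact Finset.measurable_prod _ fun j _ => measurable_const.indicator (hB j)
    · intro i x
      rw [norm_prod]
      refine Finset.prod_le_one (fun _ _ => norm_nonneg _) fun j _ => ?_
      by_cases hx : x ∈ B j <;> simp [hx]
  -- If one point is tested twice, both sides vanish: on the left the sets are disjoint, on the
  -- right two columns coincide.
  · obtain ⟨i, j, hij, hne⟩ : ∃ i j, f i = f j ∧ i ≠ j := by
      simpa [Function.Injective] using hf
    have h0 : ∀ x : Fin n → X, ∏ j, (B j).indicator (fun _ => (1 : ℂ)) (x (f j)) = 0 := by
      intro x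
      by_cases hx : x (f i) ∈ B i
      · refine Finset.prod_eq_zero (Finset.mem_univ j) (Set.indicator_of_notMem ?_ _)
        rw [← hij]
        exact Set.disjoint_left.1 (hd hne) hx
      · exact Finset.prod_eq_zero (Finset.mem_univ i) (Set.indicator_of_notMem hx _)
    simp only [h0, zero_mul, integral_zero]
    rw [eq_comm, mul_eq_zero]
    right
    refine Finset.sum_eq_zero fun σ _ => Matrix.det_zero_of_column_eq hne fun l => ?_
    simp only [Matrix.of_apply, hij]

theorem setIntegral_det_kernel (hφ : ∀ i, Measurable (φ i)) {C : ℝ} (hC : ∀ i x, ‖φ i x‖ ≤ C)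
    {k : ℕ} {B : Fin k → Set X} (hB : ∀ j, MeasurableSet (B j)) :
    ∫ y in Set.univ.pi B, (Matrix.of fun i j => ∑ a, φ a (y i) * conj (φ a (y j))).det
        ∂(Measure.pi fun _ : Fin k => μ) =
      ∑ g : Fin k → Fin n, (Matrix.of fun i j => ∫ x, (B i).indicator (fun _ => (1 : ℂ)) x *
          (φ (g i) x * conj (φ (g j) x)) ∂μ).det := by
  classical
  have h1 : ∀ y : Fin k → X, (Matrix.of fun i j => ∑ a, φ a (y i) * conj (φ a (y j))).det =
      ∑ g : Fin k → Fin n, (Matrix.of fun i j => φ (g i) (y i) * conj (φ (g j) (y i))).det := by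
    intro y
    have h2 : (Matrix.of fun i j => ∑ a, φ a (y i) * conj (φ a (y j))) =
        fun i => ∑ a, fun j => φ a (y i) * conj (φ a (y j)) := by
      ext i j; simp
    have h7 := MultilinearMap.map_sum
      (Matrix.detRowAlternating (R := ℂ) (n := Fin k)).toMultilinearMap
      (fun i (a : Fin n) j => φ a (y i) * conj (φ a (y j)))
    rw [h2]
    refine h7.trans ?_
    refine Finset.sum_congr rfl fun g _ => ?_
    -- Multilinearity in the rows produces `φ (g i) (y i) * conj (φ (g i) (y j))`, which mixes
    -- variables. Once the first factors are pulled out, transposing the rest makes row `i` depend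
    -- on `y i` only.
    have h3 : (Matrix.of fun i j => φ (g i) (y i) * conj (φ (g j) (y i))).det =
        (∏ i, φ (g i) (y i)) * (Matrix.of fun i j => conj (φ (g j) (y i))).det := by
      rw [← Matrix.det_mul_column]; rfl
    have h4 : (Matrix.of fun i j => φ (g i) (y i) * conj (φ (g i) (y j))).det =
        (∏ i, φ (g i) (y i)) * (Matrix.of fun i j => conj (φ (g i) (y j))).det := by
      rw [← Matrix.det_mul_column]; rfl
    rw [h3, ← Matrix.det_transpose]
    exact h4
  rw [← integral_indicator (MeasurableSet.univ_pi hB)]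
  have h5 : ∀ y : Fin k → X, (Set.univ.pi B).indicator
      (fun y => (Matrix.of fun i j => ∑ a, φ a (y i) * conj (φ a (y j))).det) y =
      ∑ g : Fin k → Fin n, (Matrix.of fun i j => (B i).indicator (fun _ => (1 : ℂ)) (y i) *
        (φ (g i) (y i) * conj (φ (g j) (y i)))).det := by
    intro y
    have h6 : ∀ g : Fin k → Fin n, (Matrix.of fun i j =>
        (B i).indicator (fun _ => (1 : ℂ)) (y i) *
        (φ (g i) (y i) * conj (φ (g j) (y i)))).det =
        (∏ i, (B i).indicator (fun _ => (1 : ℂ)) (y i)) *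
        (Matrix.of fun i j => φ (g i) (y i) * conj (φ (g j) (y i))).det := by
      intro g
      rw [← Matrix.det_mul_column]; rfl
    simp only [h6]
    rw [← Finset.mul_sum, ← h1]
    by_cases hy : y ∈ Set.univ.pi B
    · rw [Set.indicator_of_mem hy, Finset.prod_eq_one, one_mul]
      intro i _
      exact Set.indicator_of_mem (hy i (Set.mem_univ i)) _
    · rw [Set.indicator_of_notMem hy]
      simp only [Set.mem_univ_pi, not_forall] at hy
      obtain ⟨i, hi⟩ := hy
      rw [Finset.prod_eq_zero (Finset.mem_univ i) (Set.indicator_of_notMem hi _), zero_mul]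
  have hI : ∀ (g : Fin k → Fin n) (i j : Fin k), Integrable (fun x =>
      (B i).indicator (fun _ => (1 : ℂ)) x * (φ (g i) x * conj (φ (g j) x))) μ := by
    intro g i j
    refine integrable_mul_conj hφ hC (measurable_const.indicator (hB i)) (fun x => ?_) _ _
    by_cases hx : x ∈ B i <;> simp [hx]
  simp only [h5]
  rw [integral_finsetSum]
  · refine Finset.sum_congr rfl fun g _ => ?_
    exact integral_det_eq_det_integral (hI g)
  · intro g _
    simp only [← Matrix.det_transpose (Matrix.of _), Matrix.det_apply', Matrix.transpose_apply,
      Matrix.of_apply]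
    refine integrable_finsetSum _ fun τ _ => Integrable.const_mul ?_ _
    exact Integrable.fintype_prod
      (f := fun i x => (B i).indicator (fun _ => (1 : ℂ)) x * (φ (g i) x * conj (φ (g (τ i)) x)))
      fun i => hI g _ _

/-- Both sides are sums of the same determinants. On the left they are indexed by `f` and a
permutation `σ` through `g = σ ∘ f`; for each `σ` this runs once through all `g`, so the `n!` equal
contributions cancel the normalization of the density. -/
theorem integral_prod_sum_indicator_mul_slater (hφ : ∀ i, Measurable (φ i)) {C : ℝ}
    (hC : ∀ i x, ‖φ i x‖ ≤ C)
    (ho : ∀ a b, ∫ x, φ a x * conj (φ b x) ∂μ = if a = b then 1 else 0)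
    {k : ℕ} {B : Fin k → Set X} (hB : ∀ j, MeasurableSet (B j))
    (hd : Pairwise (fun i j => Disjoint (B i) (B j)))
    (hs : ∀ f : Fin k → Fin n, Integrable (fun x : Fin n → X =>
      (∏ j, (B j).indicator (fun _ => (1 : ℂ)) (x (f j))) * (slater φ x : ℂ))
        (Measure.pi fun _ : Fin n => μ)) :
    ∫ x, (∏ j, ∑ i, (B j).indicator (fun _ => (1 : ℂ)) (x i)) * (slater φ x : ℂ)
        ∂(Measure.pi fun _ : Fin n => μ) =
      ∫ y in Set.univ.pi B, (Matrix.of fun i j => ∑ a, φ a (y i) * conj (φ a (y j))).det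
        ∂(Measure.pi fun _ : Fin k => μ) := by
  classical
  rw [setIntegral_det_kernel hφ hC hB]
  simp only [Finset.prod_univ_sum, Fintype.piFinset_univ, Finset.sum_mul]
  rw [integral_finsetSum _ fun f _ => hs f]
  simp only [integral_prod_indicator_mul_slater hφ hC ho hB hd]
  rw [← Finset.mul_sum, Finset.sum_comm]
  have : ∀ σ : Equiv.Perm (Fin n), ∑ f : Fin k → Fin n,
      (Matrix.of fun i j => ∫ x, (B i).indicator (fun _ => (1 : ℂ)) x *
          (φ (σ (f i)) x * conj (φ (σ (f j)) x)) ∂μ).det =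
      ∑ g : Fin k → Fin n, (Matrix.of fun i j => ∫ x, (B i).indicator (fun _ => (1 : ℂ)) x *
          (φ (g i) x * conj (φ (g j) x)) ∂μ).det := by
    intro σ
    exact Fintype.sum_equiv (Equiv.arrowCongr (Equiv.refl _) σ) _ _ fun f => rfl
  simp only [this, Finset.sum_const, Finset.card_univ, Fintype.card_perm, Fintype.card_fin,
    nsmul_eq_mul]
  rw [inv_mul_cancel_left₀ (by exact_mod_cast n.factorial_ne_zero)]

end Slater

theorem ae_prod_fst_ne_snd {X : Type*} [MeasurableSpace X] [MeasurableSingletonClass X]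
    [MeasurableEq X] (μ : Measure X) [SFinite μ] [NullSingletonClass μ] :
    ∀ᵐ p ∂(μ.prod μ), p.1 ≠ p.2 := by
  have h : MeasurableSet {p : X × X | p.1 ≠ p.2} := measurableSet_diagonal.compl
  rw [Measure.ae_prod_iff_ae_ae h]
  refine .of_forall fun x => ?_
  rw [ae_iff]
  simp

theorem isDeterminantal_slater {d n : ℕ} {Ω : Set (E d)} {μ : Measure (E d)}
    [IsProbabilityMeasure μ] [NullSingletonClass μ] (hΩ : ∀ᵐ x ∂μ, x ∈ Ω)
    {φ : Fin n → E d → ℂ} (hφ : ∀ i, Measurable (φ i)) {C : ℝ} (hC : ∀ i x, ‖φ i x‖ ≤ C)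
    (ho : ∀ a b, ∫ x, φ a x * conj (φ b x) ∂μ = if a = b then 1 else 0) :
    IsDeterminantal Ω μ (fun x y => ∑ a, φ a x * conj (φ a y))
      ((Measure.pi fun _ : Fin n => μ).withDensity fun x => ENNReal.ofReal (slater φ x)) := by
  set π := Measure.pi fun _ : Fin n => μ
  have hm := measurable_slater hφ
  obtain ⟨C', hC'⟩ := exists_slater_le φ hC
  have hi : ∀ {f : (Fin n → E d) → ℂ} {R : ℝ}, Measurable f → (∀ x, ‖f x‖ ≤ R) →
      Integrable (fun x => f x * (slater φ x : ℂ)) π := by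
    intro f R hf hR
    refine Integrable.of_bound (C := R * C')
      (hf.mul (Complex.measurable_ofReal.comp hm)).aestronglyMeasurable (.of_forall fun x => ?_)
    rw [norm_mul, Complex.norm_real, Real.norm_of_nonneg (slater_nonneg _ _)]
    exact mul_le_mul (hR x) (hC' x) (slater_nonneg _ _) ((norm_nonneg _).trans (hR x))
  have hint : ∀ {k : ℕ} {B : Fin k → Set (E d)}, (∀ j, MeasurableSet (B j)) →
      Pairwise (fun i j => Disjoint (B i) (B j)) →
      ∫ x, (∏ j, ∑ i, (B j).indicator (fun _ => (1 : ℂ)) (x i)) * (slater φ x : ℂ) ∂π =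
      ∫ y in Set.univ.pi B, (Matrix.of fun i j => ∑ a, φ a (y i) * conj (φ a (y j))).det
        ∂(Measure.pi fun _ : Fin k => μ) := by
    intro k B hB hd
    refine integral_prod_sum_indicator_mul_slater hφ hC ho hB hd fun f => hi (R := 1) ?_ ?_
    · exact Finset.measurable_prod _ fun j _ =>
        (measurable_const.indicator (hB j)).comp (measurable_pi_apply _)
    · intro x
      rw [norm_prod]
      refine Finset.prod_le_one (fun _ _ => norm_nonneg _) fun j _ => ?_
      by_cases hx : x (f j) ∈ B j <;> simp [hx]
  refine ⟨⟨?_⟩, ?_, ?_, ?_⟩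
  -- For `k = 0` the intensity identity, with empty product and empty determinant, says that the
  -- density has total mass one.
  · have h0 := hint (k := 0) (B := fun _ => Set.univ) (fun j => j.elim0) (fun i => i.elim0)
    simp only [Finset.univ_eq_empty, Finset.prod_empty, one_mul, Matrix.det_isEmpty] at h0
    rw [integral_complex_ofReal, setIntegral_const] at h0
    simp only [Set.pi_univ, Measure.real, measure_univ, ENNReal.toReal_one, one_smul] at h0
    rw [withDensity_apply _ MeasurableSet.univ, Measure.restrict_univ,
      ← ofReal_integral_eq_lintegral_ofReal _ (.of_forall (slater_nonneg φ))]
    · rw [show ∫ x, slater φ x ∂π = 1 by exact_mod_cast h0, ENNReal.ofReal_one]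
    · exact Integrable.of_bound (C := C') hm.aestronglyMeasurable (.of_forall fun x => by
        rw [Real.norm_of_nonneg (slater_nonneg _ _)]; exact hC' x)
  · refine (withDensity_absolutelyContinuous _ _).ae_le ?_
    exact ae_all_iff.2 fun i => (Measure.quasiMeasurePreserving_eval _ i).ae hΩ
  · refine (withDensity_absolutelyContinuous _ _).ae_le ?_
    have : ∀ i j : Fin n, i ≠ j → ∀ᵐ x ∂π, x i ≠ x j := by
      intro i j hij
      -- Two different coordinates of the product measure have joint law `μ ⊗ μ`, and the diagonal
      -- is null for it since `μ` has no atoms.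
      have h1 := (ProbabilityTheory.iIndepFun_pi (μ := fun _ : Fin n => μ)
        (X := fun _ => id) fun _ => aemeasurable_id).indepFun hij
      simp only [id] at h1
      rw [ProbabilityTheory.indepFun_iff_map_prod_eq_prod_map_map
        (measurable_pi_apply _).aemeasurable (measurable_pi_apply _).aemeasurable] at h1
      rw [(measurePreserving_eval (fun _ : Fin n => μ) i).map_eq,
        (measurePreserving_eval (fun _ : Fin n => μ) j).map_eq] at h1
      have h2 := ae_of_ae_map
        ((measurable_pi_apply i).prodMk (measurable_pi_apply j)).aemeasurable
        (h1 ▸ ae_prod_fst_ne_snd μ)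
      exact h2
    have h2 : ∀ᵐ x ∂π, ∀ i j : Fin n, i ≠ j → x i ≠ x j := by
      rw [ae_all_iff]; intro i
      rw [ae_all_iff]; intro j
      by_cases hij : i = j
      · simp [hij]
      · filter_upwards [this i j hij] with x hx _ using hx
    filter_upwards [h2] with x hx i j hij
    by_contra h
    exact hx i j h hij
  · intro k B hB _ hd
    rw [integral_withDensity_eq_integral_toReal_smul hm.ennreal_ofReal
      (.of_forall fun _ => ENNReal.ofReal_lt_top), ← hint hB hd, ← integral_complex_ofReal]
    refine integral_congr_ae (.of_forall fun x => ?_)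
    simp only [ENNReal.toReal_ofReal (slater_nonneg φ x), smul_eq_mul]
    push_cast
    rw [mul_comm]
    congr 1
    refine Finset.prod_congr rfl fun j _ => Finset.sum_congr rfl fun i _ => ?_
    by_cases hx : x i ∈ B j <;> simp [hx]

end FlatTorus

/-! ### Characters of the torus and existence of the processes -/

namespace FlatTorus

open scoped ComplexConjugate Pointwise

/-- The character `u ↦ e^{2πi⟨u, w⟩}`. -/
noncomputable def char {d : ℕ} (w u : E d) : ℂ :=
  Complex.exp (2 * Real.pi * Complex.I * (inner ℝ u w : ℝ))

theorem char_eq_exp_mul_I {d : ℕ} (w u : E d) :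
    char w u = Complex.exp ((2 * Real.pi * inner ℝ u w : ℝ) * Complex.I) := by
  rw [char]; push_cast; ring_nf

theorem continuous_char {d : ℕ} (w : E d) : Continuous (char w) := by
  unfold char; fun_prop

theorem norm_char {d : ℕ} (w u : E d) : ‖char w u‖ = 1 := by
  rw [char_eq_exp_mul_I, Complex.norm_exp_ofReal_mul_I]

theorem conj_char {d : ℕ} (w u : E d) : conj (char w u) = char (-w) u := by
  rw [char, ← Complex.exp_conj, char]
  congr 1
  rw [inner_neg_right]
  simp only [map_mul, Complex.conj_ofReal, Complex.conj_I, map_ofNat]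
  push_cast; ring

theorem char_add {d : ℕ} (w w' u : E d) : char (w + w') u = char w u * char w' u := by
  rw [char, char, char, ← Complex.exp_add, inner_add_right]
  congr 1; push_cast; ring

theorem char_add_right {d : ℕ} (w u u' : E d) : char w (u + u') = char w u * char w u' := by
  rw [char, char, char, ← Complex.exp_add, inner_add_left]
  congr 1; push_cast; ring

theorem char_sub_right {d : ℕ} (w u u' : E d) : char w (u - u') = char w u * conj (char w u') := by
  rw [conj_char, char, char, char, ← Complex.exp_add, inner_sub_left, inner_neg_right]
  congr 1; push_cast; ring

theorem char_zero {d : ℕ} (u : E d) : char 0 u = 1 := by simp [char]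

theorem char_lattice {d : ℕ} (v : Basis (Fin d) ℝ (E d)) {w l : E d} (hw : w ∈ dualLattice v)
    (hl : l ∈ lattice v) : char w l = 1 := by
  obtain ⟨n, hn⟩ := (mem_dualLattice v w).1 hw l hl
  rw [char, real_inner_comm, ← hn]
  refine Complex.exp_eq_one_iff.2 ⟨n, ?_⟩
  push_cast; ring

theorem char_periodic {d : ℕ} (v : Basis (Fin d) ℝ (E d)) {w : E d} (hw : w ∈ dualLattice v)
    (l : E d) (hl : l ∈ lattice v) (x : E d) : char w (x + l) = char w x := by
  rw [char_add_right, char_lattice v hw hl, mul_one]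

theorem integrableOn_char {d : ℕ} (v : Basis (Fin d) ℝ (E d)) (w : E d) :
    IntegrableOn (char w) (torus v) :=
  Measure.integrableOn_of_bounded (M := 1) (volume_torus_lt_top v).ne
    (continuous_char w).aestronglyMeasurable (.of_forall fun x => (norm_char w x).le)

theorem setIntegral_char {d : ℕ} (v : Basis (Fin d) ℝ (E d)) {w : E d} (hw : w ∈ dualLattice v) :
    ∫ x in torus v, char w x = if w = 0 then (covol v : ℂ) else 0 := by
  split_ifs with h
  · subst h
    simp [char_zero, volume_real_torus]
  -- Translation by `w / (2‖w‖²)` multiplies the character by `e^{πi} = -1` and preserves the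
  -- integral, which is therefore zero.
  · have h1 := setIntegral_torus_sub v (char_periodic v hw) (-(((2 : ℝ) * ‖w‖ ^ 2)⁻¹ • w))
    simp only [sub_neg_eq_add, char_add_right] at h1
    rw [integral_mul_const] at h1
    have h2 : char w (((2 : ℝ) * ‖w‖ ^ 2)⁻¹ • w) = -1 := by
      rw [char, real_inner_smul_left, real_inner_self_eq_norm_sq, ← Complex.exp_pi_mul_I]
      have : ‖w‖ ≠ 0 := by simpa using h
      congr 1
      rw [show ((2 * ‖w‖ ^ 2)⁻¹ * ‖w‖ ^ 2 : ℝ) = 1 / 2 by field_simp]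
      push_cast; ring
    rw [h2] at h1
    linear_combination (-1 / 2 : ℂ) * h1

theorem integral_char_mul_conj {d : ℕ} (v : Basis (Fin d) ℝ (E d)) {w w' : E d}
    (hw : w ∈ dualLattice v) (hw' : w' ∈ dualLattice v) :
    ∫ x, char w x * conj (char w' x) ∂(torusMeasure v) = if w = w' then 1 else 0 := by
  simp only [conj_char, ← char_add]
  rw [integral_torusMeasure, setIntegral_char v (add_mem hw (neg_mem hw'))]
  simp only [← sub_eq_add_neg, sub_eq_zero]
  split_ifs with h
  · rw [Complex.real_smul, ← Complex.ofReal_mul, inv_mul_cancel₀ (covol_pos v).ne',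
      Complex.ofReal_one]
  · simp

/-- The points of the dual lattice in `N^{1/d} D`. -/
def latticePoints {d : ℕ} (v : Basis (Fin d) ℝ (E d)) (D : Set (E d)) (N : ℕ) :
    Set (dualLattice v) :=
  {w | (w : E d) ∈ ((N : ℝ) ^ (1 / (d : ℝ))) • D}

theorem kappa_of_mem {d : ℕ} {v : Basis (Fin d) ℝ (E d)} {D : Set (E d)} {N : ℕ}
    {w : dualLattice v} (hw : w ∈ latticePoints v D N) : kappa v D N w = 1 :=
  if_pos hw

theorem kappa_of_notMem {d : ℕ} {v : Basis (Fin d) ℝ (E d)} {D : Set (E d)} {N : ℕ}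
    {w : dualLattice v} (hw : w ∉ latticePoints v D N) : kappa v D N w = 0 :=
  if_neg hw

theorem finite_latticePoints {d : ℕ} (v : Basis (Fin d) ℝ (E d)) {D : Set (E d)}
    (hD : Bornology.IsBounded D) (N : ℕ) : (latticePoints v D N).Finite := by
  have h := ZSpan.setFinite_inter (dualBasis v) (hD.smul₀ ((N : ℝ) ^ (1 / (d : ℝ))))
  refine Set.Finite.of_finite_image (f := fun w : dualLattice v => (w : E d))
    (h.subset ?_) Subtype.coe_injective.injOn
  rintro _ ⟨w, hw, rfl⟩
  refine ⟨hw, ?_⟩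
  exact (dualLattice_eq v).le w.2

theorem kernel_kappa {d : ℕ} (v : Basis (Fin d) ℝ (E d)) {D : Set (E d)}
    (hD : Bornology.IsBounded D) (N : ℕ) (u u' : E d) :
    kernel v (kappa v D N) u u' =
      ∑ w ∈ (finite_latticePoints v hD N).toFinset, char (w : E d) (u - u') := by
  classical
  rw [kernel, finsum_eq_sum_of_support_subset (s := (finite_latticePoints v hD N).toFinset)]
  · refine Finset.sum_congr rfl fun w hw => ?_
    rw [Set.Finite.mem_toFinset] at hw
    rw [kappa_of_mem hw, Nat.cast_one, one_mul, char]
  · intro w hw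
    rw [Set.Finite.coe_toFinset]
    by_contra h
    exact hw (by simp [kappa_of_notMem h])

theorem trace_eq_card {d : ℕ} (v : Basis (Fin d) ℝ (E d)) {D : Set (E d)}
    (hD : Bornology.IsBounded D) (N : ℕ) :
    trace v D N = (finite_latticePoints v hD N).toFinset.card := by
  classical
  rw [trace, finsum_eq_sum_of_support_subset (s := (finite_latticePoints v hD N).toFinset),
    Finset.card_eq_sum_ones]
  · refine Finset.sum_congr rfl fun w hw => ?_
    rw [Set.Finite.mem_toFinset] at hw
    rw [kappa_of_mem hw]
  · intro w hw
    rw [Set.Finite.coe_toFinset]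
    by_contra h
    exact hw (kappa_of_notMem h)

theorem exists_isProcess {d : ℕ} [NeZero d] (v : Basis (Fin d) ℝ (E d)) {D : Set (E d)}
    (hD : Bornology.IsBounded D) (N : ℕ) : ∃ P, IsProcess v D N P := by
  classical
  set S := (finite_latticePoints v hD N).toFinset
  let e : Fin (trace v D N) ≃ S :=
    (finCongr (trace_eq_card v hD N)).trans S.equivFin.symm
  have h := isDeterminantal_slater (ae_mem_torus v)
    (φ := fun i => char ((e i : dualLattice v) : E d)) (C := 1)
    (fun i => (continuous_char _).measurable) (fun i x => (norm_char _ x).le)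
    (fun a b => by
      rw [integral_char_mul_conj v (e a : dualLattice v).2 (e b : dualLattice v).2]
      simp only [← Subtype.ext_iff, e.injective.eq_iff])
  have hK : kernel v (kappa v D N) = fun u u' => ∑ a, char ((e a : dualLattice v) : E d) u *
      conj (char ((e a : dualLattice v) : E d) u') := by
    ext u u'
    rw [kernel_kappa v hD, ← Finset.sum_coe_sort,
      ← e.sum_comp (fun w : S => char ((w : dualLattice v) : E d) (u - u'))]
    simp only [char_sub_right]
  rw [← hK] at h
  exact ⟨_, h⟩

end FlatTorus

/-! ### From the two-point intensity to the law of pairs of distinct points -/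

namespace FlatTorus

variable {d n : ℕ} {Ω : Set (E d)} {μ : Measure (E d)} {K : E d → E d → ℂ}
  {P : Measure (Fin n → E d)} {ρ : E d × E d → ℝ}

/-- The sum of the laws of the pairs of distinct coordinates. -/
noncomputable def pairMeasure (P : Measure (Fin n → E d)) : Measure (E d × E d) :=
  ∑ p ∈ (Finset.univ : Finset (Fin n)).offDiag, P.map fun x => (x p.1, x p.2)

theorem measurable_pair (p : Fin n × Fin n) :
    Measurable fun x : Fin n → E d => (x p.1, x p.2) :=
  (measurable_pi_apply _).prodMk (measurable_pi_apply _)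

theorem pairMeasure_apply {s : Set (E d × E d)} (hs : MeasurableSet s) :
    pairMeasure P s =
      ∑ p ∈ (Finset.univ : Finset (Fin n)).offDiag, P {x | (x p.1, x p.2) ∈ s} := by
  rw [pairMeasure, Measure.finsetSum_apply]
  exact Finset.sum_congr rfl fun p _ => Measure.map_apply (measurable_pair p) hs

theorem ae_pairMeasure {s : Set (E d × E d)} (hs : MeasurableSet s)
    (h : ∀ p ∈ (Finset.univ : Finset (Fin n)).offDiag, ∀ᵐ x ∂P, (x p.1, x p.2) ∈ s) :
    ∀ᵐ q ∂(pairMeasure P), q ∈ s := by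
  rw [ae_iff]
  change pairMeasure P sᶜ = 0
  rw [pairMeasure_apply hs.compl]
  exact Finset.sum_eq_zero fun p hp => ae_iff.1 (h p hp)

/-- This is the intensity identity for `k = 2`: since `B` and `C` are disjoint, no single point is
counted in both, and the product of the counts is a sum over ordered pairs of distinct indices. -/
theorem IsDeterminantal.pairMeasure_prod (h : IsDeterminantal Ω μ K P) [SigmaFinite μ]
    (hρ : ∀ u u', (ρ (u, u') : ℂ) = K u u * K u' u' - K u u' * K u' u) (hρ0 : ∀ p, 0 ≤ ρ p)
    (hρi : Integrable ρ (μ.prod μ)) {B C : Set (E d)} (hB : MeasurableSet B)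
    (hC : MeasurableSet C) (hBΩ : B ⊆ Ω) (hCΩ : C ⊆ Ω) (hBC : Disjoint B C) :
    pairMeasure P (B ×ˢ C) = (μ.prod μ).withDensity (fun p => ENNReal.ofReal (ρ p)) (B ×ˢ C) := by
  have := h.isProbabilityMeasure
  have h1 := h.intensity 2 ![B, C] (by simp [Fin.forall_fin_two, hB, hC])
    (by simp [Fin.forall_fin_two, hBΩ, hCΩ])
    (by
      intro i j hij
      fin_cases i <;> fin_cases j <;> simp_all [hBC.symm])
  simp only [Fin.prod_univ_two, Matrix.cons_val_zero, Matrix.cons_val_one, Matrix.det_fin_two,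
    Matrix.of_apply] at h1
  simp only [← hρ] at h1
  rw [integral_complex_ofReal, Complex.ofReal_inj] at h1
  have h2 : ∫ y in Set.univ.pi ![B, C], ρ (y 0, y 1) ∂(Measure.pi fun _ : Fin 2 => μ) =
      ∫ p in B ×ˢ C, ρ p ∂(μ.prod μ) := by
    rw [← (measurePreserving_finTwoArrow μ).setIntegral_preimage_emb
      MeasurableEquiv.finTwoArrow.measurableEmbedding]
    congr 2
    ext y
    simp [Fin.forall_fin_two]
  rw [h2] at h1
  rw [withDensity_apply _ (hB.prod hC), ← ofReal_integral_eq_lintegral_ofReal hρi.integrableOn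
    (.of_forall hρ0), ← h1, pairMeasure_apply (hB.prod hC)]
  have h3 : ∀ x : Fin n → E d, (∑ i, B.indicator (fun _ => (1 : ℝ)) (x i)) *
      ∑ i, C.indicator (fun _ => (1 : ℝ)) (x i) =
      ∑ p ∈ (Finset.univ : Finset (Fin n)).offDiag,
        {x : Fin n → E d | (x p.1, x p.2) ∈ B ×ˢ C}.indicator (fun _ => (1 : ℝ)) x := by
    intro x
    have h4 : ∀ p : Fin n × Fin n, B.indicator (fun _ => (1 : ℝ)) (x p.1) *
        C.indicator (fun _ => (1 : ℝ)) (x p.2) =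
        {x : Fin n → E d | (x p.1, x p.2) ∈ B ×ˢ C}.indicator (fun _ => (1 : ℝ)) x := by
      intro p
      by_cases hp : x p.1 ∈ B <;> by_cases hp' : x p.2 ∈ C <;> simp [hp, hp']
    rw [Finset.sum_mul_sum, ← Finset.sum_product', ← Finset.diag_union_offDiag,
      Finset.sum_union (Finset.disjoint_diag_offDiag _), Finset.sum_eq_zero, zero_add]
    · exact Finset.sum_congr rfl fun p _ => h4 p
    · intro p hp
      rw [h4, Set.indicator_of_notMem]
      rintro ⟨hp1, hp2⟩
      rw [← (Finset.mem_diag.1 hp).2] at hp2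
      exact Set.disjoint_left.1 hBC hp1 hp2
  have hm : ∀ p : Fin n × Fin n, MeasurableSet {x : Fin n → E d | (x p.1, x p.2) ∈ B ×ˢ C} :=
    fun p => measurable_pair p (hB.prod hC)
  simp only [h3]
  rw [integral_finsetSum, ENNReal.ofReal_sum_of_nonneg]
  · refine Finset.sum_congr rfl fun p _ => ?_
    rw [integral_indicator_const _ (hm p), smul_eq_mul, mul_one, ofReal_measureReal]
  · intro p _
    exact integral_nonneg fun x => Set.indicator_nonneg (fun _ _ => zero_le_one) _
  · intro p _
    exact (integrable_const _).indicator (hm p)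

theorem iUnion_disjoint_countableBasis {X : Type*} [TopologicalSpace X]
    [SecondCountableTopology X] [T2Space X] :
    (⋃ q : {q : TopologicalSpace.countableBasis X × TopologicalSpace.countableBasis X //
      Disjoint (q.1 : Set X) (q.2 : Set X)}, (q.1.1 : Set X) ×ˢ (q.1.2 : Set X)) =
      {p | p.1 ≠ p.2} := by
  ext ⟨x, y⟩
  simp only [Set.mem_iUnion, Set.mem_prod, Set.mem_ofPred_eq]
  constructor
  · rintro ⟨q, hx, hy⟩ rfl
    exact Set.disjoint_left.1 q.2 hx hy
  · intro hxy
    obtain ⟨U, V, hU, hV, hxU, hyV, hUV⟩ := t2_separation hxy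
    have hb := TopologicalSpace.isBasis_countableBasis X
    obtain ⟨U', hU', hxU', hUU'⟩ := hb.exists_subset_of_mem_open hxU hU
    obtain ⟨V', hV', hyV', hVV'⟩ := hb.exists_subset_of_mem_open hyV hV
    exact ⟨⟨(⟨U', hU'⟩, ⟨V', hV'⟩), hUV.mono hUU' hVV'⟩, hxU', hyV'⟩

/-- The intensities test only products of disjoint sets. This suffices because neither measure
charges the diagonal (simplicity on one side, absence of atoms on the other) and its complement is a
countable union of boxes with disjoint sides. -/
theorem IsDeterminantal.pairMeasure_eq (h : IsDeterminantal Ω μ K P) [IsFiniteMeasure μ]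
    [NullSingletonClass μ] (hΩ : MeasurableSet Ω) (hμ : ∀ᵐ x ∂μ, x ∈ Ω)
    (hρ : ∀ u u', (ρ (u, u') : ℂ) = K u u * K u' u' - K u u' * K u' u) (hρ0 : ∀ p, 0 ≤ ρ p)
    (hρi : Integrable ρ (μ.prod μ)) :
    pairMeasure P = (μ.prod μ).withDensity fun p => ENNReal.ofReal (ρ p) := by
  have := h.isProbabilityMeasure
  set M := (μ.prod μ).withDensity fun p => ENNReal.ofReal (ρ p) with hM
  have hfin : IsFiniteMeasure M := isFiniteMeasure_withDensity_ofReal hρi.2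
  have hfin' : IsFiniteMeasure (pairMeasure P) := by
    refine ⟨?_⟩
    rw [pairMeasure_apply MeasurableSet.univ]
    exact ENNReal.sum_lt_top.2 fun p _ => measure_lt_top _ _
  have hd : MeasurableSet {p : E d × E d | p.1 ≠ p.2} := measurableSet_diagonal.compl
  have hPd : ∀ᵐ p ∂(pairMeasure P), p ∈ {p : E d × E d | p.1 ≠ p.2} := by
    refine ae_pairMeasure hd fun p hp => ?_
    filter_upwards [h.simple] with x hx hxp
    exact (Finset.mem_offDiag.1 hp).2.2 (hx hxp)
  have hMd : ∀ᵐ p ∂M, p ∈ {p : E d × E d | p.1 ≠ p.2} :=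
    (withDensity_absolutelyContinuous _ _).ae_le (ae_prod_fst_ne_snd μ)
  have hPΩ : ∀ᵐ p ∂(pairMeasure P), p ∈ Ω ×ˢ Ω := by
    refine ae_pairMeasure (hΩ.prod hΩ) fun p hp => ?_
    filter_upwards [h.mem_domain] with x hx
    exact ⟨hx _, hx _⟩
  have hMΩ : ∀ᵐ p ∂M, p ∈ Ω ×ˢ Ω := by
    refine (withDensity_absolutelyContinuous _ _).ae_le ?_
    filter_upwards [Measure.quasiMeasurePreserving_fst.ae hμ,
      Measure.quasiMeasurePreserving_snd.ae hμ] with p h1 h2 using ⟨h1, h2⟩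
  rw [← Measure.restrict_eq_self_of_ae_mem hPd, ← Measure.restrict_eq_self_of_ae_mem hMd]
  rw [← iUnion_disjoint_countableBasis, Measure.restrict_iUnion_congr]
  rintro ⟨⟨U, V⟩, hUV⟩
  have hU : MeasurableSet (U : Set (E d)) :=
    ((TopologicalSpace.isBasis_countableBasis _).isOpen U.2).measurableSet
  have hV : MeasurableSet (V : Set (E d)) :=
    ((TopologicalSpace.isBasis_countableBasis _).isOpen V.2).measurableSet
  -- Inside one such box every measurable rectangle has disjoint sides, and rectangles determine a
  -- finite measure. Intersecting with `Ω ×ˢ Ω` changes neither measure and makes the intensity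
  -- identity applicable.
  refine Measure.ext_prod fun {s t} hs ht => ?_
  rw [Measure.restrict_apply (hs.prod ht), Measure.restrict_apply (hs.prod ht),
    ← Measure.restrict_eq_self_of_ae_mem hPΩ, ← Measure.restrict_eq_self_of_ae_mem hMΩ,
    Measure.restrict_apply ((hs.prod ht).inter (hU.prod hV)),
    Measure.restrict_apply ((hs.prod ht).inter (hU.prod hV)),
    Set.prod_inter_prod, Set.prod_inter_prod]
  exact h.pairMeasure_prod hρ hρ0 hρi ((hs.inter hU).inter hΩ) ((ht.inter hV).inter hΩ)
    Set.inter_subset_right Set.inter_subset_right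
    (hUV.mono (Set.inter_subset_left.trans Set.inter_subset_right)
      (Set.inter_subset_left.trans Set.inter_subset_right))

theorem IsDeterminantal.integrable_sum_pair (h : IsDeterminantal Ω μ K P) [IsFiniteMeasure μ]
    [NullSingletonClass μ] (hΩ : MeasurableSet Ω) (hμ : ∀ᵐ x ∂μ, x ∈ Ω)
    (hρ : ∀ u u', (ρ (u, u') : ℂ) = K u u * K u' u' - K u u' * K u' u) (hρ0 : ∀ p, 0 ≤ ρ p)
    (hρm : Measurable ρ)
    (hρi : Integrable ρ (μ.prod μ)) {f : E d × E d → ℝ} (hf : Measurable f)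
    (hfi : Integrable (fun p => ρ p * f p) (μ.prod μ)) :
    Integrable (fun x => ∑ p ∈ (Finset.univ : Finset (Fin n)).offDiag, f (x p.1, x p.2)) P ∧
      ∫ x, ∑ p ∈ (Finset.univ : Finset (Fin n)).offDiag, f (x p.1, x p.2) ∂P =
        ∫ p, ρ p * f p ∂(μ.prod μ) := by
  have hM := h.pairMeasure_eq hΩ hμ hρ hρ0 hρi
  have h1 : Integrable f (pairMeasure P) := by
    rw [hM, integrable_withDensity_iff_integrable_smul' hρm.ennreal_ofReal
      (.of_forall fun _ => ENNReal.ofReal_lt_top)]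
    simpa only [ENNReal.toReal_ofReal (hρ0 _), smul_eq_mul] using hfi
  have h2 : ∫ p, f p ∂(pairMeasure P) = ∫ p, ρ p * f p ∂(μ.prod μ) := by
    rw [hM, integral_withDensity_eq_integral_toReal_smul hρm.ennreal_ofReal
      (.of_forall fun _ => ENNReal.ofReal_lt_top)]
    simp only [ENNReal.toReal_ofReal (hρ0 _), smul_eq_mul]
  have h3 : ∀ p ∈ (Finset.univ : Finset (Fin n)).offDiag,
      Integrable f (P.map fun x => (x p.1, x p.2)) := by
    rw [pairMeasure, integrable_finsetSum_measure] at h1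
    exact h1
  have h4 : ∀ p ∈ (Finset.univ : Finset (Fin n)).offDiag,
      Integrable (fun x => f (x p.1, x p.2)) P := fun p hp =>
    (h3 p hp).comp_measurable (measurable_pair p)
  refine ⟨integrable_finsetSum _ h4, ?_⟩
  rw [integral_finsetSum _ h4, ← h2, pairMeasure, integral_finsetSum_measure h3]
  exact Finset.sum_congr rfl fun p _ => (integral_map (measurable_pair p).aemeasurable
    hf.aestronglyMeasurable).symm

end FlatTorus

/-! ### Gamma and Gaussian integrals of the Riesz kernel -/

namespace FlatTorus

/-- The integrand `(π/t)^{d/2} e^{-π² r²/t} t^{s/2-1} / Γ(s/2)`. -/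
noncomputable def gaussWeight (d : ℕ) (s r t : ℝ) : ℝ :=
  Real.pi ^ ((d : ℝ) / 2) / t ^ ((d : ℝ) / 2) * Real.exp (-(Real.pi ^ 2 * r ^ 2) / t) *
    (t ^ (s / 2 - 1) / Real.Gamma (s / 2))

/-- The function `∫_1^∞ e^{-|x|² t} t^{s/2-1} / Γ(s/2) dt`. -/
noncomputable def shortRange {d : ℕ} (s : ℝ) (x : E d) : ℝ :=
  ∫ t in Set.Ioi (1 : ℝ), Real.exp (-‖x‖ ^ 2 * t) * (t ^ (s / 2 - 1) / Real.Gamma (s / 2))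

variable {d : ℕ} {s : ℝ}

theorem gaussWeight_nonneg (hs : 0 < s) {r t : ℝ} (ht : 0 < t) : 0 ≤ gaussWeight d s r t := by
  have := Real.Gamma_pos_of_pos (half_pos hs)
  unfold gaussWeight
  positivity

theorem gaussWeight_eq {r t : ℝ} (ht : 0 < t) : gaussWeight d s r t =
    Real.pi ^ ((d : ℝ) / 2) / Real.Gamma (s / 2) *
      (t ^ (-((d - s) / 2) - 1) * Real.exp (-(Real.pi ^ 2 * r ^ 2) / t)) := by
  have h : t ^ (-((d - s) / 2) - 1) = t ^ (s / 2 - 1) / t ^ ((d : ℝ) / 2) := by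
    rw [← Real.rpow_sub ht]; congr 1; ring
  rw [gaussWeight, h]
  ring

/-- The inversion `t ↦ 1/t` turns this into Euler's integral for `Γ(β)`. -/
theorem rpow_mul_exp_inv_integral {β a : ℝ} (hβ : 0 < β) (ha : 0 < a) :
    IntegrableOn (fun t : ℝ => t ^ (-β - 1) * Real.exp (-a / t)) (Set.Ioi 0) ∧
    ∫ t in Set.Ioi (0 : ℝ), t ^ (-β - 1) * Real.exp (-a / t) = (1 / a) ^ β * Real.Gamma β := by
  have h1 : ∀ t ∈ Set.Ioi (0 : ℝ), (|(-1 : ℝ)| * t ^ ((-1 : ℝ) - 1)) •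
      ((t ^ (-1 : ℝ)) ^ (β - 1) * Real.exp (-(a * t ^ (-1 : ℝ)))) =
      t ^ (-β - 1) * Real.exp (-a / t) := by
    intro t ht
    have ht' : 0 < t := ht
    rw [← Real.rpow_mul ht'.le, smul_eq_mul, ← mul_assoc, abs_neg, abs_one, one_mul,
      ← Real.rpow_add ht', Real.rpow_neg_one]
    congr 2
    · ring
    · field_simp
  have h2 := integral_comp_rpow_Ioi (fun y : ℝ => y ^ (β - 1) * Real.exp (-(a * y)))
    (p := -1) (by norm_num)
  have h3 := integrableOn_Ioi_comp_rpow_iff (fun y : ℝ => y ^ (β - 1) * Real.exp (-(a * y)))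
    (p := -1) (by norm_num)
  constructor
  · refine (h3.2 ?_).congr_fun h1 measurableSet_Ioi
    -- A non-integrable function has integral `0` by convention, whereas the Gamma integral is
    -- positive.
    by_contra hc
    have h4 := Real.integral_rpow_mul_exp_neg_mul_Ioi hβ ha
    rw [integral_undef hc] at h4
    have := Real.Gamma_pos_of_pos hβ
    have : 0 < (1 / a) ^ β * Real.Gamma β := by positivity
    linarith
  · rw [← Real.integral_rpow_mul_exp_neg_mul_Ioi hβ ha, ← h2]
    exact (setIntegral_congr_fun measurableSet_Ioi h1).symm

theorem integrableOn_gaussWeight (hsd : s < d) {r : ℝ} (hr : 0 < r) :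
    IntegrableOn (gaussWeight d s r) (Set.Ioi 0) := by
  have h := (rpow_mul_exp_inv_integral (β := (d - s) / 2) (a := Real.pi ^ 2 * r ^ 2)
    (by linarith) (by positivity)).1
  exact IntegrableOn.congr_fun (h.const_mul (Real.pi ^ ((d : ℝ) / 2) / Real.Gamma (s / 2)))
    (fun t ht => (gaussWeight_eq ht).symm) measurableSet_Ioi

theorem integral_gaussWeight (hsd : s < d) {r : ℝ} (hr : 0 < r) :
    ∫ t in Set.Ioi 0, gaussWeight d s r t =
      Real.pi ^ (s - (d : ℝ) / 2) * Real.Gamma ((d - s) / 2) / Real.Gamma (s / 2) *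
        (1 / r ^ (d - s)) := by
  rw [setIntegral_congr_fun measurableSet_Ioi fun t ht => gaussWeight_eq ht,
    integral_const_mul, (rpow_mul_exp_inv_integral (β := (d - s) / 2)
      (a := Real.pi ^ 2 * r ^ 2) (by linarith) (by positivity)).2]
  have h1 : (1 / (Real.pi ^ 2 * r ^ 2)) ^ (((d : ℝ) - s) / 2) =
      Real.pi ^ (-((d : ℝ) - s)) * (1 / r ^ ((d : ℝ) - s)) := by
    rw [Real.div_rpow zero_le_one (by positivity), Real.one_rpow, ← mul_pow,
      ← Real.rpow_natCast, ← Real.rpow_mul (by positivity), Nat.cast_ofNat,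
      mul_div_cancel₀ _ (two_ne_zero), Real.mul_rpow Real.pi_pos.le hr.le,
      Real.rpow_neg Real.pi_pos.le]
    field_simp
  have h2 : Real.pi ^ (s - (d : ℝ) / 2) =
      Real.pi ^ ((d : ℝ) / 2) * Real.pi ^ (-((d : ℝ) - s)) := by
    rw [← Real.rpow_add Real.pi_pos]; congr 1; ring
  rw [h1, h2]
  ring

/-- For frequency zero the weight is a pure power, integrable at infinity because `s < d`. Its
integral over `(1,∞)` is the source of the leading constant of the energy. -/
theorem gaussWeight_zero_Ioi_one (hsd : s < d) :
    IntegrableOn (gaussWeight d s 0) (Set.Ioi 1) ∧ ∫ t in Set.Ioi 1, gaussWeight d s 0 t =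
      2 * Real.pi ^ ((d : ℝ) / 2) / (Real.Gamma (s / 2) * (d - s)) := by
  have h0 : ∀ t ∈ Set.Ioi (1 : ℝ), Real.pi ^ ((d : ℝ) / 2) / Real.Gamma (s / 2) *
      t ^ (-((d - s) / 2) - 1) = gaussWeight d s 0 t := by
    intro t ht
    rw [gaussWeight_eq (zero_lt_one.trans ht)]
    simp
  have hβ : -(((d : ℝ) - s) / 2) - 1 < -1 := by linarith
  constructor
  · exact IntegrableOn.congr_fun ((integrableOn_Ioi_rpow_of_lt hβ zero_lt_one).const_mul _) h0
      measurableSet_Ioi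
  · rw [← setIntegral_congr_fun measurableSet_Ioi h0, integral_const_mul,
      integral_Ioi_rpow_of_lt hβ zero_lt_one, Real.one_rpow]
    have : (d : ℝ) - s ≠ 0 := by linarith
    rw [show -(((d : ℝ) - s) / 2) - 1 + 1 = -(((d : ℝ) - s) / 2) by ring]
    rw [neg_div_neg_eq, one_div_div, div_mul_div_comm]
    ring

theorem shortRange_nonneg (hs : 0 < s) (x : E d) : 0 ≤ shortRange s x := by
  have := Real.Gamma_pos_of_pos (half_pos hs)
  refine setIntegral_nonneg measurableSet_Ioi fun t ht => ?_
  have : (0 : ℝ) < t := zero_lt_one.trans ht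
  positivity

theorem measurable_shortRange : Measurable (shortRange s : E d → ℝ) := by
  unfold shortRange
  apply StronglyMeasurable.measurable
  refine StronglyMeasurable.integral_prod_right (f := fun (x : E d) (t : ℝ) =>
    Real.exp (-‖x‖ ^ 2 * t) * (t ^ (s / 2 - 1) / Real.Gamma (s / 2))) ?_
  apply Measurable.stronglyMeasurable
  simp only [Function.uncurry_def]
  fun_prop

theorem integral_exp_neg_mul_sq {t : ℝ} (ht : 0 < t) :
    ∫ x : E d, Real.exp (-‖x‖ ^ 2 * t) = Real.pi ^ ((d : ℝ) / 2) / t ^ ((d : ℝ) / 2) := by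
  have h := GaussianFourier.integral_rexp_neg_mul_sq_norm (V := E d) ht
  rw [finrank_euclideanSpace_fin, Real.div_rpow Real.pi_pos.le ht.le] at h
  rw [← h]
  congr 1; ext x; congr 1; ring

theorem integrable_exp_neg_mul_sq {t : ℝ} (ht : 0 < t) :
    Integrable fun x : E d => Real.exp (-‖x‖ ^ 2 * t) := by
  by_contra hc
  have h := integral_exp_neg_mul_sq (d := d) ht
  rw [integral_undef hc] at h
  have : 0 < Real.pi ^ ((d : ℝ) / 2) / t ^ ((d : ℝ) / 2) := by positivity
  linarith

theorem integral_exp_neg_mul_sq_char {t : ℝ} (ht : 0 < t) (w : E d) :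
    ∫ x : E d, (Real.exp (-‖x‖ ^ 2 * t) : ℂ) * char w x =
      ((Real.pi ^ ((d : ℝ) / 2) / t ^ ((d : ℝ) / 2) *
        Real.exp (-(Real.pi ^ 2 * ‖w‖ ^ 2) / t) : ℝ) : ℂ) := by
  have h := GaussianFourier.integral_cexp_neg_mul_sq_norm_add (V := E d) (b := (t : ℂ))
    (by simpa using ht) (2 * Real.pi * Complex.I) w
  rw [finrank_euclideanSpace_fin] at h
  have h1 : ∀ x : E d, (Real.exp (-‖x‖ ^ 2 * t) : ℂ) * char w x =
      Complex.exp (-(t : ℂ) * (‖x‖ : ℂ) ^ 2 + 2 * Real.pi * Complex.I * (inner ℝ w x : ℝ)) := by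
    intro x
    rw [char, Complex.ofReal_exp, ← Complex.exp_add, real_inner_comm]
    congr 1; push_cast; ring
  simp only [h1]
  rw [h, Complex.ofReal_mul, Complex.ofReal_exp, ← Real.div_rpow Real.pi_pos.le ht.le,
    Complex.ofReal_cpow (by positivity)]
  congr 1
  · push_cast; rfl
  · congr 1
    have : (t : ℂ) ≠ 0 := by exact_mod_cast ht.ne'
    push_cast
    field_simp
    rw [Complex.I_sq]; ring

/-- Integrating the Gaussian over space first leaves `gaussWeight d s 0` on `(1,∞)`. -/
theorem integrable_shortRange_prod (hs : 0 < s) (hsd : s < d) :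
    Integrable (fun p : E d × ℝ => Real.exp (-‖p.1‖ ^ 2 * p.2) *
      (p.2 ^ (s / 2 - 1) / Real.Gamma (s / 2)))
      ((volume : Measure (E d)).prod (volume.restrict (Set.Ioi 1))) := by
  have hG := Real.Gamma_pos_of_pos (half_pos hs)
  rw [integrable_prod_iff' (by
    apply Measurable.aestronglyMeasurable
    fun_prop)]
  constructor
  · filter_upwards [ae_restrict_mem measurableSet_Ioi] with t ht
    exact (integrable_exp_neg_mul_sq (zero_lt_one.trans ht)).mul_const _
  · refine Integrable.congr (gaussWeight_zero_Ioi_one hsd).1 ?_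
    filter_upwards [ae_restrict_mem measurableSet_Ioi] with t ht
    have ht0 : (0 : ℝ) < t := zero_lt_one.trans ht
    have : ∀ x : E d, ‖Real.exp (-‖x‖ ^ 2 * t) * (t ^ (s / 2 - 1) / Real.Gamma (s / 2))‖ =
        Real.exp (-‖x‖ ^ 2 * t) * (t ^ (s / 2 - 1) / Real.Gamma (s / 2)) := fun x =>
      Real.norm_of_nonneg (by positivity)
    simp only [this]
    rw [integral_mul_const, integral_exp_neg_mul_sq ht0, gaussWeight]
    simp

theorem integrable_shortRange (hs : 0 < s) (hsd : s < d) :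
    Integrable (shortRange s : E d → ℝ) :=
  (integrable_shortRange_prod hs hsd).integral_prod_left

theorem integral_shortRange_mul_char (hs : 0 < s) (hsd : s < d) (w : E d) :
    ∫ x : E d, (shortRange s x : ℂ) * char w x =
      ((∫ t in Set.Ioi 1, gaussWeight d s ‖w‖ t : ℝ) : ℂ) := by
  have h1 : Integrable (fun p : E d × ℝ => ((Real.exp (-‖p.1‖ ^ 2 * p.2) *
      (p.2 ^ (s / 2 - 1) / Real.Gamma (s / 2)) : ℝ) : ℂ) * char w p.1)
      ((volume : Measure (E d)).prod (volume.restrict (Set.Ioi 1))) := by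
    refine (integrable_shortRange_prod hs hsd).ofReal.mul_bdd (c := 1) ?_ ?_
    · exact ((continuous_char w).comp continuous_fst).aestronglyMeasurable
    · exact .of_forall fun p => (norm_char w p.1).le
  have h2 : ∀ x : E d, (shortRange s x : ℂ) * char w x = ∫ t in Set.Ioi (1 : ℝ),
      ((Real.exp (-‖x‖ ^ 2 * t) * (t ^ (s / 2 - 1) / Real.Gamma (s / 2)) : ℝ) : ℂ) *
        char w x := by
    intro x
    rw [integral_mul_const, integral_complex_ofReal, shortRange]
  simp only [h2]
  rw [integral_integral_swap h1, ← integral_complex_ofReal]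
  refine setIntegral_congr_fun measurableSet_Ioi fun t ht => ?_
  have ht0 : (0 : ℝ) < t := zero_lt_one.trans ht
  have h3 : ∀ x : E d, ((Real.exp (-‖x‖ ^ 2 * t) * (t ^ (s / 2 - 1) / Real.Gamma (s / 2)) : ℝ) : ℂ) *
      char w x = ((Real.exp (-‖x‖ ^ 2 * t) : ℂ) * char w x) *
        ((t ^ (s / 2 - 1) / Real.Gamma (s / 2) : ℝ) : ℂ) := by
    intro x; push_cast; ring
  simp only [h3]
  rw [integral_mul_const]
  simp only [gaussWeight]
  rw [integral_exp_neg_mul_sq_char ht0, ← Complex.ofReal_mul]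

/-- Any exponent larger than `d` makes the bound summable over a lattice of rank `d`. The choice
`2d` comes from the term of order `d` of the exponential series; the resulting `t^d` also
compensates `t^{-d/2}` on `(0,1]`. -/
theorem setIntegral_gaussWeight_le (hs : 0 < s) (hsd : s < d) {r : ℝ} (hr : 0 < r) :
    ∫ t in Set.Ioc 0 1, gaussWeight d s r t ≤
      (∫ t in Set.Ioc (0 : ℝ) 1, Real.pi ^ ((d : ℝ) / 2) * d.factorial *
        (t ^ (s / 2 - 1) / Real.Gamma (s / 2)) / (Real.pi ^ 2) ^ d) * r ^ (-(2 * d : ℝ)) := by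
  have hG := Real.Gamma_pos_of_pos (half_pos hs)
  rw [← integral_mul_const]
  have hi : IntegrableOn (fun t : ℝ => t ^ (s / 2 - 1)) (Set.Ioc 0 1) := by
    rw [← intervalIntegrable_iff_integrableOn_Ioc_of_le zero_le_one]
    exact intervalIntegral.intervalIntegrable_rpow' (by linarith)
  refine setIntegral_mono_on ((integrableOn_gaussWeight hsd hr).mono_set Set.Ioc_subset_Ioi_self)
    ?_ measurableSet_Ioc fun t ht => ?_
  · exact ((((hi.div_const _).const_mul _).div_const _).mul_const _)
  · have ht0 : 0 < t := ht.1
    set a := Real.pi ^ 2 * r ^ 2 with ha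
    have ha0 : 0 < a := by positivity
    have h1 : Real.exp (-a / t) ≤ d.factorial * (t / a) ^ d := by
      have h2 := Real.pow_div_factorial_le_exp (a / t) (by positivity) d
      rw [neg_div, Real.exp_neg]
      rw [inv_le_comm₀ (Real.exp_pos _) (by positivity)]
      refine le_trans (le_of_eq ?_) h2
      rw [div_pow, div_pow]
      field_simp
    have h3 : t ^ d / t ^ ((d : ℝ) / 2) ≤ 1 := by
      rw [← Real.rpow_natCast, ← Real.rpow_sub ht0]
      exact Real.rpow_le_one ht0.le ht.2 (by linarith [(Nat.cast_nonneg d : (0 : ℝ) ≤ d)])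
    have h4 : r ^ (-(2 * d : ℝ)) = 1 / (r ^ 2) ^ d := by
      rw [Real.rpow_neg hr.le, ← pow_mul, ← Real.rpow_natCast, one_div]
      push_cast; rfl
    rw [gaussWeight, h4]
    calc Real.pi ^ ((d : ℝ) / 2) / t ^ ((d : ℝ) / 2) * Real.exp (-a / t) *
          (t ^ (s / 2 - 1) / Real.Gamma (s / 2))
        ≤ Real.pi ^ ((d : ℝ) / 2) / t ^ ((d : ℝ) / 2) * (d.factorial * (t / a) ^ d) *
          (t ^ (s / 2 - 1) / Real.Gamma (s / 2)) := by gcongr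
      _ = Real.pi ^ ((d : ℝ) / 2) * d.factorial * (t ^ (s / 2 - 1) / Real.Gamma (s / 2)) /
          (Real.pi ^ 2) ^ d * (1 / (r ^ 2) ^ d) * (t ^ d / t ^ ((d : ℝ) / 2)) := by
          rw [ha, div_pow, mul_pow]; ring
      _ ≤ _ := mul_le_of_le_one_right (by positivity) h3

end FlatTorus

/-! ### Fourier coefficients of the periodic Riesz kernel -/

namespace FlatTorus

open scoped ComplexConjugate

variable {d : ℕ} {s : ℝ}

theorem measurable_periodization (v : Basis (Fin d) ℝ (E d)) {g : E d → ℝ} (hg : Measurable g)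
    (hg0 : ∀ x, 0 ≤ g x) : Measurable fun x => ∑' l : lattice v, g (x + (l : E d)) := by
  -- In `[0,∞]` a countable sum of measurable functions is always measurable. Where it diverges,
  -- `toReal` gives `0`, which is also the value of the divergent real series.
  have h : ∀ x, ∑' l : lattice v, g (x + (l : E d)) =
      (∑' l : lattice v, ENNReal.ofReal (g (x + (l : E d)))).toReal := by
    intro x
    rw [ENNReal.tsum_toReal_eq fun _ => ENNReal.ofReal_ne_top]
    simp only [ENNReal.toReal_ofReal (hg0 _)]
  simp only [h]
  exact (Measurable.tsum fun l => (hg.comp (by fun_prop)).ennreal_ofReal).ennreal_toReal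

theorem periodization_add (v : Basis (Fin d) ℝ (E d)) (g : E d → ℝ) (m : E d) (hm : m ∈ lattice v)
    (x : E d) : ∑' l : lattice v, g (x + m + (l : E d)) = ∑' l : lattice v, g (x + (l : E d)) := by
  rw [← (Equiv.addLeft (⟨m, hm⟩ : lattice v)).tsum_eq
    (fun l : lattice v => g (x + (l : E d)))]
  simp [add_assoc]

theorem tsum_lintegral_torus (v : Basis (Fin d) ℝ (E d)) (g : E d → ENNReal) :
    ∑' l : lattice v, ∫⁻ x in torus v, g (x + (l : E d)) = ∫⁻ x, g x := by
  rw [(isAddFundamentalDomain_torus v).lintegral_eq_tsum'' g]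
  simp only [Submodule.vadd_def, vadd_eq_add, add_comm]

theorem integrableOn_periodization (v : Basis (Fin d) ℝ (E d)) {g : E d → ℝ} (hg : Measurable g)
    (hg0 : ∀ x, 0 ≤ g x) (hi : Integrable g) :
    IntegrableOn (fun x => ∑' l : lattice v, g (x + (l : E d))) (torus v) := by
  refine ⟨(measurable_periodization v hg hg0).aestronglyMeasurable, ?_⟩
  rw [HasFiniteIntegral]
  calc ∫⁻ x in torus v, ‖∑' l : lattice v, g (x + (l : E d))‖ₑ
      ≤ ∫⁻ x in torus v, ∑' l : lattice v, ‖g (x + (l : E d))‖ₑ :=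
        lintegral_mono fun x => enorm_tsum_le_tsum_enorm
    _ = ∫⁻ x, ‖g x‖ₑ := by
        rw [lintegral_tsum (f := fun (l : lattice v) x => ‖g (x + (l : E d))‖ₑ)
          fun l => (hg.comp (measurable_add_const _)).enorm.aemeasurable,
          tsum_lintegral_torus v fun x => ‖g x‖ₑ]
    _ < ⊤ := hi.2

/-- Unfolding: the character is periodic and the translates of `Ω` tile the space, so a Fourier
coefficient of the periodization is a Fourier integral of `g`. -/
theorem setIntegral_periodization_mul_char (v : Basis (Fin d) ℝ (E d)) {g : E d → ℝ}
    (hg : Measurable g) (hi : Integrable g) {w : E d} (hw : w ∈ dualLattice v) :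
    ∫ x in torus v, ((∑' l : lattice v, g (x + (l : E d)) : ℝ) : ℂ) * char w x =
      ∫ x, (g x : ℂ) * char w x := by
  have h1 : ∀ x, ((∑' l : lattice v, g (x + (l : E d)) : ℝ) : ℂ) * char w x =
      ∑' l : lattice v, (g (x + (l : E d)) : ℂ) * char w (x + (l : E d)) := by
    intro x
    simp only [char_periodic v hw _ (Subtype.mem _)]
    rw [tsum_mul_right, Complex.ofReal_tsum]
  have hm : Measurable fun x => (g x : ℂ) * char w x :=
    (Complex.measurable_ofReal.comp hg).mul (continuous_char w).measurable
  have hgi : Integrable fun x => (g x : ℂ) * char w x :=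
    hi.ofReal.mul_bdd (c := 1) (continuous_char w).aestronglyMeasurable
      (.of_forall fun x => (norm_char w x).le)
  simp only [h1]
  rw [integral_tsum (f := fun (l : lattice v) x =>
    (g (x + (l : E d)) : ℂ) * char w (x + (l : E d)))
    fun l => (hm.comp (measurable_add_const _)).aestronglyMeasurable]
  · rw [(isAddFundamentalDomain_torus v).integral_eq_tsum'' _ hgi]
    simp only [Submodule.vadd_def, vadd_eq_add, add_comm]
  · rw [tsum_lintegral_torus v fun x => ‖(g x : ℂ) * char w x‖ₑ]
    exact hgi.2.ne

/-- The coefficients of the trigonometric series in the Riesz kernel. -/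
noncomputable def longCoeff (d : ℕ) (s r : ℝ) : ℝ := ∫ t in Set.Ioc 0 1, gaussWeight d s r t

theorem longCoeff_nonneg (hs : 0 < s) (r : ℝ) : 0 ≤ longCoeff d s r :=
  setIntegral_nonneg measurableSet_Ioc fun _ ht => gaussWeight_nonneg hs ht.1

theorem summable_longCoeff (v : Basis (Fin d) ℝ (E d)) (hs : 0 < s) (hsd : s < d) :
    Summable fun w : {w : dualLattice v // w ≠ 0} => longCoeff d s ‖(w : E d)‖ := by
  have hd : (0 : ℝ) < d := hs.trans hsd
  have h1 : Summable fun w : dualLattice v => ‖w‖ ^ (-(2 * d : ℝ)) := by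
    refine ZLattice.summable_norm_rpow _ _ ?_
    rw [ZLattice.rank ℝ, finrank_euclideanSpace_fin]
    linarith
  have h2 : Summable fun w : {w : dualLattice v // w ≠ 0} => ‖(w : E d)‖ ^ (-(2 * d : ℝ)) :=
    h1.subtype {w | w ≠ 0}
  refine Summable.of_nonneg_of_le (fun w => longCoeff_nonneg hs _)
    (fun w => setIntegral_gaussWeight_le hs hsd ?_) (h2.mul_left _)
  have := w.2
  simpa using this

/-- The trigonometric series in the Riesz kernel. -/
noncomputable def longRange (v : Basis (Fin d) ℝ (E d)) (s : ℝ) (x : E d) : ℂ :=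
  ∑' w : {w : dualLattice v // w ≠ 0}, char (w : E d) x * (longCoeff d s ‖(w : E d)‖ : ℂ)

theorem norm_char_mul_longCoeff (v : Basis (Fin d) ℝ (E d)) (hs : 0 < s)
    (w : {w : dualLattice v // w ≠ 0}) (x : E d) :
    ‖char (w : E d) x * (longCoeff d s ‖(w : E d)‖ : ℂ)‖ = longCoeff d s ‖(w : E d)‖ := by
  rw [norm_mul, norm_char, one_mul, Complex.norm_real, Real.norm_of_nonneg (longCoeff_nonneg hs _)]

theorem continuous_longRange (v : Basis (Fin d) ℝ (E d)) (hs : 0 < s) (hsd : s < d) :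
    Continuous (longRange v s) :=
  continuous_tsum (fun _ => (continuous_char _).mul continuous_const)
    (summable_longCoeff v hs hsd) fun w x => (norm_char_mul_longCoeff v hs w x).le

theorem longRange_add (v : Basis (Fin d) ℝ (E d)) (l : E d) (hl : l ∈ lattice v) (x : E d) :
    longRange v s (x + l) = longRange v s x := by
  simp only [longRange]
  refine tsum_congr fun w => ?_
  rw [char_periodic v (w : dualLattice v).2 l hl]

/-- The coefficients are even, so `w ↦ -w` exchanges the series with its conjugate. Hence taking the
real part in `rieszKernel` loses nothing. -/
theorem conj_longRange (v : Basis (Fin d) ℝ (E d)) (x : E d) :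
    conj (longRange v s x) = longRange v s x := by
  let e : {w : dualLattice v // w ≠ 0} ≃ {w : dualLattice v // w ≠ 0} :=
    (Equiv.neg _).subtypeEquiv fun _ => by simp
  rw [longRange, Complex.conj_tsum, ← e.tsum_eq]
  refine tsum_congr fun w => ?_
  simp [e, conj_char]

theorem longRange_re (v : Basis (Fin d) ℝ (E d)) (x : E d) :
    ((longRange v s x).re : ℂ) = longRange v s x :=
  Complex.conj_eq_iff_re.1 (conj_longRange v x)

theorem setIntegral_longRange_mul_char (v : Basis (Fin d) ℝ (E d)) (hs : 0 < s) (hsd : s < d)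
    {w : E d} (hw : w ∈ dualLattice v) :
    ∫ x in torus v, longRange v s x * char w x =
      if w = 0 then 0 else (covol v : ℂ) * (longCoeff d s ‖w‖ : ℂ) := by
  have h0 : ∀ (u : {w : dualLattice v // w ≠ 0}) (x : E d),
      char (u : E d) x * (longCoeff d s ‖(u : E d)‖ : ℂ) * char w x =
      char ((u : E d) + w) x * (longCoeff d s ‖(u : E d)‖ : ℂ) := by
    intro u x; rw [char_add]; ring
  have h1 : ∀ x, longRange v s x * char w x = ∑' u : {w : dualLattice v // w ≠ 0},
      char ((u : E d) + w) x * (longCoeff d s ‖(u : E d)‖ : ℂ) := by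
    intro x
    simp only [longRange, ← h0]
    rw [tsum_mul_right]
  simp only [h1]
  rw [← integral_tsum_of_summable_integral_norm]
  · have h2 : ∀ u : {w : dualLattice v // w ≠ 0}, ∫ x in torus v,
        char ((u : E d) + w) x * (longCoeff d s ‖(u : E d)‖ : ℂ) =
        if (u : E d) = -w then (covol v : ℂ) * (longCoeff d s ‖w‖ : ℂ) else 0 := by
      intro u
      rw [integral_mul_const, setIntegral_char v (add_mem (u : dualLattice v).2 hw)]
      simp only [add_eq_zero_iff_eq_neg]
      split_ifs with h
      · rw [h, norm_neg]
      · rw [zero_mul]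
    simp only [h2]
    split_ifs with h
    · refine (tsum_congr fun u => if_neg ?_).trans tsum_zero
      rw [h, neg_zero]
      have := u.2
      simpa using this
    · rw [tsum_eq_single (⟨⟨-w, neg_mem hw⟩, by simpa [Subtype.ext_iff] using h⟩ :
        {w : dualLattice v // w ≠ 0})]
      · simp
      · intro u hu
        refine if_neg fun h' => hu ?_
        ext1; ext1; exact h'
  · intro u
    exact (integrableOn_char v _).mul_const _
  · have h3 : ∀ (u : {w : dualLattice v // w ≠ 0}) (x : E d),
        ‖char ((u : E d) + w) x * (longCoeff d s ‖(u : E d)‖ : ℂ)‖ =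
        longCoeff d s ‖(u : E d)‖ := by
      intro u x
      rw [← h0, norm_mul, norm_char_mul_longCoeff v hs, norm_char, mul_one]
    simp only [h3, setIntegral_const, volume_real_torus, smul_eq_mul]
    exact (summable_longCoeff v hs hsd).mul_left _

theorem rieszKernel_eq (v : Basis (Fin d) ℝ (E d)) (x : E d) :
    rieszKernel v s x = (∑' l : lattice v, shortRange s (x + (l : E d))) +
      (covol v)⁻¹ * (longRange v s x).re := by
  rw [← one_div]; rfl

theorem measurable_rieszKernel (v : Basis (Fin d) ℝ (E d)) (hs : 0 < s) (hsd : s < d) :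
    Measurable (rieszKernel v s) := by
  have h : rieszKernel v s = fun x => (∑' l : lattice v, shortRange s (x + (l : E d))) +
      (covol v)⁻¹ * (longRange v s x).re := funext (rieszKernel_eq v)
  rw [h]
  exact (measurable_periodization v measurable_shortRange (shortRange_nonneg hs)).add
    (measurable_const.mul (Complex.measurable_re.comp (continuous_longRange v hs hsd).measurable))

theorem rieszKernel_add (v : Basis (Fin d) ℝ (E d)) (l : E d) (hl : l ∈ lattice v) (x : E d) :
    rieszKernel v s (x + l) = rieszKernel v s x := by
  rw [rieszKernel_eq, rieszKernel_eq, longRange_add v l hl, periodization_add v _ l hl]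

theorem integrableOn_rieszKernel (v : Basis (Fin d) ℝ (E d)) (hs : 0 < s) (hsd : s < d) :
    IntegrableOn (rieszKernel v s) (torus v) := by
  have h : rieszKernel v s = fun x => (∑' l : lattice v, shortRange s (x + (l : E d))) +
      (covol v)⁻¹ * (longRange v s x).re := funext (rieszKernel_eq v)
  rw [h]
  refine Integrable.add (integrableOn_periodization v measurable_shortRange (shortRange_nonneg hs)
    (integrable_shortRange hs hsd)) ?_
  have hc : Continuous fun x => (covol v)⁻¹ * (longRange v s x).re :=
    continuous_const.mul (Complex.continuous_re.comp (continuous_longRange v hs hsd))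
  exact (hc.locallyIntegrable.integrableOn_isCompact (isBounded_torus v).isCompact_closure).mono_set
    subset_closure

/-- For `w ≠ 0` the short-range part contributes the integral of `gaussWeight` over `(1,∞)` and the
trigonometric series the one over `(0,1]`; together they form the complete Gamma integral. For `w =
0` the series has no term and only the first part remains. -/
theorem setIntegral_rieszKernel_mul_char (v : Basis (Fin d) ℝ (E d)) (hs : 0 < s) (hsd : s < d)
    {w : E d} (hw : w ∈ dualLattice v) :
    ∫ x in torus v, (rieszKernel v s x : ℂ) * char w x =
      ((if w = 0 then 2 * Real.pi ^ ((d : ℝ) / 2) / (Real.Gamma (s / 2) * (d - s)) else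
        Real.pi ^ (s - (d : ℝ) / 2) * Real.Gamma ((d - s) / 2) / Real.Gamma (s / 2) *
        (1 / ‖w‖ ^ (d - s)) : ℝ) : ℂ) := by
  have h1 : ∀ x, (rieszKernel v s x : ℂ) * char w x =
      ((∑' l : lattice v, shortRange s (x + (l : E d)) : ℝ) : ℂ) * char w x +
      (covol v : ℂ)⁻¹ * (longRange v s x * char w x) := by
    intro x
    rw [rieszKernel_eq, Complex.ofReal_add, Complex.ofReal_mul, longRange_re, Complex.ofReal_inv]
    ring
  have hcv : (covol v : ℂ) ≠ 0 := by exact_mod_cast (covol_pos v).ne'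
  simp only [h1]
  rw [integral_add, integral_const_mul, setIntegral_longRange_mul_char v hs hsd hw,
    setIntegral_periodization_mul_char v measurable_shortRange (integrable_shortRange hs hsd) hw,
    integral_shortRange_mul_char hs hsd]
  · split_ifs with h
    · rw [h, norm_zero, (gaussWeight_zero_Ioi_one hsd).2]
      simp
    · rw [inv_mul_cancel_left₀ hcv, ← Complex.ofReal_add, Complex.ofReal_inj]
      have hr : 0 < ‖w‖ := norm_pos_iff.2 h
      have hi := integrableOn_gaussWeight hsd hr
      rw [← integral_gaussWeight hsd hr, longCoeff, add_comm,
        ← setIntegral_union (Set.Ioc_disjoint_Ioi le_rfl) measurableSet_Ioi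
          (hi.mono_set Set.Ioc_subset_Ioi_self)
          (hi.mono_set (Set.Ioi_subset_Ioi zero_le_one)),
        Set.Ioc_union_Ioi_eq_Ioi zero_le_one]
  · exact (integrableOn_periodization v measurable_shortRange (shortRange_nonneg hs)
      (integrable_shortRange hs hsd)).ofReal.mul_bdd (c := 1)
      (continuous_char w).aestronglyMeasurable (.of_forall fun x => (norm_char w x).le)
  · refine Integrable.const_mul ?_ _
    exact (((continuous_longRange v hs hsd).mul (continuous_char w)).locallyIntegrable
      |>.integrableOn_isCompact (isBounded_torus v).isCompact_closure).mono_set subset_closure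

end FlatTorus

/-! ### The exact formula for the expected energy -/

namespace FlatTorus

open scoped ComplexConjugate

variable {d : ℕ} {s : ℝ}

/-- The trigonometric polynomial with frequencies in `S`. -/
noncomputable def trigPoly {v : Basis (Fin d) ℝ (E d)} (S : Finset (dualLattice v)) (x : E d) : ℂ :=
  ∑ w ∈ S, char (w : E d) x

theorem norm_trigPoly_le {v : Basis (Fin d) ℝ (E d)} (S : Finset (dualLattice v)) (x : E d) :
    ‖trigPoly S x‖ ≤ S.card := by
  refine (norm_sum_le _ _).trans ?_
  simp [norm_char]

theorem continuous_trigPoly {v : Basis (Fin d) ℝ (E d)} (S : Finset (dualLattice v)) :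
    Continuous (trigPoly S) :=
  continuous_finsetSum _ fun _ _ => continuous_char _

theorem trigPoly_add {v : Basis (Fin d) ℝ (E d)} (S : Finset (dualLattice v)) (l : E d)
    (hl : l ∈ lattice v) (x : E d) : trigPoly S (x + l) = trigPoly S x :=
  Finset.sum_congr rfl fun w _ => char_periodic v w.2 l hl x

theorem normSq_trigPoly {v : Basis (Fin d) ℝ (E d)} (S : Finset (dualLattice v)) (x : E d) :
    ((‖trigPoly S x‖ ^ 2 : ℝ) : ℂ) = ∑ w ∈ S, ∑ w' ∈ S, char ((w : E d) - (w' : E d)) x := by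
  rw [← Complex.normSq_eq_norm_sq, ← Complex.mul_conj, trigPoly, map_sum, Finset.sum_mul_sum]
  simp only [conj_char, ← char_add, sub_eq_add_neg]

/-- Expanding `|trigPoly|²` gives one Fourier coefficient per pair of frequencies. The diagonal
pairs all give the coefficient at zero, hence the term linear in `S.card`. -/
theorem setIntegral_rieszKernel_mul_intensity (v : Basis (Fin d) ℝ (E d)) (hs : 0 < s)
    (hsd : s < d) (S : Finset (dualLattice v)) :
    (covol v)⁻¹ * ∫ x in torus v, ((S.card : ℝ) ^ 2 - ‖trigPoly S x‖ ^ 2) * rieszKernel v s x =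
      leadingConst v s * (S.card : ℝ) ^ 2 - (leadingConst v s * S.card +
        Real.pi ^ (s - (d : ℝ) / 2) * Real.Gamma ((d - s) / 2) / (Real.Gamma (s / 2) * covol v) *
        ∑ w ∈ S, ∑ w' ∈ S, 1 / ‖(w : E d) - (w' : E d)‖ ^ ((d : ℝ) - s)) := by
  have hi := integrableOn_rieszKernel v hs hsd
  have hic : ∀ w : E d, IntegrableOn (fun x => (rieszKernel v s x : ℂ) * char w x) (torus v) :=
    fun w => hi.ofReal.mul_bdd (c := 1) (continuous_char w).aestronglyMeasurable
      (.of_forall fun x => (norm_char w x).le)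
  set A : E d → ℝ := fun w =>
    if w = 0 then 2 * Real.pi ^ ((d : ℝ) / 2) / (Real.Gamma (s / 2) * (d - s)) else
        Real.pi ^ (s - (d : ℝ) / 2) * Real.Gamma ((d - s) / 2) / Real.Gamma (s / 2) *
        (1 / ‖w‖ ^ (d - s)) with hA
  have h1 : ∀ w ∈ dualLattice v, ∫ x in torus v, (rieszKernel v s x : ℂ) * char w x = (A w : ℂ) :=
    fun w hw => setIntegral_rieszKernel_mul_char v hs hsd hw
  have h2 : ((∫ x in torus v, ((S.card : ℝ) ^ 2 - ‖trigPoly S x‖ ^ 2) * rieszKernel v s x : ℝ) : ℂ)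
      = ((S.card ^ 2 * A 0 - ∑ w ∈ S, ∑ w' ∈ S, A ((w : E d) - (w' : E d)) : ℝ) : ℂ) := by
    rw [← integral_complex_ofReal]
    have h3 : ∀ x, ((((S.card : ℝ) ^ 2 - ‖trigPoly S x‖ ^ 2) * rieszKernel v s x : ℝ) : ℂ) =
        (S.card : ℂ) ^ 2 * ((rieszKernel v s x : ℂ) * char 0 x) - ∑ w ∈ S, ∑ w' ∈ S,
          (rieszKernel v s x : ℂ) * char ((w : E d) - (w' : E d)) x := by
      intro x
      rw [Complex.ofReal_mul, Complex.ofReal_sub, normSq_trigPoly, char_zero]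
      simp only [← Finset.mul_sum]
      push_cast; ring
    simp only [h3]
    rw [integral_sub ((hic 0).const_mul _) (integrable_finsetSum _ fun w _ =>
      integrable_finsetSum _ fun w' _ => hic _), integral_const_mul, h1 0 (zero_mem _),
      integral_finsetSum _ fun w _ => integrable_finsetSum _ fun w' _ => hic _]
    push_cast
    congr 1
    refine Finset.sum_congr rfl fun w _ => ?_
    rw [integral_finsetSum _ fun w' _ => hic _]
    exact Finset.sum_congr rfl fun w' _ => h1 _ (sub_mem w.2 w'.2)
  rw [Complex.ofReal_inj] at h2
  rw [h2]
  have h4 : ∀ w ∈ S, ∑ w' ∈ S, A ((w : E d) - (w' : E d)) = A 0 +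
      Real.pi ^ (s - (d : ℝ) / 2) * Real.Gamma ((d - s) / 2) / Real.Gamma (s / 2) *
      ∑ w' ∈ S, 1 / ‖(w : E d) - (w' : E d)‖ ^ ((d : ℝ) - s) := by
    intro w hw
    rw [Finset.mul_sum]
    rw [← Finset.add_sum_erase _ _ hw, ← Finset.add_sum_erase _ (fun w' : dualLattice v =>
      Real.pi ^ (s - (d : ℝ) / 2) * Real.Gamma ((d - s) / 2) / Real.Gamma (s / 2) *
      (1 / ‖(w : E d) - (w' : E d)‖ ^ ((d : ℝ) - s))) hw]
    -- The diagonal term of the full double sum is `1 / 0 = 0`, so it may be included without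
    -- effect.
    rw [sub_self, norm_zero, Real.zero_rpow (by linarith), div_zero, mul_zero, zero_add]
    congr 1
    refine Finset.sum_congr rfl fun w' hw' => ?_
    rw [hA]
    refine if_neg ?_
    rw [sub_eq_zero, Subtype.coe_inj]
    exact (Finset.ne_of_mem_erase hw').symm
  rw [Finset.sum_congr rfl h4, Finset.sum_add_distrib, ← Finset.mul_sum, Finset.sum_const,
    nsmul_eq_mul]
  have h5 : A 0 = leadingConst v s * covol v := by
    have := (covol_pos v).ne'
    rw [hA, leadingConst]
    simp only [if_true]
    field_simp
  rw [h5]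
  have := (covol_pos v).ne'
  field_simp

theorem IsProcess.energy [NeZero d] {v : Basis (Fin d) ℝ (E d)} (hs : 0 < s) (hsd : s < d)
    {D : Set (E d)} (hD : Bornology.IsBounded D) {N : ℕ} {P : Measure (Fin (trace v D N) → E d)}
    (h : IsProcess v D N P) :
    Integrable (rieszEnergy v s) P ∧ ∫ x, rieszEnergy v s x ∂P =
      leadingConst v s * (trace v D N : ℝ) ^ 2 - (leadingConst v s * trace v D N +
        Real.pi ^ (s - (d : ℝ) / 2) * Real.Gamma ((d - s) / 2) / (Real.Gamma (s / 2) * covol v) *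
        ∑ w ∈ (finite_latticePoints v hD N).toFinset,
          ∑ w' ∈ (finite_latticePoints v hD N).toFinset,
          1 / ‖(w : E d) - (w' : E d)‖ ^ ((d : ℝ) - s)) := by
  set S := (finite_latticePoints v hD N).toFinset
  set r : E d → ℝ := fun x => (S.card : ℝ) ^ 2 - ‖trigPoly S x‖ ^ 2 with hr
  have hrc : Continuous r := continuous_const.sub ((continuous_trigPoly S).norm.pow 2)
  have hr0 : ∀ x, 0 ≤ r x := fun x =>
    sub_nonneg.2 (pow_le_pow_left₀ (norm_nonneg _) (norm_trigPoly_le S x) 2)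
  have hrb : ∀ x, ‖r x‖ ≤ (S.card : ℝ) ^ 2 := fun x => by
    rw [Real.norm_of_nonneg (hr0 x)]
    exact sub_le_self _ (by positivity)
  have hK : ∀ u u', kernel v (kappa v D N) u u' = trigPoly S (u - u') := kernel_kappa v hD N
  have hρ : ∀ u u' : E d, ((r (u - u') : ℝ) : ℂ) =
      kernel v (kappa v D N) u u * kernel v (kappa v D N) u' u' -
      kernel v (kappa v D N) u u' * kernel v (kappa v D N) u' u := by
    intro u u'
    have h1 : trigPoly S (u' - u) = conj (trigPoly S (u - u')) := by
      simp only [trigPoly, map_sum]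
      refine Finset.sum_congr rfl fun w _ => ?_
      rw [char_sub_right, char_sub_right]
      simp [mul_comm]
    have h2 : trigPoly S 0 = S.card := by
      simp [trigPoly, char]
    simp only [hK, sub_self, h2, h1]
    rw [Complex.mul_conj, Complex.normSq_eq_norm_sq, hr]
    push_cast; ring
  have hm : StronglyMeasurable fun x => r x * rieszKernel v s x :=
    (hrc.measurable.mul (measurable_rieszKernel v hs hsd)).stronglyMeasurable
  have hp : ∀ l ∈ lattice v, ∀ x,
      r (x + l) * rieszKernel v s (x + l) = r x * rieszKernel v s x := by
    intro l hl x
    simp only [hr, trigPoly_add S l hl, rieszKernel_add v l hl]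
  have hi : IntegrableOn (fun x => r x * rieszKernel v s x) (torus v) :=
    (integrableOn_rieszKernel v hs hsd).bdd_mul hrc.aestronglyMeasurable (.of_forall hrb)
  have hrm : Measurable fun p : E d × E d => r (p.1 - p.2) :=
    hrc.measurable.comp (measurable_fst.sub measurable_snd)
  have h3 := IsDeterminantal.integrable_sum_pair h (measurableSet_torus v) (ae_mem_torus v)
    (ρ := fun p => r (p.1 - p.2)) (f := fun p => rieszKernel v s (p.1 - p.2)) hρ
    (fun p => hr0 _) hrm
    (Integrable.of_bound hrm.aestronglyMeasurable _ (.of_forall fun p => hrb _))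
    ((measurable_rieszKernel v hs hsd).comp (measurable_fst.sub measurable_snd))
    (integrable_prod_torus_sub v hm hp hi)
  refine ⟨h3.1, h3.2.trans ?_⟩
  rw [integral_prod_torus_sub v hm hp hi, smul_eq_mul, trace_eq_card v hD]
  exact setIntegral_rieszKernel_mul_intensity v hs hsd S

end FlatTorus

/-! ### Local integrability of the potential and the cells of the dual lattice -/

namespace FlatTorus

open Filter Topology
open scoped Pointwise

variable {d : ℕ}

theorem integrableOn_ball_one_div_norm_rpow [NeZero d] {t : ℝ} (htd : t < d) (M : ℝ) :
    IntegrableOn (fun x : E d => 1 / ‖x‖ ^ t) (Metric.ball 0 M) := by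
  have h1 : (Metric.ball (0 : E d) M).indicator (fun x => 1 / ‖x‖ ^ t) =
      fun x : E d => (Set.Iio M).indicator (fun r : ℝ => 1 / r ^ t) ‖x‖ := by
    ext x
    by_cases hx : ‖x‖ < M <;> simp [Set.indicator, hx]
  rw [← integrable_indicator_iff measurableSet_ball, h1,
    integrable_fun_norm_addHaar (volume : Measure (E d))
    (f := (Set.Iio M).indicator (fun r : ℝ => 1 / r ^ t))]
  have hd : 0 < d := Nat.pos_of_ne_zero (NeZero.ne d)
  have h2 : IntegrableOn (fun r : ℝ => r ^ ((d : ℝ) - 1 - t)) (Set.Ioo 0 M) := by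
    rcases le_or_gt M 0 with hM | hM
    · simp [hM]
    · rw [← integrableOn_Ioc_iff_integrableOn_Ioo,
        ← intervalIntegrable_iff_integrableOn_Ioc_of_le hM.le]
      exact intervalIntegral.intervalIntegrable_rpow' (by linarith)
  rw [← integrable_indicator_iff measurableSet_Ioi]
  rw [← integrable_indicator_iff measurableSet_Ioo] at h2
  convert h2 using 1
  ext r
  by_cases h0 : 0 < r <;> by_cases hM : r < M <;> simp [Set.indicator, h0, hM]
  rw [Real.rpow_sub h0, Real.rpow_sub_one h0.ne', Real.rpow_natCast, div_eq_mul_inv]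
  congr 1
  rw [eq_div_iff h0.ne', pow_sub_one_mul hd.ne']

/-- Differences of points of a ball lie in the ball of twice the radius. This bounds the interaction
of one point with the ball uniformly in the point. -/
theorem lintegral_ball_le [NeZero d] (k : E d → ENNReal) {M : ℝ} {x : E d}
    (hx : x ∈ Metric.ball (0 : E d) M) :
    ∫⁻ y in Metric.ball (0 : E d) M, k (x - y) ≤ ∫⁻ u in Metric.ball (0 : E d) (2 * M), k u := by
  rw [← lintegral_indicator measurableSet_ball, ← lintegral_indicator measurableSet_ball,
    ← lintegral_sub_left_eq_self (fun u => (Metric.ball (0 : E d) (2 * M)).indicator k u) x]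
  refine lintegral_mono fun y => ?_
  by_cases hy : y ∈ Metric.ball (0 : E d) M
  · rw [Set.indicator_of_mem hy, Set.indicator_of_mem]
    rw [mem_ball_zero_iff] at *
    linarith [norm_sub_le x y]
  · rw [Set.indicator_of_notMem hy]
    exact zero_le

theorem integrableOn_prod_one_div_norm_sub_rpow [NeZero d] {t : ℝ} (htd : t < d) (M : ℝ) :
    IntegrableOn (fun p : E d × E d => 1 / ‖p.1 - p.2‖ ^ t)
      (Metric.ball 0 M ×ˢ Metric.ball 0 M) := by
  have hm : Measurable fun p : E d × E d => 1 / ‖p.1 - p.2‖ ^ t := by fun_prop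
  refine ⟨hm.aestronglyMeasurable, ?_⟩
  rw [HasFiniteIntegral, Measure.volume_eq_prod, ← Measure.prod_restrict,
    lintegral_prod _ hm.enorm.aemeasurable]
  have h1 := (integrableOn_ball_one_div_norm_rpow htd (2 * M)).2
  rw [HasFiniteIntegral] at h1
  calc _ ≤ ∫⁻ x in Metric.ball (0 : E d) M,
        ∫⁻ u in Metric.ball (0 : E d) (2 * M), ‖1 / ‖u‖ ^ t‖ₑ := by
        refine setLIntegral_mono' measurableSet_ball fun x hx => ?_
        exact lintegral_ball_le (fun u => ‖1 / ‖u‖ ^ t‖ₑ) hx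
    _ < ⊤ := by
        rw [setLIntegral_const]
        exact ENNReal.mul_lt_top h1 measure_ball_lt_top

theorem nu_prod_nu (v : Basis (Fin d) ℝ (E d)) :
    (nu v).prod (nu v) = ENNReal.ofReal (covol v ^ 2) • (volume : Measure (E d × E d)) := by
  rw [nu_eq, Measure.prod_smul_left, Measure.prod_smul_right, smul_smul,
    ← ENNReal.ofReal_mul (covol_pos v).le, ← sq, Measure.volume_eq_prod]

theorem integrableOn_nu_prod [NeZero d] (v : Basis (Fin d) ℝ (E d)) {t : ℝ} (htd : t < d)
    {D : Set (E d)} (hD : Bornology.IsBounded D) :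
    IntegrableOn (fun p : E d × E d => 1 / ‖p.1 - p.2‖ ^ t) (D ×ˢ D) ((nu v).prod (nu v)) := by
  obtain ⟨M, hM⟩ := hD.subset_ball 0
  rw [nu_prod_nu, IntegrableOn, Measure.restrict_smul]
  exact ((integrableOn_prod_one_div_norm_sub_rpow htd M).mono_set
    (Set.prod_mono hM hM)).smul_measure ENNReal.ofReal_ne_top

/-- The point of the dual lattice in the same cell as `x`. -/
noncomputable def latticeFloor (v : Basis (Fin d) ℝ (E d)) (x : E d) : dualLattice v :=
  ⟨ZSpan.floor (dualBasis v) x, (dualLattice_eq v).ge (ZSpan.floor (dualBasis v) x).2⟩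

theorem latticeFloor_eq_iff (v : Basis (Fin d) ℝ (E d)) (x : E d) (w : dualLattice v) :
    latticeFloor v x = w ↔ x - w ∈ torus (dualBasis v) := by
  have hw : (w : E d) ∈ Submodule.span ℤ (Set.range (dualBasis v)) := (dualLattice_eq v).le w.2
  rw [torus, ← ZSpan.fract_eq_self, sub_eq_add_neg,
    ZSpan.fract_add_ZSpan _ _ (neg_mem hw), ZSpan.fract_apply, ← sub_eq_add_neg, sub_right_inj,
    Subtype.ext_iff]
  rfl

theorem measurableSet_latticeFloor (v : Basis (Fin d) ℝ (E d)) (w : dualLattice v) :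
    MeasurableSet {x | latticeFloor v x = w} := by
  simp only [latticeFloor_eq_iff]
  exact (measurable_id.sub_const _) (measurableSet_torus _)

theorem nu_latticeFloor (v : Basis (Fin d) ℝ (E d)) (w : dualLattice v) :
    nu v {x | latticeFloor v x = w} = 1 := by
  simp only [latticeFloor_eq_iff]
  have h := (measurePreserving_sub_right (nu v) (w : E d)).measure_preimage
    (measurableSet_torus (dualBasis v)).nullMeasurableSet
  rw [show {x | x - (w : E d) ∈ torus (dualBasis v)} =
    (fun x => x - (w : E d)) ⁻¹' torus (dualBasis v) from rfl, h, nu_eq, Measure.smul_apply,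
    volume_torus, smul_eq_mul, ← ENNReal.ofReal_mul (covol_pos v).le, covol_mul_covol_dual,
    ENNReal.ofReal_one]

theorem exists_norm_sub_latticeFloor_le (v : Basis (Fin d) ℝ (E d)) :
    ∃ δ : ℝ, 0 ≤ δ ∧ ∀ x, ‖x - latticeFloor v x‖ ≤ δ :=
  ⟨∑ i, ‖dualBasis v i‖, Finset.sum_nonneg fun _ _ => norm_nonneg _,
    ZSpan.norm_fract_le (dualBasis v)⟩

theorem exists_le_norm_of_mem_dualLattice (v : Basis (Fin d) ℝ (E d)) :
    ∃ ε : ℝ, 0 < ε ∧ ∀ w : dualLattice v, w ≠ 0 → ε ≤ ‖(w : E d)‖ := by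
  obtain ⟨ε, hε, h⟩ := Metric.exists_ball_inter_eq_singleton_of_mem_discrete
    (s := (dualLattice v : Set (E d)))
    (isDiscrete_iff_discreteTopology.2 (inferInstanceAs (DiscreteTopology (dualLattice v)))) (zero_mem (dualLattice v))
  refine ⟨ε, hε, fun w hw => ?_⟩
  by_contra! hlt
  have : (w : E d) ∈ Metric.ball (0 : E d) ε ∩ (dualLattice v : Set (E d)) :=
    ⟨by simpa using hlt, w.2⟩
  rw [h] at this
  exact hw (by ext1; simpa using this)

-- Since the cells have `ν`-measure one, sums over lattice points become integrals of functions of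
-- `latticeFloor`.
open Classical in
theorem integral_sum_latticeFloor (v : Basis (Fin d) ℝ (E d)) (S : Finset (dualLattice v)) :
    ∫ x, (if latticeFloor v x ∈ S then (1 : ℝ) else 0) ∂(nu v) = S.card := by
  have h1 : ∀ x, (if latticeFloor v x ∈ S then (1 : ℝ) else 0) =
      ∑ w ∈ S, {x | latticeFloor v x = w}.indicator (fun _ => (1 : ℝ)) x := by
    intro x
    simp [Set.indicator]
  have h2 : ∀ w : dualLattice v, (nu v).real {x | latticeFloor v x = w} = 1 := fun w => by
    rw [measureReal_def, nu_latticeFloor, ENNReal.toReal_one]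
  simp only [h1]
  rw [integral_finsetSum]
  · simp only [integral_indicator_const _ (measurableSet_latticeFloor v _), h2, smul_eq_mul,
      mul_one, Finset.sum_const, nsmul_eq_mul]
  · intro w _
    refine (integrable_indicator_iff (measurableSet_latticeFloor v w)).2 (integrableOn_const ?_)
    rw [nu_latticeFloor]; simp

open Classical in
theorem integral_sum_latticeFloor_prod (v : Basis (Fin d) ℝ (E d)) (S : Finset (dualLattice v))
    (a : dualLattice v → dualLattice v → ℝ) :
    ∫ p : E d × E d, (if latticeFloor v p.1 ∈ S ∧ latticeFloor v p.2 ∈ S then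
      a (latticeFloor v p.1) (latticeFloor v p.2) else 0) ∂((nu v).prod (nu v)) =
      ∑ w ∈ S, ∑ w' ∈ S, a w w' := by
  set c : dualLattice v → Set (E d) := fun w => {x | latticeFloor v x = w}
  have h1 : ∀ p : E d × E d, (if latticeFloor v p.1 ∈ S ∧ latticeFloor v p.2 ∈ S then
      a (latticeFloor v p.1) (latticeFloor v p.2) else 0) =
      ∑ w ∈ S, ∑ w' ∈ S, (c w ×ˢ c w').indicator (fun _ => a w w') p := by
    intro p
    have : ∀ w w', (c w ×ˢ c w').indicator (fun _ => a w w') p =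
        if latticeFloor v p.1 = w then (if latticeFloor v p.2 = w' then a w w' else 0) else 0 := by
      intro w w'
      rw [← ite_and]
      simp only [Set.indicator, Set.mem_prod]
      congr
    simp only [this, Finset.sum_ite_eq, Finset.sum_ite_irrel, Finset.sum_const_zero, ite_and]
  have hm : ∀ w w', MeasurableSet (c w ×ˢ c w') := fun w w' =>
    (measurableSet_latticeFloor v w).prod (measurableSet_latticeFloor v w')
  have h2 : ∀ w w', (nu v).prod (nu v) (c w ×ˢ c w') = 1 := fun w w' => by
    rw [Measure.prod_prod, nu_latticeFloor, nu_latticeFloor, one_mul]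
  have h3 : ∀ w w', Integrable ((c w ×ˢ c w').indicator (fun _ => a w w'))
      ((nu v).prod (nu v)) := fun w w' =>
    (integrable_indicator_iff (hm w w')).2 (integrableOn_const (by rw [h2]; simp))
  simp only [h1]
  rw [integral_finsetSum _ fun w _ => integrable_finsetSum _ fun w' _ => h3 w w']
  refine Finset.sum_congr rfl fun w _ => ?_
  rw [integral_finsetSum _ fun w' _ => h3 w w']
  refine Finset.sum_congr rfl fun w' _ => ?_
  rw [integral_indicator_const _ (hm w w'), measureReal_def, h2]
  simp

end FlatTorus

/-! ### Asymptotics of lattice point counts and pair sums -/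

namespace FlatTorus

open Filter Topology
open scoped Pointwise

variable {d : ℕ}

theorem tendsto_rpow_one_div_atTop [NeZero d] :
    Tendsto (fun N : ℕ => (N : ℝ) ^ (1 / (d : ℝ))) atTop atTop :=
  (tendsto_rpow_atTop (one_div_pos.2 (by exact_mod_cast Nat.pos_of_ne_zero (NeZero.ne d)))).comp
    tendsto_natCast_atTop_atTop

theorem tendsto_inv_smul_latticeFloor (v : Basis (Fin d) ℝ (E d)) {R : ℕ → ℝ}
    (hR : Tendsto R atTop atTop) (x : E d) :
    Tendsto (fun N => (R N)⁻¹ • (latticeFloor v (R N • x) : E d)) atTop (𝓝 x) := by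
  obtain ⟨δ, -, hδ⟩ := exists_norm_sub_latticeFloor_le v
  rw [tendsto_iff_norm_sub_tendsto_zero]
  have h1 : Tendsto (fun N => (R N)⁻¹ * δ) atTop (𝓝 0) := by
    simpa using (tendsto_inv_atTop_zero.comp hR).mul_const δ
  refine squeeze_zero' (.of_forall fun _ => norm_nonneg _) ?_ h1
  filter_upwards [hR.eventually_gt_atTop 0] with N hN
  have h2 : (R N)⁻¹ • (latticeFloor v (R N • x) : E d) - x =
      -((R N)⁻¹ • (R N • x - (latticeFloor v (R N • x) : E d))) := by
    rw [smul_sub, inv_smul_smul₀ hN.ne']; abel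
  rw [h2, norm_neg, norm_smul, Real.norm_of_nonneg (by positivity)]
  gcongr
  exact hδ _

/-- Off the frontier, `x` is interior to `D` or to its complement, and the rescaled lattice points
converge to `x`. -/
theorem eventually_latticeFloor_mem_iff [NeZero d] (v : Basis (Fin d) ℝ (E d)) {D : Set (E d)}
    (hD : IsOpen D) {x : E d} (hx : x ∉ frontier D) :
    ∀ᶠ N : ℕ in atTop,
      latticeFloor v ((N : ℝ) ^ (1 / (d : ℝ)) • x) ∈ latticePoints v D N ↔ x ∈ D := by
  have hR := tendsto_rpow_one_div_atTop (d := d)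
  have ht := tendsto_inv_smul_latticeFloor v hR x
  have h1 : ∀ᶠ N : ℕ in atTop, (((N : ℝ) ^ (1 / (d : ℝ)))⁻¹ •
      (latticeFloor v ((N : ℝ) ^ (1 / (d : ℝ)) • x) : E d) ∈ D ↔ x ∈ D) := by
    by_cases hxD : x ∈ D
    · filter_upwards [ht.eventually (hD.mem_nhds hxD)] with N hN
      exact iff_of_true hN hxD
    · have hxc : x ∈ (closure D)ᶜ := fun h => hx ⟨h, by rwa [hD.interior_eq]⟩
      filter_upwards [ht.eventually (isClosed_closure.isOpen_compl.mem_nhds hxc)] with N hN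
      exact iff_of_false (fun h => hN (subset_closure h)) hxD
  filter_upwards [h1, hR.eventually_gt_atTop 0] with N hN hpos
  rw [← hN]
  exact Set.mem_smul_set_iff_inv_smul_mem₀ hpos.ne' _ _

/-- For `N ≥ 1` the scaling factor is at least one, so rescaled cells are no larger than the
original ones. The resulting fixed ball carries the dominating functions below. -/
theorem exists_bound_of_latticeFloor_mem [NeZero d] (v : Basis (Fin d) ℝ (E d)) {D : Set (E d)}
    (hD : Bornology.IsBounded D) : ∃ M : ℝ, ∀ N : ℕ, 1 ≤ N → ∀ x : E d,
      latticeFloor v ((N : ℝ) ^ (1 / (d : ℝ)) • x) ∈ latticePoints v D N →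
        x ∈ Metric.ball (0 : E d) M := by
  obtain ⟨δ, hδ0, hδ⟩ := exists_norm_sub_latticeFloor_le v
  obtain ⟨M, hM⟩ := hD.subset_ball 0
  refine ⟨M + δ, fun N hN x hx => ?_⟩
  set R := (N : ℝ) ^ (1 / (d : ℝ))
  have hR : 1 ≤ R := Real.one_le_rpow (by exact_mod_cast hN) (by positivity)
  have hR0 : 0 < R := by linarith
  have h1 : R⁻¹ • (latticeFloor v (R • x) : E d) ∈ D :=
    (Set.mem_smul_set_iff_inv_smul_mem₀ hR0.ne' _ _).1 hx
  have h2 := hM h1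
  rw [mem_ball_zero_iff, norm_smul, Real.norm_of_nonneg (by positivity),
    inv_mul_lt_iff₀ hR0] at h2
  rw [mem_ball_zero_iff]
  have h3 : R * ‖x‖ ≤ ‖(latticeFloor v (R • x) : E d)‖ + δ := by
    rw [← Real.norm_of_nonneg hR0.le, ← norm_smul, Real.norm_of_nonneg hR0.le]
    have := norm_add_le (R • x - (latticeFloor v (R • x) : E d)) (latticeFloor v (R • x) : E d)
    rw [sub_add_cancel] at this
    linarith [hδ (R • x)]
  have h4 : R * ‖x‖ < R * (M + δ) := by
    nlinarith [mul_le_mul_of_nonneg_right hR hδ0]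
  exact lt_of_mul_lt_mul_left h4 hR0.le

theorem measurable_latticeFloor_comp (v : Basis (Fin d) ℝ (E d)) :
    Measurable[_, ⊤] (latticeFloor v) :=
  @measurable_to_countable' _ _ ⊤ _ _ _ fun w => measurableSet_latticeFloor v w

theorem tendsto_trace_div [NeZero d] (v : Basis (Fin d) ℝ (E d)) {D : Set (E d)} (hDo : IsOpen D)
    (hD : Bornology.IsBounded D) (hfr : volume (frontier D) = 0) :
    Tendsto (fun N : ℕ => (trace v D N : ℝ) / N) atTop (𝓝 ((nu v).real D)) := by
  classical
  set R : ℕ → ℝ := fun N => (N : ℝ) ^ (1 / (d : ℝ))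
  have hd0 : (d : ℝ) ≠ 0 := by exact_mod_cast NeZero.ne d
  obtain ⟨M, hM⟩ := exists_bound_of_latticeFloor_mem v hD
  set S : ℕ → Finset (dualLattice v) := fun N => (finite_latticePoints v hD N).toFinset with hS
  set G : ℕ → E d → ℝ := fun N x => if latticeFloor v x ∈ S N then (1 : ℝ) else 0
  have hGm : ∀ N, Measurable (G N) := fun N =>
    (measurable_from_top (f := fun w => if w ∈ S N then (1 : ℝ) else 0)).comp
      (measurable_latticeFloor_comp v)
  have h1 : ∀ N : ℕ, 1 ≤ N → ∫ x, G N (R N • x) ∂(nu v) = (trace v D N : ℝ) / N := by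
    intro N hN
    have hN0 : (0 : ℝ) < N := by exact_mod_cast hN
    rw [Measure.integral_comp_smul (nu v) (G N), integral_sum_latticeFloor,
      finrank_euclideanSpace_fin, trace_eq_card v hD, ← Real.rpow_natCast,
      ← Real.rpow_mul hN0.le, one_div_mul_cancel hd0, Real.rpow_one, abs_of_nonneg (by positivity),
      smul_eq_mul, div_eq_inv_mul]
  have h2 : (nu v).real D = ∫ x, D.indicator (fun _ => (1 : ℝ)) x ∂(nu v) := by
    rw [integral_indicator_const _ hDo.measurableSet, smul_eq_mul, mul_one]
  rw [h2]
  refine Tendsto.congr' (f₁ := fun N => ∫ x, G N (R N • x) ∂(nu v))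
    ((eventually_ge_atTop 1).mono h1) ?_
  refine tendsto_integral_filter_of_dominated_convergence
    ((Metric.ball (0 : E d) M).indicator fun _ => (1 : ℝ)) ?_ ?_ ?_ ?_
  · exact .of_forall fun N => ((hGm N).comp (measurable_const_smul _)).aestronglyMeasurable
  · filter_upwards [eventually_ge_atTop 1] with N hN
    refine .of_forall fun x => ?_
    simp only [G, hS, Set.Finite.mem_toFinset]
    split_ifs with h
    · rw [Set.indicator_of_mem (hM N hN x h), norm_one]
    · rw [norm_zero]
      exact Set.indicator_nonneg (fun _ _ => zero_le_one) _
  · exact (integrable_indicator_iff measurableSet_ball).2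
      (integrableOn_const measure_ball_lt_top.ne)
  · have h3 : ∀ᵐ x ∂(nu v), x ∉ frontier D := by
      rw [nu_eq]
      exact Measure.ae_smul_measure (measure_eq_zero_iff_ae_notMem.1 hfr) _
    filter_upwards [h3] with x hx
    refine tendsto_const_nhds.congr' ?_
    filter_upwards [eventually_latticeFloor_mem_iff v hDo hx] with N hN
    simp only [G, hS, Set.Finite.mem_toFinset, R, hN, Set.indicator]

/-- Passing to the cells costs at most `2δ` in distance, and distinct lattice points are at least
`ε` apart, so this cost is absorbed into a factor. It lets the singular kernel at lattice points be
dominated by the kernel at the points themselves. -/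
theorem exists_norm_sub_le_mul_norm_latticeFloor_sub (v : Basis (Fin d) ℝ (E d)) :
    ∃ C : ℝ, 0 < C ∧ ∀ x y, latticeFloor v x ≠ latticeFloor v y →
      ‖x - y‖ ≤ C * ‖(latticeFloor v x : E d) - latticeFloor v y‖ := by
  obtain ⟨δ, hδ0, hδ⟩ := exists_norm_sub_latticeFloor_le v
  obtain ⟨ε, hε, h⟩ := exists_le_norm_of_mem_dualLattice v
  refine ⟨1 + 2 * δ / ε, by positivity, fun x y hxy => ?_⟩
  have h1 : ε ≤ ‖(latticeFloor v x : E d) - latticeFloor v y‖ :=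
    h (latticeFloor v x - latticeFloor v y) (sub_ne_zero.2 hxy)
  have h2 : x - y = (x - latticeFloor v x) + ((latticeFloor v x : E d) - latticeFloor v y) -
      (y - latticeFloor v y) := by abel
  have h3 : ‖x - y‖ ≤ δ + ‖(latticeFloor v x : E d) - latticeFloor v y‖ + δ := by
    rw [h2]
    refine (norm_sub_le _ _).trans (add_le_add ((norm_add_le _ _).trans ?_) (hδ y))
    gcongr
    exact hδ x
  have h4 : 2 * δ ≤ 2 * δ / ε * ‖(latticeFloor v x : E d) - latticeFloor v y‖ := by
    calc 2 * δ = 2 * δ / ε * ε := by field_simp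
      _ ≤ _ := by gcongr
  linarith

theorem tendsto_pair_sum_div [NeZero d] (v : Basis (Fin d) ℝ (E d)) {D : Set (E d)}
    (hDo : IsOpen D) (hD : Bornology.IsBounded D) (hfr : volume (frontier D) = 0) {t : ℝ}
    (ht0 : 0 < t) (htd : t < d) :
    Tendsto (fun N : ℕ => (∑ w ∈ (finite_latticePoints v hD N).toFinset,
        ∑ w' ∈ (finite_latticePoints v hD N).toFinset, 1 / ‖(w : E d) - (w' : E d)‖ ^ t) /
        (N : ℝ) ^ (2 - t / d)) atTop (𝓝 (potential v D t)) := by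
  classical
  set R : ℕ → ℝ := fun N => (N : ℝ) ^ (1 / (d : ℝ)) with hRdef
  have hd0 : (d : ℝ) ≠ 0 := by exact_mod_cast NeZero.ne d
  obtain ⟨M, hM⟩ := exists_bound_of_latticeFloor_mem v hD
  obtain ⟨C, hC0, hC⟩ := exists_norm_sub_le_mul_norm_latticeFloor_sub v
  set S : ℕ → Finset (dualLattice v) := fun N => (finite_latticePoints v hD N).toFinset with hS
  set G : ℕ → E d × E d → ℝ := fun N p =>
    if latticeFloor v p.1 ∈ S N ∧ latticeFloor v p.2 ∈ S N then
      1 / ‖(latticeFloor v p.1 : E d) - latticeFloor v p.2‖ ^ t else 0 with hG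
  have hGm : ∀ N, Measurable (G N) := by
    intro N
    have h1 : Measurable[_, ⊤] fun p : E d × E d => (latticeFloor v p.1, latticeFloor v p.2) := by
      refine @measurable_to_countable' _ _ ⊤ _ _ _ fun w => ?_
      have := ((measurableSet_latticeFloor v w.1).prod (measurableSet_latticeFloor v w.2))
      convert this using 1
      ext p
      simp [Prod.ext_iff]
    exact (measurable_from_top (f := fun q : dualLattice v × dualLattice v =>
      if q.1 ∈ S N ∧ q.2 ∈ S N then 1 / ‖(q.1 : E d) - q.2‖ ^ t else 0)).comp h1
  have hRpos : ∀ N : ℕ, 1 ≤ N → 0 < R N := fun N hN =>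
    Real.rpow_pos_of_pos (by exact_mod_cast hN) _
  -- The factor `R^t` comes from the homogeneity of the kernel and `R^{-2d}` from the change of
  -- variables; with `R = N^{1/d}` they combine to `N^{t/d - 2}`.
  have h1 : ∀ N : ℕ, 1 ≤ N → ∫ p, R N ^ t * G N (R N • p) ∂((nu v).prod (nu v)) =
      (∑ w ∈ S N, ∑ w' ∈ S N, 1 / ‖(w : E d) - (w' : E d)‖ ^ t) / (N : ℝ) ^ (2 - t / d) := by
    intro N hN
    have hN0 : (0 : ℝ) < N := by exact_mod_cast hN
    rw [integral_const_mul, Measure.integral_comp_smul ((nu v).prod (nu v)) (G N),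
      integral_sum_latticeFloor_prod v (S N) (fun w w' => 1 / ‖(w : E d) - (w' : E d)‖ ^ t),
      finrank_prod, finrank_euclideanSpace_fin, hRdef]
    have h2 : (((N : ℝ) ^ (1 / (d : ℝ))) ^ (d + d)) = (N : ℝ) ^ (2 : ℝ) := by
      rw [← Real.rpow_natCast, ← Real.rpow_mul hN0.le]
      congr 1
      push_cast
      field_simp
      norm_num
    have h3 : ((N : ℝ) ^ (1 / (d : ℝ))) ^ t = (N : ℝ) ^ (t / d) := by
      rw [← Real.rpow_mul hN0.le]; congr 1; ring
    simp only [h2, h3]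
    rw [abs_of_nonneg (by positivity), smul_eq_mul, Real.rpow_sub hN0]
    have := (Real.rpow_pos_of_pos hN0 (t / d)).ne'
    field_simp
  have h2 : potential v D t = ∫ p, (D ×ˢ D).indicator (fun p => 1 / ‖p.1 - p.2‖ ^ t) p
      ∂((nu v).prod (nu v)) := by
    rw [integral_indicator (hDo.measurableSet.prod hDo.measurableSet), potential]
  rw [h2]
  refine Tendsto.congr' (f₁ := fun N => ∫ p, R N ^ t * G N (R N • p) ∂((nu v).prod (nu v)))
    ((eventually_ge_atTop 1).mono h1) ?_
  -- Two points of the same cell give `1 / 0 = 0`. Hence only pairs in distinct cells, where the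
  -- comparison with constant `C` holds, have to be dominated.
  have hfloor_eq : ∀ N (p : E d × E d), latticeFloor v (R N • p.1) = latticeFloor v (R N • p.2) →
      G N (R N • p) = 0 := by
    intro N p hp
    simp [hG, hp, Real.zero_rpow ht0.ne']
  refine tendsto_integral_filter_of_dominated_convergence
    (fun p => C ^ t * (Metric.ball (0 : E d) M ×ˢ Metric.ball (0 : E d) M).indicator
      (fun p => 1 / ‖p.1 - p.2‖ ^ t) p) ?_ ?_ ?_ ?_
  · exact .of_forall fun N =>
      (((hGm N).comp (measurable_const_smul _)).const_mul _).aestronglyMeasurable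
  · filter_upwards [eventually_ge_atTop 1] with N hN
    have h0 : ∀ p : E d × E d, 0 ≤ C ^ t * (Metric.ball (0 : E d) M ×ˢ
        Metric.ball (0 : E d) M).indicator (fun p => 1 / ‖p.1 - p.2‖ ^ t) p := fun p =>
      mul_nonneg (by positivity) (Set.indicator_nonneg (fun _ _ => by positivity) _)
    filter_upwards [ae_prod_fst_ne_snd (nu v)] with p hp
    by_cases hf : latticeFloor v (R N • p.1) = latticeFloor v (R N • p.2)
    · rw [hfloor_eq N p hf, mul_zero, norm_zero]
      exact h0 p
    · simp only [hG, hS, Set.Finite.mem_toFinset, Prod.smul_fst, Prod.smul_snd]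
      split_ifs with h
      · have hp0 : 0 < ‖p.1 - p.2‖ := norm_pos_iff.2 (sub_ne_zero.2 hp)
        have hq0 : 0 < ‖(latticeFloor v (R N • p.1) : E d) - latticeFloor v (R N • p.2)‖ :=
          norm_pos_iff.2 (sub_ne_zero.2 fun h' => hf (Subtype.ext h'))
        rw [Set.indicator_of_mem (Set.mk_mem_prod (hM N hN _ h.1) (hM N hN _ h.2)),
          Real.norm_of_nonneg (by have := hRpos N hN; positivity)]
        have h3 := hC _ _ hf
        rw [← smul_sub, norm_smul, Real.norm_of_nonneg (hRpos N hN).le] at h3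
        have h4 := Real.rpow_le_rpow (mul_nonneg (hRpos N hN).le hp0.le) h3 ht0.le
        rw [Real.mul_rpow (hRpos N hN).le hp0.le, Real.mul_rpow hC0.le hq0.le] at h4
        rw [mul_one_div, mul_one_div, div_le_div_iff₀ (by positivity) (by positivity)]
        exact h4
      · rw [mul_zero, norm_zero]
        exact h0 p
  · refine Integrable.const_mul ?_ _
    rw [integrable_indicator_iff (measurableSet_ball.prod measurableSet_ball)]
    exact integrableOn_nu_prod v htd Metric.isBounded_ball
  · have h3 : ∀ᵐ x ∂(nu v), x ∉ frontier D := by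
      rw [nu_eq]
      exact Measure.ae_smul_measure (measure_eq_zero_iff_ae_notMem.1 hfr) _
    filter_upwards [ae_prod_fst_ne_snd (nu v), Measure.quasiMeasurePreserving_fst.ae h3,
      Measure.quasiMeasurePreserving_snd.ae h3] with p hp hp1 hp2
    have hp0 : 0 < ‖p.1 - p.2‖ := norm_pos_iff.2 (sub_ne_zero.2 hp)
    have e1 := eventually_latticeFloor_mem_iff v hDo hp1
    have e2 := eventually_latticeFloor_mem_iff v hDo hp2
    by_cases hpD : p ∈ D ×ˢ D
    · rw [Set.indicator_of_mem hpD]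
      have hRt := tendsto_rpow_one_div_atTop (d := d)
      have h5 := ((tendsto_inv_smul_latticeFloor v hRt p.1).sub
        (tendsto_inv_smul_latticeFloor v hRt p.2)).norm
      have h6 := (tendsto_const_nhds (x := (1 : ℝ))).div (h5.rpow_const (p := t) (Or.inl hp0.ne'))
        (by positivity)
      refine h6.congr' ?_
      filter_upwards [e1, e2, eventually_ge_atTop 1] with N hN1 hN2 hN
      rw [hG]
      simp only [hS, Set.Finite.mem_toFinset, Prod.smul_fst, Prod.smul_snd]
      rw [if_pos ⟨hN1.2 hpD.1, hN2.2 hpD.2⟩]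
      change 1 / ‖(R N)⁻¹ • (latticeFloor v (R N • p.1) : E d) -
        (R N)⁻¹ • (latticeFloor v (R N • p.2) : E d)‖ ^ t = _
      rw [← smul_sub, norm_smul,
        Real.norm_of_nonneg (inv_nonneg.2 (hRpos N hN).le),
        Real.mul_rpow (inv_nonneg.2 (hRpos N hN).le) (norm_nonneg _),
        Real.inv_rpow (hRpos N hN).le, one_div, mul_inv, inv_inv, one_div]
    · rw [Set.indicator_of_notMem hpD]
      refine tendsto_const_nhds.congr' ?_
      filter_upwards [e1, e2] with N hN1 hN2
      rw [hG]
      simp only [hS, Set.Finite.mem_toFinset, Prod.smul_fst, Prod.smul_snd]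
      rw [if_neg, mul_zero]
      rintro ⟨h7, h8⟩
      exact hpD ⟨hN1.1 h7, hN2.1 h8⟩

end FlatTorus

/-! ### Reflections and polarization -/

namespace FlatTorus

open Filter Topology
open scoped Pointwise

variable {d : ℕ}

/-- The reflection in the hyperplane `⟨z, a⟩ = c`. -/
noncomputable def hyperRefl (a : E d) (c : ℝ) (z : E d) : E d :=
  z - (2 * (inner ℝ z a - c) / ‖a‖ ^ 2) • a

/-- The reflection in a hyperplane is, up to a translation, minus the reflection in its normal line;
it is thus an isometry preserving the volume. -/
theorem hyperRefl_eq (a : E d) (c : ℝ) (z : E d) :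
    hyperRefl a c z = (2 * c / ‖a‖ ^ 2) • a - (Submodule.span ℝ {a}).reflection z := by
  rw [Submodule.reflection_singleton_apply, hyperRefl, real_inner_comm, two_smul]
  simp only [RCLike.ofReal_real_eq_id, id]
  rw [mul_sub, sub_div, sub_smul, mul_div_assoc, two_mul, add_smul]
  abel

theorem measurePreserving_hyperRefl (a : E d) (c : ℝ) :
    MeasurePreserving (hyperRefl a c) volume volume := by
  have h := (Measure.measurePreserving_sub_left (volume : Measure (E d)) ((2 * c / ‖a‖ ^ 2) • a)).comp
    ((Submodule.span ℝ {a}).reflection).measurePreserving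
  rwa [show hyperRefl a c = _ from funext (hyperRefl_eq a c)]

theorem norm_hyperRefl_sub (a : E d) (c : ℝ) (x y : E d) :
    ‖hyperRefl a c x - hyperRefl a c y‖ = ‖x - y‖ := by
  rw [hyperRefl_eq, hyperRefl_eq, sub_sub_sub_cancel_left, ← map_sub, LinearIsometryEquiv.norm_map,
    norm_sub_rev]

theorem inner_hyperRefl {a : E d} (ha : a ≠ 0) (c : ℝ) (z : E d) :
    inner ℝ (hyperRefl a c z) a = 2 * c - inner ℝ z a := by
  have : ‖a‖ ≠ 0 := norm_ne_zero_iff.2 ha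
  rw [hyperRefl, inner_sub_left, real_inner_smul_left, real_inner_self_eq_norm_sq]
  field_simp
  ring

theorem hyperRefl_hyperRefl {a : E d} (ha : a ≠ 0) (c : ℝ) (z : E d) :
    hyperRefl a c (hyperRefl a c z) = z := by
  nth_rw 1 [hyperRefl]
  rw [inner_hyperRefl ha, hyperRefl, sub_sub, ← add_smul, ← add_div]
  ring_nf
  simp

theorem hyperRefl_of_inner_eq {a : E d} {c : ℝ} {z : E d} (h : inner ℝ z a = c) :
    hyperRefl a c z = z := by
  simp [hyperRefl, h]

theorem norm_sub_hyperRefl_sq {a : E d} (ha : a ≠ 0) (c : ℝ) (x y : E d) :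
    ‖x - hyperRefl a c y‖ ^ 2 =
      ‖x - y‖ ^ 2 + 4 * (inner ℝ y a - c) * (inner ℝ x a - c) / ‖a‖ ^ 2 := by
  have h0 : ‖a‖ ≠ 0 := norm_ne_zero_iff.2 ha
  have h1 : x - hyperRefl a c y = (x - y) + (2 * (inner ℝ y a - c) / ‖a‖ ^ 2) • a := by
    rw [hyperRefl]; abel
  rw [h1, norm_add_sq_real, real_inner_smul_right, norm_smul, mul_pow, Real.norm_eq_abs, sq_abs,
    inner_sub_left]
  field_simp
  ring

/-- Two points on the same side are no farther apart than after one of them is reflected. With the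
origin on that side (`c ≥ 0`), reflected points are also no closer to the origin. -/
theorem norm_sub_le_norm_sub_hyperRefl {a : E d} (ha : a ≠ 0) {c : ℝ} {x y : E d}
    (hx : inner ℝ x a ≤ c) (hy : inner ℝ y a ≤ c) : ‖x - y‖ ≤ ‖x - hyperRefl a c y‖ := by
  refine (sq_le_sq₀ (norm_nonneg _) (norm_nonneg _)).1 ?_
  rw [norm_sub_hyperRefl_sq ha]
  have : 0 ≤ 4 * (inner ℝ y a - c) * (inner ℝ x a - c) / ‖a‖ ^ 2 := by
    apply div_nonneg _ (by positivity)
    nlinarith [mul_nonneg (sub_nonneg.2 hx) (sub_nonneg.2 hy)]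
  linarith

theorem norm_le_norm_hyperRefl {a : E d} (ha : a ≠ 0) {c : ℝ} (hc : 0 ≤ c) {z : E d}
    (hz : inner ℝ z a ≤ c) : ‖z‖ ≤ ‖hyperRefl a c z‖ := by
  have := norm_sub_le_norm_sub_hyperRefl ha (x := 0) (by simpa using hc) hz
  simpa using this

/-- The polarization (two-point rearrangement) of `A` towards the half-space `⟨z, a⟩ ≤ c`. -/
def polarization (a : E d) (c : ℝ) (A : Set (E d)) : Set (E d) :=
  {z | (z ∈ A ∧ hyperRefl a c z ∈ A) ∨ (inner ℝ z a ≤ c ∧ (z ∈ A ∨ hyperRefl a c z ∈ A))}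

theorem measurableSet_polarization (a : E d) (c : ℝ) {A : Set (E d)} (hA : MeasurableSet A) :
    MeasurableSet (polarization a c A) := by
  have h1 : MeasurableSet {z | hyperRefl a c z ∈ A} :=
    (measurePreserving_hyperRefl a c).measurable hA
  have h2 : MeasurableSet {z : E d | inner ℝ z a ≤ c} :=
    measurableSet_le (by fun_prop) measurable_const
  exact (hA.inter h1).union (h2.inter (hA.union h1))

theorem mem_polarization_of_le {a : E d} {c : ℝ} {z : E d} (A : Set (E d))
    (hz : inner ℝ z a ≤ c) :
    z ∈ polarization a c A ↔ z ∈ A ∨ hyperRefl a c z ∈ A := by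
  simp only [polarization, Set.mem_ofPred_eq]
  tauto

theorem hyperRefl_mem_polarization_of_le {a : E d} (ha : a ≠ 0) {c : ℝ} {z : E d} (A : Set (E d))
    (hz : inner ℝ z a ≤ c) :
    hyperRefl a c z ∈ polarization a c A ↔ z ∈ A ∧ hyperRefl a c z ∈ A := by
  simp only [polarization, Set.mem_ofPred_eq, hyperRefl_hyperRefl ha, inner_hyperRefl ha]
  rcases hz.lt_or_eq with h | h
  · have : ¬ (2 * c - inner ℝ z a ≤ c) := by linarith
    tauto
  · rw [hyperRefl_of_inner_eq h]
    tauto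

theorem polarization_subset_ball {a : E d} (ha : a ≠ 0) {c : ℝ} (hc : 0 ≤ c) {A : Set (E d)}
    {R : ℝ} (hA : A ⊆ Metric.ball 0 R) : polarization a c A ⊆ Metric.ball 0 R := by
  rintro z (⟨hz, -⟩ | ⟨h, hz | hz⟩)
  · exact hA hz
  · exact hA hz
  · have := hA hz
    rw [mem_ball_zero_iff] at *
    exact (norm_le_norm_hyperRefl ha hc h).trans_lt this

/-- An integral inequality follows from its symmetrization under a reflection. -/
theorem two_mul_lintegral_eq (a : E d) (c : ℝ) {f : E d → ENNReal} (hf : Measurable f) :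
    2 * ∫⁻ z, f z = ∫⁻ z, (f z + f (hyperRefl a c z)) := by
  rw [lintegral_add_left hf, (measurePreserving_hyperRefl a c).lintegral_comp hf, two_mul]

-- Polarization only redistributes membership within each pair `{z, σ z}`, keeping the number of
-- members. So the integrands agree after symmetrization under the reflection.
open Set in
theorem volume_polarization {a : E d} (ha : a ≠ 0) (c : ℝ) {A : Set (E d)}
    (hA : MeasurableSet A) : volume (polarization a c A) = volume A := by
  have hm := measurableSet_polarization a c hA
  have key : ∀ z, inner ℝ z a ≤ c →
      (polarization a c A).indicator (1 : E d → ENNReal) z +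
        (polarization a c A).indicator (1 : E d → ENNReal) (hyperRefl a c z) =
      A.indicator 1 z + A.indicator 1 (hyperRefl a c z) := by
    intro z hz
    have h1 := mem_polarization_of_le A hz
    have h2 := hyperRefl_mem_polarization_of_le ha A hz
    by_cases p : z ∈ A <;> by_cases q : hyperRefl a c z ∈ A <;>
      simp [indicator, h1, h2, p, q]
  have h : 2 * volume (polarization a c A) = 2 * volume A := by
    rw [← lintegral_indicator_one hm, ← lintegral_indicator_one hA,
      two_mul_lintegral_eq a c (measurable_one.indicator hm),
      two_mul_lintegral_eq a c (measurable_one.indicator hA)]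
    refine lintegral_congr fun z => ?_
    rcases le_total (inner ℝ z a) c with hz | hz
    · exact key z hz
    · have h3 := key (hyperRefl a c z) (by rw [inner_hyperRefl ha]; linarith)
      rw [hyperRefl_hyperRefl ha] at h3
      rw [add_comm, h3, add_comm]
  exact (ENNReal.mul_right_inj (by simp) (by simp)).1 h

-- The second volume on the left is the gain: it measures the free places of the ball whose mirror
-- image is a point of `A` outside the ball. As the origin lies on the favoured side, polarization
-- moves those points in, and moves none out.
open Set in
theorem volume_polarization_inter_ball {a : E d} (ha : a ≠ 0) {c : ℝ} (hc : 0 ≤ c)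
    {A : Set (E d)} (hA : MeasurableSet A) (r : ℝ) :
    volume (A ∩ Metric.ball 0 r) +
      volume {z | z ∈ Metric.ball 0 r \ A ∧ hyperRefl a c z ∈ A \ Metric.ball 0 r} ≤
      volume (polarization a c A ∩ Metric.ball 0 r) := by
  set B : Set (E d) := Metric.ball 0 r
  set W : Set (E d) := {z | z ∈ B \ A ∧ hyperRefl a c z ∈ A \ B}
  have hB : MeasurableSet B := measurableSet_ball
  have hW : MeasurableSet W :=
    (hB.diff hA).inter ((measurePreserving_hyperRefl a c).measurable (hA.diff hB))
  have hP := (measurableSet_polarization a c hA).inter hB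
  have key : ∀ z, inner ℝ z a ≤ c →
      ((A ∩ B).indicator (1 : E d → ENNReal) z + W.indicator 1 z) +
        ((A ∩ B).indicator 1 (hyperRefl a c z) + W.indicator 1 (hyperRefl a c z)) ≤
      (polarization a c A ∩ B).indicator 1 z +
        (polarization a c A ∩ B).indicator 1 (hyperRefl a c z) := by
    intro z hz
    have h1 := mem_polarization_of_le A hz
    have h2 := hyperRefl_mem_polarization_of_le ha A hz
    have h3 : hyperRefl a c z ∈ B → z ∈ B := by
      intro h
      rw [mem_ball_zero_iff] at *
      exact (norm_le_norm_hyperRefl ha hc hz).trans_lt h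
    by_cases p : z ∈ A <;> by_cases q : hyperRefl a c z ∈ A <;>
      by_cases p' : z ∈ B <;> by_cases q' : hyperRefl a c z ∈ B <;>
      simp_all [indicator, W, hyperRefl_hyperRefl ha]
  have h : 2 * (volume (A ∩ B) + volume W) ≤ 2 * volume (polarization a c A ∩ B) := by
    have hm := (measurable_one.indicator (hA.inter hB)).add (measurable_one.indicator hW)
      (M := ENNReal)
    rw [← lintegral_indicator_one (hA.inter hB), ← lintegral_indicator_one hW,
      ← lintegral_indicator_one hP,
      ← lintegral_add_left (measurable_one.indicator (hA.inter hB)),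
      two_mul_lintegral_eq a c (measurable_one.indicator hP),
      two_mul_lintegral_eq a c
        (f := fun z => (A ∩ B).indicator (1 : E d → ENNReal) z + W.indicator 1 z) hm]
    refine lintegral_mono fun z => ?_
    rcases le_total (inner ℝ z a) c with hz | hz
    · exact key z hz
    · have h3 := key (hyperRefl a c z) (by rw [inner_hyperRefl ha]; linarith)
      rw [hyperRefl_hyperRefl ha] at h3
      exact (add_comm _ _).trans_le (h3.trans_eq (add_comm _ _))
  exact (ENNReal.mul_le_mul_iff_right (by simp) (by simp)).1 h

/-- The interaction energy of `A` with the radial kernel `φ`. -/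
noncomputable def interaction (φ : ℝ → ENNReal) (A : Set (E d)) : ENNReal :=
  ∫⁻ p : E d × E d, A.indicator 1 p.1 * A.indicator 1 p.2 * φ ‖p.1 - p.2‖

-- Symmetrizing in both variables reduces the claim to `x` and `y` on the favoured side. The four
-- distances then take two values, `‖x - y‖` and the larger `‖x - σ y‖`. The sum changes only if
-- exactly one of `x, σ x` and exactly one of `y, σ y` belong to `A`, on opposite sides, and then
-- the larger distance is replaced by the smaller.
open Set in
theorem interaction_le_polarization {a : E d} (ha : a ≠ 0) (c : ℝ) {A : Set (E d)}
    (hA : MeasurableSet A) {φ : ℝ → ENNReal} (hφ : Antitone φ) :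
    interaction φ A ≤ interaction φ (polarization a c A) := by
  set σ := hyperRefl a c
  have hσ : MeasurePreserving σ volume volume := measurePreserving_hyperRefl a c
  have hσσ : ∀ z, σ (σ z) = z := hyperRefl_hyperRefl ha c
  set T : Set (E d) → E d × E d → ENNReal := fun A p =>
    A.indicator 1 p.1 * A.indicator 1 p.2 * φ ‖p.1 - p.2‖ with hT
  have hTm : ∀ A, MeasurableSet A → Measurable (T A) := by
    intro A hA
    have h1 : Measurable (A.indicator (1 : E d → ENNReal)) := measurable_one.indicator hA
    exact ((h1.comp measurable_fst).mul (h1.comp measurable_snd)).mul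
      (hφ.measurable.comp (by fun_prop))
  set Q : Set (E d) → E d × E d → ENNReal := fun A p =>
    T A p + T A (σ p.1, p.2) + T A (p.1, σ p.2) + T A (σ p.1, σ p.2) with hQ
  have h4 : ∀ A, MeasurableSet A → ∫⁻ p, Q A p = 4 * interaction φ A := by
    intro A hA
    have hid := MeasurePreserving.id (volume : Measure (E d))
    have e1 : ∫⁻ p : E d × E d, T A (σ p.1, p.2) = ∫⁻ p, T A p :=
      (hσ.prod hid).lintegral_comp (hTm A hA)
    have e2 : ∫⁻ p : E d × E d, T A (p.1, σ p.2) = ∫⁻ p, T A p :=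
      (hid.prod hσ).lintegral_comp (hTm A hA)
    have e3 : ∫⁻ p : E d × E d, T A (σ p.1, σ p.2) = ∫⁻ p, T A p :=
      (hσ.prod hσ).lintegral_comp (hTm A hA)
    have m1 : Measurable fun p : E d × E d => T A (σ p.1, p.2) :=
      (hTm A hA).comp ((hσ.measurable.comp measurable_fst).prodMk measurable_snd)
    have m2 : Measurable fun p : E d × E d => T A (p.1, σ p.2) :=
      (hTm A hA).comp (measurable_fst.prodMk (hσ.measurable.comp measurable_snd))
    have a1 := lintegral_add_left (μ := volume) (hTm A hA) fun p => T A (σ p.1, p.2)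
    have a2 := lintegral_add_left (μ := volume) (f := fun p => T A p + T A (σ p.1, p.2))
      ((hTm A hA).add m1) fun p => T A (p.1, σ p.2)
    have a3 := lintegral_add_left (μ := volume)
      (f := fun p => T A p + T A (σ p.1, p.2) + T A (p.1, σ p.2))
      (((hTm A hA).add m1).add m2) fun p => T A (σ p.1, σ p.2)
    change ∫⁻ p, T A p + T A (σ p.1, p.2) + T A (p.1, σ p.2) + T A (σ p.1, σ p.2) =
      4 * ∫⁻ p, T A p
    rw [a3, a2, a1, e1, e2, e3]
    ring
  have key : ∀ p : E d × E d, inner ℝ p.1 a ≤ c → inner ℝ p.2 a ≤ c →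
      Q A p ≤ Q (polarization a c A) p := by
    rintro ⟨x, y⟩ hx hy
    have hu : ‖σ x - σ y‖ = ‖x - y‖ := norm_hyperRefl_sub a c x y
    have hw : ‖σ x - y‖ = ‖x - σ y‖ := by
      have := norm_hyperRefl_sub a c (σ x) y
      rw [show hyperRefl a c (σ x) = x from hσσ x] at this
      exact this.symm
    have hwu : φ ‖x - σ y‖ ≤ φ ‖x - y‖ := hφ (norm_sub_le_norm_sub_hyperRefl ha hx hy)
    have hx1 : x ∈ polarization a c A ↔ x ∈ A ∨ σ x ∈ A := mem_polarization_of_le A hx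
    have hx2 : σ x ∈ polarization a c A ↔ x ∈ A ∧ σ x ∈ A :=
      hyperRefl_mem_polarization_of_le ha A hx
    have hy1 : y ∈ polarization a c A ↔ y ∈ A ∨ σ y ∈ A := mem_polarization_of_le A hy
    have hy2 : σ y ∈ polarization a c A ↔ y ∈ A ∧ σ y ∈ A :=
      hyperRefl_mem_polarization_of_le ha A hy
    simp only [hQ, hT, hu, hw]
    by_cases p : x ∈ A <;> by_cases q : σ x ∈ A <;>
      by_cases p' : y ∈ A <;> by_cases q' : σ y ∈ A <;>
      simp only [indicator, hx1, hx2, hy1, hy2, p, q, p', q', or_self, or_true, and_self,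
        and_true, and_false, if_true, if_false, Pi.one_apply, mul_one, mul_zero,
        zero_mul, one_mul, add_zero, zero_add, le_refl, hwu, or_false]
    all_goals exact (add_comm _ _).le
  have hsym1 : ∀ A p, Q A (σ p.1, p.2) = Q A p := by
    intro A p
    simp only [hQ, hσσ]
    ring
  have hsym2 : ∀ A p, Q A (p.1, σ p.2) = Q A p := by
    intro A p
    simp only [hQ, hσσ]
    ring
  have hside : ∀ z, c ≤ inner ℝ z a → inner ℝ (σ z) a ≤ c := fun z hz => by
    rw [inner_hyperRefl ha]; linarith
  have h5 : 4 * interaction φ A ≤ 4 * interaction φ (polarization a c A) := by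
    rw [← h4 A hA, ← h4 _ (measurableSet_polarization a c hA)]
    refine lintegral_mono fun p => ?_
    rcases le_total (inner ℝ p.1 a) c with h1 | h1 <;>
      rcases le_total (inner ℝ p.2 a) c with h2 | h2
    · exact key p h1 h2
    · have := key (p.1, σ p.2) h1 (hside _ h2)
      rwa [hsym2, hsym2] at this
    · have := key (σ p.1, p.2) (hside _ h1) h2
      rwa [hsym1, hsym1] at this
    · have := key (σ p.1, σ p.2) (hside _ h1) (hside _ h2)
      have e : ∀ A, Q A (σ p.1, σ p.2) = Q A p := fun A =>
        (hsym1 A (p.1, σ p.2)).trans (hsym2 A p)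
      rwa [e, e] at this
  exact (ENNReal.mul_le_mul_iff_right (by simp) (by simp)).1 h5

end FlatTorus

/-! ### The gain of an averaged reflection -/

namespace FlatTorus

open Filter Topology
open scoped Pointwise

variable {d : ℕ}

theorem lintegral_comp_add_smul {F : Type*} [NormedAddCommGroup F] [NormedSpace ℝ F]
    [MeasurableSpace F] [BorelSpace F] [FiniteDimensional ℝ F] (μ : Measure F) [μ.IsAddHaarMeasure]
    (b : F) {r : ℝ} (hr : 0 < r) (f : F → ENNReal) :
    ∫⁻ x, f (b + r • x) ∂μ = ENNReal.ofReal (r ^ finrank ℝ F)⁻¹ * ∫⁻ x, f x ∂μ := by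
  have h := (Homeomorph.smulOfNeZero r hr.ne').measurableEmbedding.lintegral_map (μ := μ)
    (fun x => f (b + x))
  change ∫⁻ x, f (b + x) ∂(Measure.map (r • ·) μ) = ∫⁻ x, f (b + r • x) ∂μ at h
  rw [← h, Measure.map_addHaar_smul μ hr.ne', lintegral_smul_measure,
    lintegral_add_left_eq_self f b, abs_of_pos (by positivity), smul_eq_mul]

-- With `c = ⟨z,a⟩ + τ‖a‖²/2` the reflection sends `z` to `x = z + τ a`, and `‖x‖² = ‖z‖² + 2τc`.
-- Thus `‖z‖ < ‖x‖ < R` and `τ > 1` confine `c` to `(0, R²)`.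
open Set in
theorem lintegral_Ioo_le_lintegral_hyperRefl {R : ℝ} {V : Set (E d)}
    (hVR : V ⊆ Metric.ball 0 R) {z : E d} (hzV : ∀ x ∈ V, ‖z‖ < ‖x‖)
    {a : E d} (ha : a ≠ 0) :
    ENNReal.ofReal (‖a‖ ^ 2 / 2) * ∫⁻ τ in Ioo (1 : ℝ) 2, V.indicator 1 (z + τ • a) ≤
      ∫⁻ c in Ioo 0 (R ^ 2), V.indicator 1 (hyperRefl a c z) := by
  have hk : 0 < ‖a‖ ^ 2 / 2 := by have := norm_pos_iff.2 ha; positivity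
  rw [← lintegral_indicator measurableSet_Ioo, ← lintegral_indicator measurableSet_Ioo]
  set h : ℝ → ENNReal := (Ioo 0 (R ^ 2)).indicator fun c => V.indicator 1 (hyperRefl a c z)
  have h1 := lintegral_comp_add_smul volume (inner ℝ z a) hk h
  rw [finrank_self, pow_one] at h1
  have h2 : ∫⁻ c, h c = ENNReal.ofReal (‖a‖ ^ 2 / 2) *
      ∫⁻ τ, h (inner ℝ z a + (‖a‖ ^ 2 / 2) • τ) := by
    rw [h1, ← mul_assoc, ← ENNReal.ofReal_mul hk.le, mul_inv_cancel₀ hk.ne', ENNReal.ofReal_one,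
      one_mul]
  rw [h2]
  refine mul_le_mul_right (lintegral_mono fun τ => ?_) _
  by_cases hτ : τ ∈ Ioo (1 : ℝ) 2
  swap
  · rw [indicator_of_notMem hτ]; exact zero_le
  rw [indicator_of_mem hτ]
  by_cases hx : z + τ • a ∈ V
  swap
  · rw [indicator_of_notMem hx]; exact zero_le
  have hne : ‖a‖ ≠ 0 := norm_ne_zero_iff.2 ha
  have e1 : hyperRefl a (inner ℝ z a + (‖a‖ ^ 2 / 2) • τ) z = z + τ • a := by
    rw [hyperRefl, sub_eq_add_neg, ← neg_smul]
    congr 2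
    rw [smul_eq_mul]
    field_simp
    ring
  have e2 : ‖z + τ • a‖ ^ 2 = ‖z‖ ^ 2 + 2 * τ * (inner ℝ z a + (‖a‖ ^ 2 / 2) • τ) := by
    rw [norm_add_sq_real, real_inner_smul_right, norm_smul, mul_pow, Real.norm_eq_abs, sq_abs,
      smul_eq_mul]
    ring
  set c := inner ℝ z a + (‖a‖ ^ 2 / 2) • τ
  have h3 := hzV _ hx
  have h4 := mem_ball_zero_iff.1 (hVR hx)
  have hc0 : 0 < c := by
    have : 0 < 2 * τ * c := by nlinarith [norm_nonneg z]
    exact pos_of_mul_pos_right this (by linarith [hτ.1])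
  have hc1 : c < R ^ 2 := by
    nlinarith [norm_nonneg (z + τ • a), norm_nonneg z, hτ.1]
  have hc : c ∈ Ioo 0 (R ^ 2) := ⟨hc0, hc1⟩
  change _ ≤ (Ioo 0 (R ^ 2)).indicator (fun c => V.indicator 1 (hyperRefl a c z)) c
  rw [indicator_of_mem hc, e1]

-- Averaging over the normals `a` as well, the image `x = z + τ a` sweeps out all of `V`; since `τ >
-- 1`, only normals of length less than `2R` are needed.
open Set in
theorem lintegral_sq_le_lintegral_hyperRefl {R : ℝ} {V : Set (E d)} (hV : MeasurableSet V)
    (hVR : V ⊆ Metric.ball 0 R) {z : E d} (hz : z ∈ Metric.ball 0 R)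
    (hzV : ∀ x ∈ V, ‖z‖ < ‖x‖) :
    ENNReal.ofReal (1 / 2 ^ (d + 3)) * ∫⁻ x in V, ENNReal.ofReal (‖x - z‖ ^ 2) ≤
      ∫⁻ a in Metric.ball 0 (2 * R), ∫⁻ c in Ioo 0 (R ^ 2), V.indicator 1 (hyperRefl a c z) := by
  have hV1 : Measurable (V.indicator (1 : E d → ENNReal)) := measurable_one.indicator hV
  calc ENNReal.ofReal (1 / 2 ^ (d + 3)) * ∫⁻ x in V, ENNReal.ofReal (‖x - z‖ ^ 2)
      = ∫⁻ τ in Ioo (1 : ℝ) 2, ENNReal.ofReal (1 / 2 ^ (d + 3)) *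
          ∫⁻ x in V, ENNReal.ofReal (‖x - z‖ ^ 2) := by
        rw [setLIntegral_const, Real.volume_Ioo]
        norm_num
    _ ≤ ∫⁻ τ in Ioo (1 : ℝ) 2, ∫⁻ a : E d,
          ENNReal.ofReal (‖a‖ ^ 2 / 2) * V.indicator 1 (z + τ • a) := by
        refine setLIntegral_mono' measurableSet_Ioo fun τ hτ => ?_
        have hτ0 : 0 < τ := by linarith [hτ.1]
        have h1 := lintegral_comp_add_smul (volume : Measure (E d)) z hτ0
          (fun x => ENNReal.ofReal (‖x - z‖ ^ 2 / (2 * τ ^ 2)) * V.indicator 1 x)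
        have h2 : ∀ a : E d, ENNReal.ofReal (‖a‖ ^ 2 / 2) * V.indicator 1 (z + τ • a) =
            ENNReal.ofReal (‖z + τ • a - z‖ ^ 2 / (2 * τ ^ 2)) * V.indicator 1 (z + τ • a) := by
          intro a
          congr 2
          rw [add_sub_cancel_left, norm_smul, mul_pow, Real.norm_eq_abs, sq_abs]
          field_simp
        simp_rw [h2]
        rw [h1, ← lintegral_indicator hV, ← lintegral_const_mul _ (by fun_prop),
          ← lintegral_const_mul _ (by fun_prop)]
        refine lintegral_mono fun x => ?_
        by_cases hx : x ∈ V
        swap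
        · simp [hx]
        simp only [indicator_of_mem hx, Pi.one_apply, mul_one]
        rw [← ENNReal.ofReal_mul (by positivity), ← ENNReal.ofReal_mul (by positivity)]
        apply ENNReal.ofReal_le_ofReal
        rw [finrank_euclideanSpace_fin]
        -- The Jacobian contributes `τ^d` and `‖a‖² / 2 = ‖x - z‖² / (2τ²)` the rest, with `τ < 2`.
        have h3 : τ ^ d * (2 * τ ^ 2) ≤ 2 ^ (d + 3) := by
          have a1 : τ ^ d ≤ 2 ^ d := pow_le_pow_left₀ hτ0.le hτ.2.le d
          have a2 : 2 * τ ^ 2 ≤ 2 ^ 3 := by nlinarith [hτ.2]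
          rw [pow_add]
          exact mul_le_mul a1 a2 (by positivity) (by positivity)
        have h4 : (τ ^ d)⁻¹ * (‖x - z‖ ^ 2 / (2 * τ ^ 2)) =
            1 / (τ ^ d * (2 * τ ^ 2)) * ‖x - z‖ ^ 2 := by
          field_simp
        rw [h4]
        gcongr
    _ = ∫⁻ a : E d, ENNReal.ofReal (‖a‖ ^ 2 / 2) *
          ∫⁻ τ in Ioo (1 : ℝ) 2, V.indicator 1 (z + τ • a) := by
        rw [lintegral_lintegral_swap]
        · refine lintegral_congr fun a => ?_
          rw [lintegral_const_mul]
          exact hV1.comp (by fun_prop)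
        · refine Measurable.aemeasurable ?_
          refine Measurable.mul (by fun_prop) (hV1.comp ?_)
          fun_prop
    _ ≤ _ := by
        rw [← lintegral_indicator measurableSet_ball]
        refine lintegral_mono fun a => ?_
        rcases eq_or_ne a 0 with rfl | ha
        · simp
        by_cases hb : a ∈ Metric.ball 0 (2 * R)
        · rw [indicator_of_mem hb]
          exact lintegral_Ioo_le_lintegral_hyperRefl hVR hzV ha
        · rw [indicator_of_notMem hb]
          refine le_of_eq ?_
          rw [setLIntegral_congr_fun (g := 0) measurableSet_Ioo]
          · simp
          · intro τ hτ
            refine indicator_of_notMem (fun hx => hb ?_) _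
            have h1 := mem_ball_zero_iff.1 (hVR hx)
            have h2 := mem_ball_zero_iff.1 hz
            rw [mem_ball_zero_iff]
            have h3 : ‖τ • a‖ ≤ ‖z + τ • a‖ + ‖z‖ := by
              simpa using norm_sub_le (z + τ • a) z
            rw [norm_smul, Real.norm_eq_abs, abs_of_pos (by linarith [hτ.1])] at h3
            nlinarith [norm_nonneg a, hτ.1]

theorem exists_volume_ball_le [NeZero d] {δ : ENNReal} (hδ : δ ≠ 0) :
    ∃ η : ℝ, 0 < η ∧ ∀ z : E d, volume (Metric.ball z η) ≤ δ := by
  obtain ⟨n, hn0, hn⟩ := ENNReal.exists_nnreal_pos_mul_lt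
    (measure_ball_lt_top (μ := (volume : Measure (E d))) (x := 0) (r := 1)).ne hδ
  have hη : 0 < min (n : ℝ) 1 := lt_min (by exact_mod_cast hn0) one_pos
  refine ⟨min (n : ℝ) 1, hη, fun z => ?_⟩
  rw [Measure.addHaar_ball_of_pos _ _ hη, finrank_euclideanSpace_fin]
  refine le_trans ?_ hn.le
  gcongr
  rw [← ENNReal.ofReal_coe_nnreal]
  apply ENNReal.ofReal_le_ofReal
  exact (pow_le_of_le_one hη.le (min_le_right _ _) (NeZero.ne d)).trans (min_le_left _ _)

/-- Uniformly over pairs of sets of measure at least `δ`, the first one closer to the origin,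
some reflection maps a substantial part of the first set into the second one. -/
theorem exists_reflection_gain [NeZero d] (R : ℝ) {δ : ENNReal} (hδ : δ ≠ 0) (hδ' : δ ≠ ⊤) :
    ∃ g : ENNReal, 0 < g ∧ ∀ U V : Set (E d), MeasurableSet U → MeasurableSet V →
      U ⊆ Metric.ball 0 R → V ⊆ Metric.ball 0 R → (∀ z ∈ U, ∀ x ∈ V, ‖z‖ < ‖x‖) →
      δ ≤ volume U → δ ≤ volume V →
      ∃ a : E d, a ≠ 0 ∧ ∃ c : ℝ, 0 < c ∧ g ≤ volume {z | z ∈ U ∧ hyperRefl a c z ∈ V} := by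
  -- A ball of radius `η` has volume at most `δ/2`, so at least `δ/2` of `V` is at distance `η` or
  -- more from any given `z`; this yields the lower bound `m` for every `z`.
  obtain ⟨η, hη, hball⟩ := exists_volume_ball_le (d := d) (ENNReal.half_pos hδ).ne'
  set m : ENNReal := ENNReal.ofReal (1 / 2 ^ (d + 3)) * (ENNReal.ofReal (η ^ 2) * (δ / 2)) with hm
  have hm0 : m * δ ≠ 0 := by
    refine mul_ne_zero (mul_ne_zero ?_ (mul_ne_zero ?_ (ENNReal.half_pos hδ).ne')) hδ
    · exact (ENNReal.ofReal_pos.2 (by positivity)).ne'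
    · exact (ENNReal.ofReal_pos.2 (by positivity)).ne'
  set M : ENNReal := volume (Set.Ioo 0 (R ^ 2)) * volume (Metric.ball (0 : E d) (2 * R)) with hM
  have hMt : M ≠ ⊤ := ENNReal.mul_ne_top (by simp) measure_ball_lt_top.ne
  -- If every reflection gained less than `g`, integrating over the parameters `(a,c)`, a set of
  -- measure `M`, would give at most `g * M`, below the lower bound `m * δ`.
  obtain ⟨g, hg0, hg⟩ := ENNReal.exists_nnreal_pos_mul_lt hMt hm0
  refine ⟨g, by exact_mod_cast hg0, fun U V hU hV hUR hVR hUV hδU hδV => ?_⟩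
  by_contra! hcon
  have hV1 : Measurable (V.indicator (1 : E d → ENNReal)) := measurable_one.indicator hV
  have hU1 : Measurable (U.indicator (1 : E d → ENNReal)) := measurable_one.indicator hU
  have hmz : ∀ z ∈ U, m ≤ ∫⁻ a in Metric.ball 0 (2 * R), ∫⁻ c in Set.Ioo 0 (R ^ 2),
      V.indicator 1 (hyperRefl a c z) := by
    intro z hz
    refine le_trans ?_ (lintegral_sq_le_lintegral_hyperRefl hV hVR (hUR hz) (hUV z hz))
    rw [hm]
    refine mul_le_mul_right ?_ _
    have h1 : δ / 2 ≤ volume (V \ Metric.ball z η) := by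
      have h2 : δ ≤ volume (V \ Metric.ball z η) + δ / 2 :=
        hδV.trans ((measure_le_inter_add_sdiff volume V (Metric.ball z η)).trans (by
          rw [add_comm]
          gcongr
          exact (measure_mono Set.inter_subset_right).trans (hball z)))
      rw [← ENNReal.sub_half hδ']
      exact tsub_le_iff_right.2 h2
    calc ENNReal.ofReal (η ^ 2) * (δ / 2)
        ≤ ENNReal.ofReal (η ^ 2) * volume (V \ Metric.ball z η) := by gcongr
      _ = ∫⁻ x in V \ Metric.ball z η, ENNReal.ofReal (η ^ 2) := (setLIntegral_const _ _).symm
      _ ≤ ∫⁻ x in V \ Metric.ball z η, ENNReal.ofReal (‖x - z‖ ^ 2) := by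
          refine setLIntegral_mono' (hV.diff measurableSet_ball) fun x hx => ?_
          have : η ≤ ‖x - z‖ := by simpa [dist_eq_norm] using hx.2
          gcongr
      _ ≤ _ := lintegral_mono_set Set.sdiff_subset
  have hjoint : Measurable fun q : E d × E d × ℝ =>
      U.indicator (1 : E d → ENNReal) q.1 *
        V.indicator (1 : E d → ENNReal) (hyperRefl q.2.1 q.2.2 q.1) := by
    refine (hU1.comp measurable_fst).mul (hV1.comp ?_)
    unfold hyperRefl
    fun_prop
  have hlow : m * δ ≤ ∫⁻ z, ∫⁻ a in Metric.ball 0 (2 * R), ∫⁻ c in Set.Ioo 0 (R ^ 2),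
      U.indicator 1 z * V.indicator 1 (hyperRefl a c z) := by
    calc m * δ ≤ m * volume U := by gcongr
      _ = ∫⁻ z in U, m := (setLIntegral_const _ _).symm
      _ = ∫⁻ z, U.indicator (fun _ => m) z := (lintegral_indicator hU _).symm
      _ ≤ _ := by
        refine lintegral_mono fun z => ?_
        by_cases hz : z ∈ U
        · simpa [hz] using hmz z hz
        · simp [hz]
  have hupp : ∫⁻ z, ∫⁻ a in Metric.ball 0 (2 * R), ∫⁻ c in Set.Ioo 0 (R ^ 2),
      U.indicator 1 z * V.indicator 1 (hyperRefl a c z) ≤ g * M := by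
    rw [lintegral_lintegral_swap]
    swap
    · refine Measurable.aemeasurable ?_
      exact Measurable.lintegral_prod_right' (ν := volume.restrict (Set.Ioo 0 (R ^ 2)))
        (f := fun q : (E d × E d) × ℝ => U.indicator (1 : E d → ENNReal) q.1.1 *
          V.indicator (1 : E d → ENNReal) (hyperRefl q.1.2 q.2 q.1.1))
        (hjoint.comp (by fun_prop : Measurable fun q : (E d × E d) × ℝ => (q.1.1, q.1.2, q.2)))
    calc _ ≤ ∫⁻ a in Metric.ball (0 : E d) (2 * R), g * volume (Set.Ioo 0 (R ^ 2)) := by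
          rw [← lintegral_indicator measurableSet_ball, ← lintegral_indicator measurableSet_ball]
          refine lintegral_mono_ae ?_
          filter_upwards [(Measure.ae_ne (volume : Measure (E d)) 0)] with a ha
          refine Set.indicator_le_indicator ?_
          rw [lintegral_lintegral_swap]
          swap
          · exact (hjoint.comp (by fun_prop : Measurable fun q : E d × ℝ =>
              (q.1, a, q.2))).aemeasurable
          rw [← setLIntegral_const]
          refine setLIntegral_mono' measurableSet_Ioo fun c hc => ?_
          refine le_trans (le_of_eq ?_) (hcon a ha c hc.1).le
          have hW : MeasurableSet {z | z ∈ U ∧ hyperRefl a c z ∈ V} :=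
            hU.inter ((measurePreserving_hyperRefl a c).measurable hV)
          rw [← lintegral_indicator_one hW]
          refine lintegral_congr fun z => ?_
          by_cases p : z ∈ U <;> by_cases q : hyperRefl a c z ∈ V <;> simp [p, q]
      _ = g * M := by rw [setLIntegral_const, hM, mul_assoc]
  exact absurd (hlow.trans hupp) (not_le.2 hg)

end FlatTorus

/-! ### Riesz's rearrangement inequality -/

namespace FlatTorus

open Filter Topology
open scoped Pointwise

variable {d : ℕ}

/-- Repeated polarization brings a set arbitrarily close to the ball of the same volume. -/
theorem exists_close_to_ball [NeZero d] {A : Set (E d)} (hA : MeasurableSet A) {R r : ℝ}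
    (hAR : A ⊆ Metric.ball 0 R) (hr : r ≤ R) (hvol : volume A = volume (Metric.ball (0 : E d) r))
    {φ : ℝ → ENNReal} (hφ : Antitone φ) {ε : ENNReal} (hε : 0 < ε) :
    ∃ A' : Set (E d), MeasurableSet A' ∧ A' ⊆ Metric.ball 0 R ∧
      interaction φ A ≤ interaction φ A' ∧ volume (A' \ Metric.ball 0 r) < ε := by
  set B : Set (E d) := Metric.ball 0 r
  have hB : MeasurableSet B := measurableSet_ball
  set C : Set (Set (E d)) := {A' | MeasurableSet A' ∧ A' ⊆ Metric.ball 0 R ∧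
    volume A' = volume B ∧ interaction φ A ≤ interaction φ A'} with hC
  set β : ENNReal := ⨅ A' ∈ C, volume (A' \ B) with hβ
  have hAC : A ∈ C := ⟨hA, hAR, hvol, le_rfl⟩
  have hBt : volume B ≠ ⊤ := measure_ball_lt_top.ne
  have hβt : β ≠ ⊤ := by
    refine ne_top_of_le_ne_top hBt ((iInf₂_le A hAC).trans ?_)
    exact (measure_mono Set.sdiff_subset).trans hvol.le
  have hβ0 : β = 0 := by
    by_contra hne
    -- If the infimum `β` of the excess over the ball were positive, a competitor with excess below
    -- `β + g` could be polarized once more, gaining at least `g` and falling below `β`.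
    obtain ⟨g, hg, hgain⟩ := exists_reflection_gain (d := d) R hne hβt
    have hlt : β < β + g := ENNReal.lt_add_right hβt hg.ne'
    obtain ⟨A', hA'C, hA'⟩ : ∃ A' ∈ C, volume (A' \ B) < β + g := by
      simpa [hβ, iInf_lt_iff] using hlt
    obtain ⟨hm, hsub, hv, hint⟩ := hA'C
    have hV : β ≤ volume (A' \ B) := iInf₂_le A' ⟨hm, hsub, hv, hint⟩
    have s1 := measure_inter_add_sdiff (μ := volume) A' hB
    have s2 := measure_inter_add_sdiff (μ := volume) B hm
    have hfin : volume (A' ∩ B) ≠ ⊤ :=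
      ne_top_of_le_ne_top hBt (measure_mono Set.inter_subset_right)
    -- Equal total volumes make the vacant part of the ball as large as the excess outside it.
    have hU : volume (B \ A') = volume (A' \ B) := by
      rw [Set.inter_comm, ← hv, ← s1] at s2
      exact (ENNReal.add_right_inj hfin).1 s2
    obtain ⟨a, ha, c, hc, hgc⟩ := hgain (B \ A') (A' \ B) (hB.diff hm) (hm.diff hB)
      (Set.sdiff_subset.trans (Metric.ball_subset_ball hr)) (Set.sdiff_subset.trans hsub)
      (fun z hz x hx => by
        have h1 := mem_ball_zero_iff.1 hz.1
        have h2 : r ≤ ‖x‖ := by simpa [B] using hx.2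
        linarith) (hU ▸ hV) hV
    have hP := volume_polarization_inter_ball ha hc.le hm r
    have hmP := measurableSet_polarization a c hm
    have hPC : polarization a c A' ∈ C := ⟨hmP, polarization_subset_ball ha hc.le hsub,
      (volume_polarization ha c hm).trans hv,
      hint.trans (interaction_le_polarization ha c hm hφ)⟩
    have s3 := measure_inter_add_sdiff (μ := volume) (polarization a c A') hB
    rw [volume_polarization ha c hm, ← s1] at s3
    have h4 : volume (A' ∩ B) + (volume (polarization a c A' \ B) + g) ≤
        volume (A' ∩ B) + volume (A' \ B) := by
      rw [← s3]
      calc _ = (volume (A' ∩ B) + g) + volume (polarization a c A' \ B) := by ring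
        _ ≤ _ := by
          gcongr
          exact (by gcongr : _ ≤ _).trans hP
    have h5 := (ENNReal.add_le_add_iff_left hfin).1 h4
    have hgt : g ≠ ⊤ := by
      intro h
      rw [h, add_top, top_le_iff] at h5
      exact ne_top_of_le_ne_top hBt ((measure_mono Set.sdiff_subset).trans hv.le) h5
    have h6 : volume (polarization a c A' \ B) < β :=
      (ENNReal.add_lt_add_iff_right hgt).1 (h5.trans_lt hA')
    exact absurd (iInf₂_le (polarization a c A') hPC) (not_le.2 h6)
  have : ⨅ A' ∈ C, volume (A' \ B) < ε := by rw [← hβ, hβ0]; exact hε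
  obtain ⟨A', hA'C, hA'⟩ : ∃ A' ∈ C, volume (A' \ B) < ε := by
    simpa [iInf_lt_iff] using this
  exact ⟨A', hA'C.1, hA'C.2.1, hA'C.2.2.2, hA'⟩

-- A pair from `A` that is not a pair from `B` has a member in `A \ B`, and each point interacts
-- with `A` by at most the kernel mass of the ball of radius `2R`.
open Set in
theorem interaction_le_add [NeZero d] {A B : Set (E d)} (hA : MeasurableSet A)
    (hB : MeasurableSet B) {R : ℝ} (hAR : A ⊆ Metric.ball 0 R) {φ : ℝ → ENNReal}
    (hφ : Measurable φ) :
    interaction φ A ≤ interaction φ B +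
      volume (A \ B) * (2 * ∫⁻ u in Metric.ball (0 : E d) (2 * R), φ ‖u‖) := by
  set S := A \ B
  have hS : MeasurableSet S := hA.diff hB
  set C := ∫⁻ u in Metric.ball (0 : E d) (2 * R), φ ‖u‖
  have ind : ∀ {T : Set (E d)}, MeasurableSet T → Measurable (T.indicator (1 : E d → ENNReal)) :=
    fun hT => measurable_one.indicator hT
  have hφm : Measurable fun p : E d × E d => φ ‖p.1 - p.2‖ := hφ.comp (by fun_prop)
  have hm : Measurable fun p : E d × E d => S.indicator 1 p.1 * A.indicator 1 p.2 *
      φ ‖p.1 - p.2‖ :=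
    (((ind hS).comp measurable_fst).mul ((ind hA).comp measurable_snd)).mul hφm
  have hmB : Measurable fun p : E d × E d => B.indicator 1 p.1 * B.indicator 1 p.2 *
      φ ‖p.1 - p.2‖ :=
    (((ind hB).comp measurable_fst).mul ((ind hB).comp measurable_snd)).mul hφm
  have h1 : ∫⁻ p : E d × E d, S.indicator 1 p.1 * A.indicator 1 p.2 * φ ‖p.1 - p.2‖ ≤
      volume S * C := by
    rw [Measure.volume_eq_prod, lintegral_prod _ hm.aemeasurable]
    rw [mul_comm, ← setLIntegral_const, ← lintegral_indicator hS]
    refine lintegral_mono fun x => ?_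
    by_cases hx : x ∈ S
    swap
    · simp [hx]
    simp only [indicator_of_mem hx, Pi.one_apply, one_mul]
    refine le_trans ?_ (lintegral_ball_le (fun u => φ ‖u‖) (hAR hx.1))
    rw [← lintegral_indicator measurableSet_ball]
    refine lintegral_mono fun y => ?_
    by_cases hy : y ∈ A
    · simp [indicator_of_mem hy, indicator_of_mem (hAR hy)]
    · simp [hy]
  have h2 : ∫⁻ p : E d × E d, S.indicator 1 p.2 * A.indicator 1 p.1 * φ ‖p.2 - p.1‖ ≤
      volume S * C := by
    refine le_trans (le_of_eq ?_) h1
    exact lintegral_prod_swap (μ := (volume : Measure (E d))) (ν := (volume : Measure (E d)))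
      (fun p : E d × E d => S.indicator 1 p.1 * A.indicator 1 p.2 * φ ‖p.1 - p.2‖)
  calc interaction φ A
      ≤ ∫⁻ p : E d × E d, (B.indicator 1 p.1 * B.indicator 1 p.2 * φ ‖p.1 - p.2‖ +
          (S.indicator 1 p.1 * A.indicator 1 p.2 * φ ‖p.1 - p.2‖ +
            S.indicator 1 p.2 * A.indicator 1 p.1 * φ ‖p.2 - p.1‖)) := by
        refine lintegral_mono fun p => ?_
        by_cases a1 : p.1 ∈ A <;> by_cases a2 : p.2 ∈ A <;> by_cases b1 : p.1 ∈ B <;>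
          by_cases b2 : p.2 ∈ B <;> simp [a1, a2, b1, b2, S, norm_sub_rev p.2 p.1]
    _ = _ := by
        rw [lintegral_add_left hmB, lintegral_add_left hm]
    _ ≤ interaction φ B + (volume S * C + volume S * C) := by
        gcongr
        exact le_rfl
    _ = _ := by ring

/-- Riesz's rearrangement inequality for the energy of a set. -/
theorem interaction_le_ball [NeZero d] {A : Set (E d)} (hA : MeasurableSet A) {R r : ℝ}
    (hAR : A ⊆ Metric.ball 0 R) (hr : r ≤ R) (hvol : volume A = volume (Metric.ball (0 : E d) r))
    {φ : ℝ → ENNReal} (hφ : Antitone φ)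
    (hfin : ∫⁻ u in Metric.ball (0 : E d) (2 * R), φ ‖u‖ ≠ ⊤) :
    interaction φ A ≤ interaction φ (Metric.ball (0 : E d) r) := by
  refine ENNReal.le_of_forall_pos_le_add fun ε hε _ => ?_
  obtain ⟨n, hn0, hn⟩ := ENNReal.exists_nnreal_pos_mul_lt
    (ENNReal.mul_ne_top (by simp : (2 : ENNReal) ≠ ⊤) hfin) (ENNReal.coe_ne_zero.2 hε.ne')
  obtain ⟨A', hm, hsub, hint, hlt⟩ := exists_close_to_ball hA hAR hr hvol hφ
    (ENNReal.coe_pos.2 hn0)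
  refine hint.trans ((interaction_le_add hm (measurableSet_ball (x := 0) (ε := r)) hsub
    hφ.measurable).trans ?_)
  gcongr
  exact (mul_le_mul_left hlt.le _).trans hn.le

/-- The Riesz kernel `r ↦ r^{-t}` with values in `[0, ∞]`. -/
noncomputable def ennPower (t r : ℝ) : ENNReal :=
  if r ≤ 0 then ⊤ else ENNReal.ofReal (1 / r ^ t)

theorem antitone_ennPower {t : ℝ} (ht : 0 < t) : Antitone (ennPower t) := by
  intro r r' h
  unfold ennPower
  by_cases h0 : r ≤ 0
  · simp [h0]
  · have h1 : ¬ r' ≤ 0 := by linarith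
    rw [if_neg h0, if_neg h1]
    push Not at h0 h1
    exact ENNReal.ofReal_le_ofReal (one_div_le_one_div_of_le (by positivity)
      (Real.rpow_le_rpow h0.le h ht.le))

theorem ennPower_norm {t : ℝ} {x : E d} (hx : x ≠ 0) :
    ennPower t ‖x‖ = ENNReal.ofReal (1 / ‖x‖ ^ t) :=
  if_neg (not_le.2 (norm_pos_iff.2 hx))

-- At distance zero the real kernel takes the value `1 / 0 = 0`, whereas `ennPower` is infinite
-- there, as monotonicity demands. The two differ only on the diagonal, a null set.
open Set in
theorem lintegral_nu_prod [NeZero d] (v : Basis (Fin d) ℝ (E d)) {D : Set (E d)}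
    (hD : MeasurableSet D) (t : ℝ) :
    ∫⁻ p in D ×ˢ D, ENNReal.ofReal (1 / ‖p.1 - p.2‖ ^ t) ∂((nu v).prod (nu v)) =
      ENNReal.ofReal (covol v ^ 2) * interaction (ennPower t) D := by
  rw [nu_prod_nu, Measure.restrict_smul, lintegral_smul_measure, smul_eq_mul,
    ← lintegral_indicator (hD.prod hD)]
  congr 1
  refine lintegral_congr_ae ?_
  filter_upwards [ae_prod_fst_ne_snd (volume : Measure (E d))] with p hp
  rw [ennPower_norm (sub_ne_zero.2 hp)]
  by_cases h1 : p.1 ∈ D <;> by_cases h2 : p.2 ∈ D <;> simp [indicator, h1, h2]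

theorem potential_le_ball [NeZero d] (v : Basis (Fin d) ℝ (E d)) {t : ℝ} (ht0 : 0 < t)
    (htd : t < d) {D : Set (E d)} (hD : MeasurableSet D) (hDb : Bornology.IsBounded D) {r : ℝ}
    (hvol : volume D = volume (Metric.ball (0 : E d) r)) :
    potential v D t ≤ potential v (Metric.ball (0 : E d) r) t := by
  have hpos : ∀ p : E d × E d, 0 ≤ 1 / ‖p.1 - p.2‖ ^ t := fun p => by positivity
  have hpot : ∀ {G : Set (E d)}, MeasurableSet G → potential v G t =
      (ENNReal.ofReal (covol v ^ 2) * interaction (ennPower t) G).toReal := by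
    intro G hG
    rw [← lintegral_nu_prod v hG, potential, integral_eq_lintegral_of_nonneg_ae
      (ae_of_all _ hpos)]
    exact Measurable.aestronglyMeasurable (by fun_prop)
  obtain ⟨M, hM⟩ := hDb.subset_ball 0
  have hfin : ENNReal.ofReal (covol v ^ 2) * interaction (ennPower t) (Metric.ball (0 : E d) r)
      ≠ ⊤ := by
    rw [← lintegral_nu_prod v measurableSet_ball]
    exact (integrableOn_nu_prod v htd Metric.isBounded_ball).lintegral_lt_top.ne
  rw [hpot hD, hpot measurableSet_ball]
  refine ENNReal.toReal_mono hfin ?_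
  refine mul_le_mul_right ?_ _
  refine interaction_le_ball hD (hM.trans (Metric.ball_subset_ball (le_max_left M r)))
    (le_max_right M r) hvol (antitone_ennPower ht0) ?_
  have h := (integrableOn_ball_one_div_norm_rpow (d := d) htd (2 * max M r)).lintegral_lt_top
  refine ne_of_eq_of_ne (lintegral_congr_ae ?_) h.ne
  filter_upwards [ae_restrict_of_ae (Measure.ae_ne (volume : Measure (E d)) 0)] with x hx
  exact ennPower_norm hx

end FlatTorus

/-! ### The asymptotic energy and the comparison with the ball -/

namespace FlatTorus

open Filter Topology

variable {d : ℕ}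

theorem volume_ballOf [NeZero d] {D : Set (E d)} (hD : Bornology.IsBounded D) :
    volume (ballOf D) = volume D := by
  have hd : (0 : ℝ) < d := by exact_mod_cast NeZero.pos d
  have hG : 0 < Real.Gamma ((d : ℝ) / 2 + 1) := Real.Gamma_pos_of_pos (by positivity)
  have hω : 0 < sphereArea d := by unfold sphereArea; positivity
  have hr : 0 ≤ d * volume.real D / sphereArea d := by positivity
  rw [ballOf, EuclideanSpace.volume_ball, Fintype.card_fin, ← ENNReal.ofReal_pow (by positivity),
    ← ENNReal.ofReal_mul (by positivity), one_div, Real.rpow_inv_natCast_pow hr (NeZero.ne d),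
    ← ofReal_measureReal hD.measure_lt_top.ne]
  congr 1
  have h : √Real.pi ^ d = Real.pi ^ ((d : ℝ) / 2) := by
    rw [Real.sqrt_eq_rpow, ← Real.rpow_mul_natCast Real.pi_pos.le]
    ring_nf
  have hp : 0 < Real.pi ^ ((d : ℝ) / 2) := by positivity
  rw [h, sphereArea]
  field_simp

theorem volume_real_pos {G : Set (E d)} (hGo : IsOpen G) (hG : Bornology.IsBounded G)
    (hne : G.Nonempty) : 0 < volume.real G :=
  ENNReal.toReal_pos (hGo.measure_pos volume hne).ne' hG.measure_lt_top.ne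

theorem nu_real_eq (v : Basis (Fin d) ℝ (E d)) (G : Set (E d)) :
    (nu v).real G = covol v * volume.real G := by
  rw [nu_eq, measureReal_ennreal_smul_apply, ENNReal.toReal_ofReal (covol_pos v).le]

/-- In the exact formula the quadratic terms cancel. Divided by `t_N^{1+s/d}`, the linear term
vanishes in the limit, and the pair sum converges because both it and `t_N^{1+s/d}` are
asymptotically multiples of `N^{1+s/d}`. -/
theorem hasAsymptoticEnergy_energyCoeff [NeZero d] (v : Basis (Fin d) ℝ (E d)) {s : ℝ}
    (hs : 0 < s) (hsd : s < d) {G : Set (E d)} (hGo : IsOpen G) (hG : Bornology.IsBounded G)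
    (hne : G.Nonempty) (hfr : volume (frontier G) = 0) :
    HasAsymptoticEnergy v G s (energyCoeff v G s) := by
  have hd : (0 : ℝ) < d := by exact_mod_cast NeZero.pos d
  set b : ℝ := covol v * volume.real G with hb
  have hb0 : 0 < b := mul_pos (covol_pos v) (volume_real_pos hGo hG hne)
  have hlim : Tendsto (fun N : ℕ => (trace v G N : ℝ) / N) atTop (𝓝 b) := by
    rw [hb, ← nu_real_eq]
    exact tendsto_trace_div v hGo hG hfr
  have htop : Tendsto (fun N => (trace v G N : ℝ)) atTop atTop := by
    have h := hlim.pos_mul_atTop hb0 (tendsto_natCast_atTop_atTop (R := ℝ))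
    refine h.congr' ?_
    filter_upwards [eventually_ne_atTop 0] with N hN
    field_simp
  refine ⟨fun N => exists_isProcess v hG N, tendsto_natCast_atTop_iff.1 htop, fun P hP => ?_⟩
  have hE := fun N => (hP N).energy hs hsd hG
  refine ⟨fun N => (hE N).1, ?_⟩
  set e : ℝ := 1 + s / d with he
  have he1 : 1 < e := by rw [he]; have : 0 < s / d := by positivity
                         linarith
  set k : ℝ := Real.pi ^ (s - (d : ℝ) / 2) * Real.Gamma ((d - s) / 2) /
    (Real.Gamma (s / 2) * covol v) with hk
  set S : ℕ → ℝ := fun N => ∑ w ∈ (finite_latticePoints v hG N).toFinset,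
    ∑ w' ∈ (finite_latticePoints v hG N).toFinset, 1 / ‖(w : E d) - (w' : E d)‖ ^ ((d : ℝ) - s)
    with hS
  set I := potential v G (d - s)
  have hSlim : Tendsto (fun N => S N / (N : ℝ) ^ e) atTop (𝓝 I) := by
    have h := tendsto_pair_sum_div v hGo hG hfr (t := d - s) (by linarith) (by linarith)
    have h2 : 2 - ((d : ℝ) - s) / d = e := by rw [he]; field_simp; ring
    rwa [h2] at h
  set n : ℕ → ℝ := fun N => (trace v G N : ℝ)
  have hn0 : ∀ N, 0 ≤ n N := fun N => Nat.cast_nonneg _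
  have hpow : Tendsto (fun N => (n N) ^ e / (N : ℝ) ^ e) atTop (𝓝 (b ^ e)) := by
    have h := hlim.rpow_const (p := e) (Or.inl hb0.ne')
    refine h.congr fun N => ?_
    exact Real.div_rpow (hn0 N) (Nat.cast_nonneg N) e
  have hratio : Tendsto (fun N => S N / (n N) ^ e) atTop (𝓝 (I / b ^ e)) := by
    have h := hSlim.div hpow (by positivity)
    refine h.congr' ?_
    filter_upwards [eventually_gt_atTop 0] with N hN
    have : (0 : ℝ) < (N : ℝ) ^ e := Real.rpow_pos_of_pos (by exact_mod_cast hN) _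
    exact div_div_div_cancel_right₀ this.ne' _ _
  have hsmall : Tendsto (fun N => n N / (n N) ^ e) atTop (𝓝 0) := by
    have h := (tendsto_rpow_neg_atTop (y := e - 1) (by linarith)).comp htop
    refine h.congr' ?_
    filter_upwards [htop.eventually_gt_atTop 0] with N hN
    change (n N) ^ (-(e - 1)) = _
    rw [neg_sub, Real.rpow_sub hN, Real.rpow_one]
  refine (Asymptotics.isLittleO_iff_tendsto' ?_).2 ?_
  · filter_upwards [htop.eventually_gt_atTop 0] with N hN h
    exact absurd h (Real.rpow_pos_of_pos hN _).ne'
  have h := ((hsmall.const_mul (leadingConst v s)).neg.sub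
    (hratio.const_mul k)).add_const (k * (I / b ^ e))
  rw [mul_zero, neg_zero, zero_sub, neg_add_cancel] at h
  refine h.congr' ?_
  filter_upwards [htop.eventually_gt_atTop 0] with N hN
  have hpos : 0 < (n N) ^ e := Real.rpow_pos_of_pos hN _
  rw [(hE N).2, energyCoeff]
  change -(leadingConst v s * (n N / n N ^ e)) - k * (S N / n N ^ e) + k * (I / b ^ e) =
    (leadingConst v s * (n N) ^ 2 - (leadingConst v s * n N + k * S N) -
      (leadingConst v s * (n N) ^ 2 + -k * (I / b ^ e) * (n N) ^ e)) / (n N) ^ e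
  generalize I / b ^ e = J
  field_simp
  ring

theorem energyCoeff_ballOf_le [NeZero d] (v : Basis (Fin d) ℝ (E d)) {s : ℝ} (hs : 0 < s)
    (hsd : s < d) {D : Set (E d)} (hDb : Bornology.IsBounded D)
    (hpot : potential v D (d - s) ≤ potential v (ballOf D) (d - s)) :
    energyCoeff v (ballOf D) s ≤ energyCoeff v D s := by
  have hvol : volume.real (ballOf D) = volume.real D := by
    rw [measureReal_def, volume_ballOf hDb, measureReal_def]
  have hc := covol_pos v
  have hG1 : 0 < Real.Gamma (s / 2) := Real.Gamma_pos_of_pos (by positivity)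
  have hG2 : 0 < Real.Gamma ((d - s) / 2) := Real.Gamma_pos_of_pos (by linarith)
  rw [energyCoeff, energyCoeff, hvol, neg_mul, neg_mul, neg_le_neg_iff]
  gcongr

end FlatTorus

theorem mainTheorem3 (d : ℕ) (v : Module.Basis (Fin d) ℝ (EuclideanSpace ℝ (Fin d)))
    (s : ℝ) (hs0 : 0 < s) (hsd : s < d)
    (D : Set (EuclideanSpace ℝ (Fin d))) (hDo : IsOpen D) (hDb : Bornology.IsBounded D) :
    (volume (FlatTorus.ballOf D) = volume D ∧
      IntegrableOn (fun p : EuclideanSpace ℝ (Fin d) × EuclideanSpace ℝ (Fin d) =>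
        1 / ‖p.1 - p.2‖ ^ ((d : ℝ) - s)) (D ×ˢ D) ((FlatTorus.nu v).prod (FlatTorus.nu v)) ∧
      FlatTorus.potential v D (d - s) ≤ FlatTorus.potential v (FlatTorus.ballOf D) (d - s)) ∧
    (D.Nonempty → volume (frontier D) = 0 →
      FlatTorus.HasAsymptoticEnergy v D s (FlatTorus.energyCoeff v D s) ∧
      FlatTorus.HasAsymptoticEnergy v (FlatTorus.ballOf D) s
        (FlatTorus.energyCoeff v (FlatTorus.ballOf D) s) ∧
      FlatTorus.energyCoeff v (FlatTorus.ballOf D) s ≤ FlatTorus.energyCoeff v D s) := by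
  have : NeZero d := ⟨by rintro rfl; rw [Nat.cast_zero] at hsd; linarith⟩
  have hvol := FlatTorus.volume_ballOf hDb
  have hpot : FlatTorus.potential v D (d - s) ≤
      FlatTorus.potential v (FlatTorus.ballOf D) (d - s) :=
    FlatTorus.potential_le_ball v (by linarith) (by linarith) hDo.measurableSet hDb hvol.symm
  refine ⟨⟨hvol, FlatTorus.integrableOn_nu_prod v (by linarith) hDb, hpot⟩, fun hne hfr => ?_⟩
  have hball : (FlatTorus.ballOf D).Nonempty :=
    nonempty_of_measure_ne_zero (hvol ▸ (hDo.measure_pos volume hne).ne')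
  refine ⟨FlatTorus.hasAsymptoticEnergy_energyCoeff v hs0 hsd hDo hDb hne hfr,
    FlatTorus.hasAsymptoticEnergy_energyCoeff v hs0 hsd Metric.isOpen_ball Metric.isBounded_ball
      -- The boundary of the ball is null by convexity.
      hball ((convex_ball _ _).addHaar_frontier volume),
    FlatTorus.energyCoeff_ballOf_le v hs0 hsd hDb hpot⟩
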